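/- **Setting.** Let $T$ be a finite-dimensional first-order theory: to every interpretable set (with parameters) $X$ of every model of $T$ there is attached $\dim X\in\omega\cup\{-\infty\}$ such that: $\dim\varphi(x,a)=\dim\varphi(x,a')$ if $a,a'$ have the same type over $\emptyset$; $\dim\emptyset=-\infty$, and for $X\neq\emptyset$, $\dim X=0$ iff $X$ is finite; $\dim(X\cup Y)=\max(\dim X,\dim Y)$; and for every interpretable function $f:X\to Y$ and $k\in\omega$, if all fibres of $f$ have dimension $\ge k$ (resp. $\le k$) then $\dim X\ge\dim Y+k$ (resp. $\dim X\le\dim Y+k$). Let $\mathcal M$ be a sufficiently saturated model of $T$, i.e. $\kappa$-saturated for some cardinal $\kappa>|L|+\aleph_0$, and let $A$ be an abelian group definable in $\mathcal M$. An *endogeny* of $A$ is a subgroup $\varphi\le A\times A$ which is total (for every $a$ the set $\varphi[a]=\{b:(a,b)\in\varphi\}$ is non-empty) and whose *katakernel* $\operatorname{kat}(\varphi)=\varphi[0]$ is finite. Put $(\varphi+\psi)[a]=\varphi[a]+\psi[a]$, $(-\varphi)[a]=-\varphi[a]$ and $(\varphi\psi)[a]=\varphi[\psi[a]]$. Write $\varphi\sim\psi$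 if $(\varphi-\psi)[A]$ is finite; then $\operatorname{Endog}(A)/{\sim}$ is a ring. A *pre-ring of endogenies* is a set of endogenies containing $0$ and $\mathrm{Id}$ and closed under sum, opposite and product; for such $\Gamma$, $\Gamma/{\sim}$ is a subring of $\operatorname{Endog}(A)/{\sim}$. Two endogenies *sharply commute* if $(\varphi\psi-\psi\varphi)[A]\le\operatorname{kat}(\varphi)+\operatorname{kat}(\psi)$, and $C^{\#}(\Gamma)$ is the set of definable endogenies which sharply commute with all elements of $\Gamma$. A subgroup $B\le A$ is *almost $\Gamma$-invariant* if $\gamma[B]\cap B$ has finite index in $\gamma[B]$ for all $\gamma\in\Gamma$; $A$ is *absolutely $(\Gamma,\Delta)$-minimal* if no infinite definable almost $(\Gamma\cup\Delta)$-invariant subgroup has infinite index in $A$. A set $\Gamma$ of definable endogenies is *invariant* over $X\subseteq\mathcal M$ if whether a formula $\varphi(x,y,b)$ defines an element of $\Gamma$ depends only on $\varphi$ and the type of $b$ over $X$; in an elementary extension $\mathcal N\succeq\mathcal M$ the same formulas and types define a set $\Gamma(\mathcal N)$ of endogenies of $A(\mathcal N)$. $\Gamma$ is *essentially unbounded* if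 for every cardinal $\mu$ there is $\mathcal N\succeq\mathcal M$ with $|\Gamma(\mathcal N)/{\sim}|>\mu$, and *essentially infinite* if $\Gamma/{\sim}$ is infinite. Finally $\operatorname{Kat}(\Gamma,\Delta)=\sum_{\gamma\in\Gamma}\operatorname{kat}(\gamma)+\sum_{\delta\in\Delta}\operatorname{kat}(\delta)$. **Theorem B.** Let $\Gamma,\Delta$ be two pre-rings of definable endogenies of $A$, invariant over a set $X$ with $|X|<\kappa$, such that - $C^{\#}(\Gamma)=\Delta$ and $C^{\#}(\Delta)=\Gamma$; - $A$ is absolutely $(\Gamma,\Delta)$-minimal; - $\Gamma$ is essentially unbounded and $\Delta$ is essentially infinite, or vice versa. Let $A_0=\operatorname{Kat}(\Gamma,\Delta)$. Then $\Gamma/{\sim}$ and $\Delta/{\sim}$ act on $A/A_0$ by $[\varphi](a+A_0)=\varphi[a]+A_0$ for $\varphi\in\Gamma\cup\Delta$, and there is an infinite definable (commutative) field $K$, a subring of $\operatorname{Endog}(A)/{\sim}$ contained in $(\Gamma/{\sim})\cap(\Delta/{\sim})$, such that $A/A_0$, with the induced action of $K$, is a finite-dimensional $K$-vector space on which $\Gamma/{\sim}$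 and $\Delta/{\sim}$ act $K$-linearly. Here "definable" means that the elements of $K$ are the classes of a uniformly definable family of endogenies indexed by a definable set, and that equality, addition and multiplication of these classes are definable in the index set. -/

import Mathlib

open FirstOrder Cardinal

universe u v w

namespace Endogenies

/-! ### Endogenies of an abelian group -/

/-- An endogeny of an abelian group `A`: a total additive relation on `A` whose katakernel
`{b | (0, b) ∈ φ}` is finite. -/
@[ext]
structure Endogeny (A : Type*) [AddCommGroup A] where
  graph : AddSubgroup (A × A)
  total : ∀ a, ∃ b, (a, b) ∈ graph
  finite_kat : {b | (0, b) ∈ graph}.Finite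

namespace Endogeny

variable {A : Type*} [AddCommGroup A]

/-- The katakernel of an endogeny. -/
def kat (φ : Endogeny A) : AddSubgroup A where
  carrier := {b | (0, b) ∈ φ.graph}
  zero_mem' := φ.graph.zero_mem
  add_mem' {a b} ha hb := by simpa using φ.graph.add_mem ha hb
  neg_mem' {a} ha := by simpa using φ.graph.neg_mem ha

/-- The image `φ[B]` of a subgroup under an endogeny. -/
def image (φ : Endogeny A) (B : AddSubgroup A) : AddSubgroup A where
  carrier := {b | ∃ a ∈ B, (a, b) ∈ φ.graph}
  zero_mem' := ⟨0, B.zero_mem, φ.graph.zero_mem⟩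
  add_mem' := by
    rintro b c ⟨a, ha, hab⟩ ⟨d, hd, hdc⟩
    exact ⟨a + d, B.add_mem ha hd, φ.graph.add_mem hab hdc⟩
  neg_mem' := by
    rintro b ⟨a, ha, hab⟩
    exact ⟨-a, B.neg_mem ha, φ.graph.neg_mem hab⟩

theorem sub_mem_kat (φ : Endogeny A) {a b c : A} (hb : (a, b) ∈ φ.graph)
    (hc : (a, c) ∈ φ.graph) : (0, b - c) ∈ φ.graph := by
  simpa using φ.graph.sub_mem hb hc

/-- The image of a finite set under an endogeny is finite. -/
theorem finite_image (φ : Endogeny A) {F : Set A} (hF : F.Finite) :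
    {c | ∃ z ∈ F, (z, c) ∈ φ.graph}.Finite := by
  have h : {c | ∃ z ∈ F, (z, c) ∈ φ.graph} = ⋃ z ∈ F, {c | (z, c) ∈ φ.graph} := by
    ext c; simp
  rw [h]
  refine hF.biUnion fun z _ => ?_
  obtain ⟨b, hb⟩ := φ.total z
  refine (φ.finite_kat.image fun k => k + b).subset fun c hc => ?_
  exact ⟨c - b, φ.sub_mem_kat hc hb, by simp⟩

instance : Zero (Endogeny A) where
  zero :=
    { graph :=
        { carrier := {p | p.2 = 0}
          zero_mem' := rfl
          add_mem' := by rintro ⟨a, b⟩ ⟨c, d⟩ h h'; simp_all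
          neg_mem' := by rintro ⟨a, b⟩ h; simp_all }
      total := fun _ => ⟨0, rfl⟩
      finite_kat := Set.finite_singleton (0 : A) }

instance : One (Endogeny A) where
  one :=
    { graph :=
        { carrier := {p | p.2 = p.1}
          zero_mem' := rfl
          add_mem' := by rintro ⟨a, b⟩ ⟨c, d⟩ h h'; simp_all
          neg_mem' := by rintro ⟨a, b⟩ h; simp_all }
      total := fun a => ⟨a, rfl⟩
      finite_kat := Set.finite_singleton (0 : A) }

/-- The sum: `(φ + ψ)[a] = φ[a] + ψ[a]`. -/
instance : Add (Endogeny A) where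
  add φ ψ :=
    { graph :=
        { carrier := {p | ∃ b₁ b₂, (p.1, b₁) ∈ φ.graph ∧ (p.1, b₂) ∈ ψ.graph ∧ b₁ + b₂ = p.2}
          zero_mem' := ⟨0, 0, φ.graph.zero_mem, ψ.graph.zero_mem, by simp⟩
          add_mem' := by
            rintro ⟨a, b⟩ ⟨c, d⟩ ⟨b₁, b₂, h₁, h₂, h⟩ ⟨d₁, d₂, k₁, k₂, k⟩
            refine ⟨b₁ + d₁, b₂ + d₂, φ.graph.add_mem h₁ k₁, ψ.graph.add_mem h₂ k₂, ?_⟩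
            simp only [Prod.mk_add_mk] at *
            rw [← h, ← k]; abel
          neg_mem' := by
            rintro ⟨a, b⟩ ⟨b₁, b₂, h₁, h₂, h⟩
            refine ⟨-b₁, -b₂, φ.graph.neg_mem h₁, ψ.graph.neg_mem h₂, ?_⟩
            simp only [Prod.neg_mk] at *
            rw [← h]; abel }
      total := fun a => by
        obtain ⟨b, hb⟩ := φ.total a
        obtain ⟨c, hc⟩ := ψ.total a
        exact ⟨b + c, b, c, hb, hc, rfl⟩
      finite_kat := by
        refine (Set.Finite.image2 (fun x y => x + y) φ.finite_kat ψ.finite_kat).subset ?_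
        rintro b ⟨b₁, b₂, h₁, h₂, h⟩
        exact ⟨b₁, h₁, b₂, h₂, h⟩ }

/-- The opposite: `(-φ)[a] = -(φ[a])`. -/
instance : Neg (Endogeny A) where
  neg φ :=
    { graph :=
        { carrier := {p | (p.1, -p.2) ∈ φ.graph}
          zero_mem' := by
            change ((0 : A), -(0 : A)) ∈ φ.graph
            rw [neg_zero]; exact φ.graph.zero_mem
          add_mem' := by
            rintro ⟨a, b⟩ ⟨c, d⟩ h h'
            simpa [add_comm] using φ.graph.add_mem h h'
          neg_mem' := by
            rintro ⟨a, b⟩ h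
            simpa using φ.graph.neg_mem h }
      total := fun a => by
        obtain ⟨b, hb⟩ := φ.total a
        exact ⟨-b, by simpa using hb⟩
      finite_kat := by
        refine (φ.finite_kat.image fun x => -x).subset fun b hb => ⟨-b, hb, by simp⟩ }

instance : Sub (Endogeny A) where
  sub φ ψ := φ + -ψ

/-- The product is the composition of relations: `(φ * ψ)[a] = φ[ψ[a]]`. -/
instance : Mul (Endogeny A) where
  mul φ ψ :=
    { graph :=
        { carrier := {p | ∃ z, (p.1, z) ∈ ψ.graph ∧ (z, p.2) ∈ φ.graph}
          zero_mem' := ⟨0, ψ.graph.zero_mem, φ.graph.zero_mem⟩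
          add_mem' := by
            rintro ⟨a, b⟩ ⟨c, d⟩ ⟨z, h₁, h₂⟩ ⟨y, k₁, k₂⟩
            exact ⟨z + y, ψ.graph.add_mem h₁ k₁, φ.graph.add_mem h₂ k₂⟩
          neg_mem' := by
            rintro ⟨a, b⟩ ⟨z, h₁, h₂⟩
            exact ⟨-z, ψ.graph.neg_mem h₁, φ.graph.neg_mem h₂⟩ }
      total := fun a => by
        obtain ⟨b, hb⟩ := ψ.total a
        obtain ⟨c, hc⟩ := φ.total b
        exact ⟨c, b, hb, hc⟩
      finite_kat := φ.finite_image ψ.finite_kat }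

theorem mem_zero {a b : A} : (a, b) ∈ (0 : Endogeny A).graph ↔ b = 0 := Iff.rfl

theorem mem_one {a b : A} : (a, b) ∈ (1 : Endogeny A).graph ↔ b = a := Iff.rfl

theorem mem_add {φ ψ : Endogeny A} {a b : A} : (a, b) ∈ (φ + ψ).graph ↔
    ∃ b₁ b₂, (a, b₁) ∈ φ.graph ∧ (a, b₂) ∈ ψ.graph ∧ b₁ + b₂ = b := Iff.rfl

theorem mem_neg {φ : Endogeny A} {a b : A} : (a, b) ∈ (-φ).graph ↔ (a, -b) ∈ φ.graph := Iff.rfl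

theorem mem_mul {φ ψ : Endogeny A} {a b : A} : (a, b) ∈ (φ * ψ).graph ↔
    ∃ z, (a, z) ∈ ψ.graph ∧ (z, b) ∈ φ.graph := Iff.rfl

/-- `φ ∼ ψ` when `(φ - ψ)[A]` is finite. -/
def Equivalent (φ ψ : Endogeny A) : Prop := ((φ - ψ).image ⊤ : Set A).Finite

theorem equivalent_iff {φ ψ : Endogeny A} : Equivalent φ ψ ↔
    ∃ F : Set A, F.Finite ∧ ∀ a b c, (a, b) ∈ φ.graph → (a, c) ∈ ψ.graph → b - c ∈ F := by
  constructor
  · intro h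
    refine ⟨_, h, fun a b c hb hc => ?_⟩
    refine ⟨a, AddSubgroup.mem_top a, b, -c, hb, ?_, (sub_eq_add_neg b c).symm⟩
    rw [mem_neg, neg_neg]; exact hc
  · rintro ⟨F, hF, h⟩
    refine hF.subset ?_
    rintro x ⟨a, -, b, c, hb, hc, hx⟩
    change b + c = x at hx
    have h' := h a b (-c) hb hc
    rw [sub_neg_eq_add] at h'
    exact hx ▸ h'

theorem equivalent_of_le {φ ψ : Endogeny A}
    (h : ∀ a b, (a, b) ∈ φ.graph → (a, b) ∈ ψ.graph) : Equivalent φ ψ :=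
  equivalent_iff.2 ⟨_, ψ.finite_kat, fun a b _ hb hc => ψ.sub_mem_kat (h a b hb) hc⟩

theorem Equivalent.symm {φ ψ : Endogeny A} (h : Equivalent φ ψ) : Equivalent ψ φ := by
  obtain ⟨F, hF, h⟩ := equivalent_iff.1 h
  refine equivalent_iff.2 ⟨_, hF.image fun x => -x, fun a b c hb hc => ?_⟩
  exact ⟨c - b, h a c b hc hb, by simp⟩

theorem Equivalent.trans {φ ψ χ : Endogeny A} (h : Equivalent φ ψ) (h' : Equivalent ψ χ) :
    Equivalent φ χ := by
  obtain ⟨F, hF, h⟩ := equivalent_iff.1 h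
  obtain ⟨G, hG, h'⟩ := equivalent_iff.1 h'
  refine equivalent_iff.2 ⟨_, Set.Finite.image2 (fun x y => x + y) hF hG, fun a b c hb hc => ?_⟩
  obtain ⟨d, hd⟩ := ψ.total a
  exact ⟨b - d, h a b d hb hd, d - c, h' a d c hd hc, by simp⟩

instance setoid (A : Type*) [AddCommGroup A] : Setoid (Endogeny A) where
  r := Equivalent
  iseqv := ⟨fun _ => equivalent_of_le fun _ _ h => h, fun h => h.symm, fun h h' => h.trans h'⟩

theorem Equivalent.add {φ φ' ψ ψ' : Endogeny A} (h : Equivalent φ φ') (h' : Equivalent ψ ψ') :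
    Equivalent (φ + ψ) (φ' + ψ') := by
  obtain ⟨F, hF, h⟩ := equivalent_iff.1 h
  obtain ⟨G, hG, h'⟩ := equivalent_iff.1 h'
  refine equivalent_iff.2 ⟨_, Set.Finite.image2 (fun x y => x + y) hF hG, ?_⟩
  rintro a b c ⟨b₁, b₂, hb₁, hb₂, rfl⟩ ⟨c₁, c₂, hc₁, hc₂, rfl⟩
  exact ⟨_, h a b₁ c₁ hb₁ hc₁, _, h' a b₂ c₂ hb₂ hc₂, by dsimp only; abel⟩

theorem Equivalent.neg {φ φ' : Endogeny A} (h : Equivalent φ φ') : Equivalent (-φ) (-φ') := by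
  obtain ⟨F, hF, h⟩ := equivalent_iff.1 h
  refine equivalent_iff.2 ⟨_, hF.image fun x => -x, fun a b c hb hc => ?_⟩
  exact ⟨_, h a (-b) (-c) hb hc, by dsimp only; abel⟩

theorem Equivalent.mul {φ φ' ψ ψ' : Endogeny A} (h : Equivalent φ φ') (h' : Equivalent ψ ψ') :
    Equivalent (φ * ψ) (φ' * ψ') := by
  obtain ⟨F, hF, h⟩ := equivalent_iff.1 h
  obtain ⟨G, hG, h'⟩ := equivalent_iff.1 h'
  refine equivalent_iff.2
    ⟨_, Set.Finite.image2 (fun x y => x + y) (φ.finite_image hG) hF, ?_⟩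
  rintro a b c ⟨z, hz, hb⟩ ⟨y, hy, hc⟩
  obtain ⟨d, hd⟩ := φ.total y
  refine ⟨b - d, ⟨z - y, h' a z y hz hy, φ.graph.sub_mem hb hd⟩, d - c, h y d c hd hc, ?_⟩
  simp

end Endogeny

/-- The quotient `Endog(A)/∼`. -/
def EndogRing (A : Type*) [AddCommGroup A] : Type _ := Quotient (Endogeny.setoid A)

namespace EndogRing

open Endogeny

variable {A : Type*} [AddCommGroup A]

/-- The class of an endogeny. -/
def mk (φ : Endogeny A) : EndogRing A := Quotient.mk _ φ

theorem mk_eq_mk {φ ψ : Endogeny A} : mk φ = mk ψ ↔ Equivalent φ ψ := Quotient.eq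

instance : Zero (EndogRing A) := ⟨mk 0⟩

instance : One (EndogRing A) := ⟨mk 1⟩

instance : Add (EndogRing A) := ⟨Quotient.map₂ (· + ·) fun _ _ h _ _ h' => Equivalent.add h h'⟩

instance : Neg (EndogRing A) := ⟨Quotient.map (- ·) fun _ _ h => Equivalent.neg h⟩

instance : Mul (EndogRing A) := ⟨Quotient.map₂ (· * ·) fun _ _ h _ _ h' => Equivalent.mul h h'⟩

theorem mk_zero : mk (0 : Endogeny A) = 0 := rfl

theorem mk_one : mk (1 : Endogeny A) = 1 := rfl

theorem mk_add (φ ψ : Endogeny A) : mk (φ + ψ) = mk φ + mk ψ := rfl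

theorem mk_neg (φ : Endogeny A) : mk (-φ) = -mk φ := rfl

theorem mk_mul (φ ψ : Endogeny A) : mk (φ * ψ) = mk φ * mk ψ := rfl

theorem mk_eq_of_le {φ ψ : Endogeny A}
    (h : ∀ a b, (a, b) ∈ φ.graph → (a, b) ∈ ψ.graph) : mk φ = mk ψ :=
  mk_eq_mk.2 (equivalent_of_le h)

instance : Ring (EndogRing A) where
  add_assoc := by
    rintro ⟨φ⟩ ⟨ψ⟩ ⟨χ⟩
    refine mk_eq_of_le ?_
    rintro a b ⟨x, z, ⟨x', y, hx, hy, rfl⟩, hz, rfl⟩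
    exact ⟨x', y + z, hx, ⟨y, z, hy, hz, rfl⟩, (add_assoc x' y z).symm⟩
  zero_add := by
    rintro ⟨φ⟩
    refine mk_eq_of_le ?_
    rintro a b ⟨x, y, hx, hy, rfl⟩
    obtain rfl : x = 0 := hx
    simpa using hy
  add_zero := by
    rintro ⟨φ⟩
    refine mk_eq_of_le ?_
    rintro a b ⟨x, y, hx, hy, rfl⟩
    obtain rfl : y = 0 := hy
    simpa using hx
  add_comm := by
    rintro ⟨φ⟩ ⟨ψ⟩
    refine mk_eq_of_le ?_
    rintro a b ⟨x, y, hx, hy, rfl⟩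
    exact ⟨y, x, hy, hx, add_comm y x⟩
  neg_add_cancel := by
    rintro ⟨φ⟩
    refine (mk_eq_of_le ?_).symm
    intro a b hb
    obtain rfl : b = 0 := hb
    obtain ⟨x, hx⟩ := φ.total a
    exact ⟨-x, x, by rw [mem_neg, neg_neg]; exact hx, hx, neg_add_cancel x⟩
  mul_assoc := by
    rintro ⟨φ⟩ ⟨ψ⟩ ⟨χ⟩
    refine mk_eq_of_le ?_
    rintro a b ⟨x, hx, y, hy, hb⟩
    exact ⟨y, ⟨x, hx, hy⟩, hb⟩
  one_mul := by
    rintro ⟨φ⟩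
    refine mk_eq_of_le ?_
    rintro a b ⟨x, hx, hb⟩
    obtain rfl : b = x := hb
    exact hx
  mul_one := by
    rintro ⟨φ⟩
    refine mk_eq_of_le ?_
    rintro a b ⟨x, hx, hb⟩
    obtain rfl : x = a := hx
    exact hb
  left_distrib := by
    rintro ⟨δ⟩ ⟨φ⟩ ⟨ψ⟩
    refine (mk_eq_of_le ?_).symm
    rintro a b ⟨x, y, ⟨c, hc, hx⟩, ⟨d, hd, hy⟩, rfl⟩
    exact ⟨c + d, ⟨c, d, hc, hd, rfl⟩, δ.graph.add_mem hx hy⟩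
  right_distrib := by
    rintro ⟨φ⟩ ⟨ψ⟩ ⟨δ⟩
    refine mk_eq_of_le ?_
    rintro a b ⟨z, hz, x, y, hx, hy, rfl⟩
    exact ⟨x, y, ⟨z, hz, hx⟩, ⟨z, hz, hy⟩, rfl⟩
  zero_mul := by
    rintro ⟨φ⟩
    refine mk_eq_of_le ?_
    rintro a b ⟨z, _, hb⟩
    exact hb
  mul_zero := by
    rintro ⟨φ⟩
    refine (mk_eq_of_le ?_).symm
    intro a b hb
    obtain rfl : b = 0 := hb
    exact ⟨0, rfl, φ.graph.zero_mem⟩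
  nsmul := nsmulRec
  zsmul := zsmulRec

end EndogRing

/-- A pre-subring of `Endog(A)`, that is a pre-ring of endogenies of `A`. -/
structure PreSubring (A : Type*) [AddCommGroup A] where
  carrier : Set (Endogeny A)
  zero_mem : 0 ∈ carrier
  one_mem : 1 ∈ carrier
  add_mem : ∀ {φ ψ}, φ ∈ carrier → ψ ∈ carrier → φ + ψ ∈ carrier
  neg_mem : ∀ {φ}, φ ∈ carrier → -φ ∈ carrier
  mul_mem : ∀ {φ ψ}, φ ∈ carrier → ψ ∈ carrier → φ * ψ ∈ carrier

section Algebra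

variable {A : Type*} [AddCommGroup A]

/-- `Γ/∼`, as a subring of `Endog(A)/∼`. -/
def PreSubring.quot (Γ : PreSubring A) : Subring (EndogRing A) where
  carrier := EndogRing.mk '' Γ.carrier
  zero_mem' := ⟨0, Γ.zero_mem, rfl⟩
  one_mem' := ⟨1, Γ.one_mem, rfl⟩
  add_mem' := by
    rintro _ _ ⟨φ, hφ, rfl⟩ ⟨ψ, hψ, rfl⟩
    exact ⟨φ + ψ, Γ.add_mem hφ hψ, rfl⟩
  neg_mem' := by
    rintro _ ⟨φ, hφ, rfl⟩
    exact ⟨-φ, Γ.neg_mem hφ, rfl⟩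
  mul_mem' := by
    rintro _ _ ⟨φ, hφ, rfl⟩ ⟨ψ, hψ, rfl⟩
    exact ⟨φ * ψ, Γ.mul_mem hφ hψ, rfl⟩

/-- `φ` and `ψ` sharply commute: `(φψ - ψφ)[A] ≤ kat φ + kat ψ`. -/
def SharplyCommute (φ ψ : Endogeny A) : Prop :=
  (φ * ψ - ψ * φ).image ⊤ ≤ φ.kat ⊔ ψ.kat

/-- `B` is almost `X`-invariant: for `γ ∈ X`, `γ[B] ∩ B` has finite index in `γ[B]`. -/
def AlmostInvariant (X : Set (Endogeny A)) (B : AddSubgroup A) : Prop :=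
  ∀ γ ∈ X, (B.addSubgroupOf (γ.image B)).FiniteIndex

/-- The global katakernel `Kat(Γ)`: the sum of the katakernels of the elements of `Γ`. -/
def Kat (Γ : PreSubring A) : AddSubgroup A := ⨆ γ ∈ Γ.carrier, γ.kat

/-- The global bikatakernel `Kat(Γ, Δ)`. -/
def BiKat (Γ Δ : PreSubring A) : AddSubgroup A := Kat Γ ⊔ Kat Δ

/-- Multiplication by the ring `S` of classes of endogenies on `A/A₀` is the action induced by
the endogenies in `X`: if `γ ∈ X` has its class in `S`, then `[γ] • (a + A₀) = γ[a] + A₀`. -/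
def IsInducedAction (X : Set (Endogeny A)) (A₀ : AddSubgroup A) (S : Subring (EndogRing A))
    [Module S (A ⧸ A₀)] : Prop :=
  ∀ γ ∈ X, ∀ s : S, (s : EndogRing A) = EndogRing.mk γ → ∀ a b : A, (a, b) ∈ γ.graph →
    s • (a : A ⧸ A₀) = (b : A ⧸ A₀)

end Algebra

/-! ### Finite-dimensional theories -/

/-- An interpretable set of a structure `N`: the quotient of a definable subset of `N ^ n` by a
definable equivalence relation, presented by a definable (with parameters) symmetric and
transitive relation on `N ^ n`, whose domain is `{x | E x x}`. -/
structure InterpSet (L : FirstOrder.Language.{u, v}) (N : Type w) [L.Structure N] (n : ℕ) where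
  E : (Fin n → N) → (Fin n → N) → Prop
  symm : ∀ {x y}, E x y → E y x
  trans : ∀ {x y z}, E x y → E y z → E x z
  definable : (Set.univ : Set N).Definable L
    {p : Fin n ⊕ Fin n → N | E (p ∘ Sum.inl) (p ∘ Sum.inr)}

namespace InterpSet

variable {L : FirstOrder.Language.{u, v}} {N : Type w} [L.Structure N] {n m : ℕ}

/-- The equivalence relation on the domain. -/
def setoid (X : InterpSet L N n) : Setoid {x // X.E x x} where
  r x y := X.E x y
  iseqv := ⟨fun x => x.2, fun h => X.symm h, fun h h' => X.trans h h'⟩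

/-- The points of an interpretable set. -/
def Pt (X : InterpSet L N n) : Type w := Quotient X.setoid

/-- `X` is an interpretable subset of `Z`. -/
def IsSubset (X Z : InterpSet L N n) : Prop := ∀ x y, X.E x y ↔ Z.E x y ∧ X.E x x

/-- An interpretable function from `X` to `Y`, given by its (definable) pullback
`F = {(x, y) | f [x] = [y]}`. -/
structure Fun (X : InterpSet L N n) (Y : InterpSet L N m) where
  F : (Fin n → N) → (Fin m → N) → Prop
  dom : ∀ {x y}, F x y → X.E x x ∧ Y.E y y
  congr : ∀ {x x' y y'}, X.E x x' → Y.E y y' → F x y → F x' y'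
  total : ∀ {x}, X.E x x → ∃ y, F x y
  unique : ∀ {x y y'}, F x y → F x y' → Y.E y y'
  definable : (Set.univ : Set N).Definable L
    {p : Fin n ⊕ Fin m → N | F (p ∘ Sum.inl) (p ∘ Sum.inr)}

/-- The fibre of an interpretable function over the class of `y`. -/
def Fun.fiber {X : InterpSet L N n} {Y : InterpSet L N m} (f : Fun X Y) (y : Fin m → N) :
    InterpSet L N n where
  E x x' := X.E x x' ∧ f.F x y
  symm h := ⟨X.symm h.1, f.congr h.1 (f.dom h.2).2 h.2⟩
  trans h h' := ⟨X.trans h.1 h'.1, h.2⟩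
  definable := by
    refine X.definable.inter ?_
    have h : (Set.univ : Set N).DefinableMap L
        (fun p : Fin n ⊕ Fin n → N => (Sum.elim (p ∘ Sum.inl) y : Fin n ⊕ Fin m → N)) := by
      rintro (i | i)
      · exact Set.DefinableFun.proj L (i := Sum.inl i)
      · exact FirstOrder.Language.definableFun_const L _ (Set.mem_univ (y i))
    exact Set.Definable.preimage_map h f.definable

end InterpSet

/-- A dimension on the interpretable sets of all models of `T`. -/
structure Dimension {L : FirstOrder.Language.{u, v}} (T : L.Theory) where
  dim : (N : FirstOrder.Language.Theory.ModelType.{u, v, w} T) → {n : ℕ} → InterpSet L N n → WithBot ℕ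
  /-- The dimension of a set in a definable family depends on the type of the parameter only. -/
  invariant : ∀ (N N' : FirstOrder.Language.Theory.ModelType.{u, v, w} T) {n k : ℕ}
    (ε : L.Formula ((Fin n ⊕ Fin n) ⊕ Fin k)) (a : Fin k → N) (a' : Fin k → N')
    (X : InterpSet L N n) (X' : InterpSet L N' n),
    (∀ ψ : L.Formula (Fin k), ψ.Realize a ↔ ψ.Realize a') →
    (∀ x y, X.E x y ↔ ε.Realize (Sum.elim (Sum.elim x y) a)) →
    (∀ x y, X'.E x y ↔ ε.Realize (Sum.elim (Sum.elim x y) a')) →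
    dim N X = dim N' X'
  dim_empty : ∀ (N : FirstOrder.Language.Theory.ModelType.{u, v, w} T) {n : ℕ} (X : InterpSet L N n),
    IsEmpty X.Pt → dim N X = ⊥
  dim_eq_zero : ∀ (N : FirstOrder.Language.Theory.ModelType.{u, v, w} T) {n : ℕ} (X : InterpSet L N n),
    Nonempty X.Pt → (dim N X = 0 ↔ Finite X.Pt)
  dim_union : ∀ (N : FirstOrder.Language.Theory.ModelType.{u, v, w} T) {n : ℕ} (X Y Z : InterpSet L N n),
    X.IsSubset Z → Y.IsSubset Z → (∀ x, Z.E x x → X.E x x ∨ Y.E x x) →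
    dim N Z = max (dim N X) (dim N Y)
  le_dim : ∀ (N : FirstOrder.Language.Theory.ModelType.{u, v, w} T) {n m : ℕ} (X : InterpSet L N n)
    (Y : InterpSet L N m) (f : X.Fun Y) (k : ℕ),
    (∀ y, Y.E y y → (k : WithBot ℕ) ≤ dim N (f.fiber y)) → dim N Y + k ≤ dim N X
  dim_le : ∀ (N : FirstOrder.Language.Theory.ModelType.{u, v, w} T) {n m : ℕ} (X : InterpSet L N n)
    (Y : InterpSet L N m) (f : X.Fun Y) (k : ℕ),
    (∀ y, Y.E y y → dim N (f.fiber y) ≤ (k : WithBot ℕ)) → dim N X ≤ dim N Y + k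

/-- `T` is finite-dimensional (its models being taken in the universe `w`). -/
def FiniteDimensionalTheory {L : FirstOrder.Language.{u, v}} (T : L.Theory) : Prop :=
  Nonempty (Dimension.{u, v, w} T)

/-! ### Definable groups, invariant families, saturation -/

section Definability

variable (L : FirstOrder.Language.{u, v}) {M : Type w} [L.Structure M]

/-- `M` is `κ`-saturated: a set of formulas in one variable over fewer than `κ` parameters
that is finitely satisfiable in `M` is realized in `M`. -/
def IsSaturated (M : Type w) [L.Structure M] (κ : Cardinal.{w}) : Prop :=
  ∀ B : Set M, #B < κ → ∀ p : Set (L.Formula (B ⊕ Unit)),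
    (∀ q : Finset (L.Formula (B ⊕ Unit)), (q : Set (L.Formula (B ⊕ Unit))) ⊆ p →
      ∃ m : M, ∀ ψ ∈ q, ψ.Realize (Sum.elim (fun b : B => (b : M)) fun _ => m)) →
    ∃ m : M, ∀ ψ ∈ p, ψ.Realize (Sum.elim (fun b : B => (b : M)) fun _ => m)

/-- The tuples `b` of `M` and `b'` of `N` have the same type over `X ⊆ M`, where `M` is seen
inside `N` through the elementary embedding `j`. -/
def SameType {N : Type w} [L.Structure N] (j : M ↪ₑ[L] N) (X : Set M) {k : ℕ}
    (b : Fin k → M) (b' : Fin k → N) : Prop :=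
  ∀ ψ : L.Formula (X ⊕ Fin k), ψ.Realize (Sum.elim (fun x : X => (x : M)) b) ↔
    ψ.Realize (Sum.elim (fun x : X => j x) b')

/-- The set `S(N)` defined in the elementary extension `N` of `M` by the formulas, with
parameters in `M`, that define `S` in `M`. -/
def extend {N : Type w} [L.Structure N] (j : M ↪ₑ[L] N) {α : Type} (S : Set (α → M)) :
    Set (α → N) :=
  {x | ∃ φ : L.Formula (M ⊕ α), S = {y | φ.Realize (Sum.elim id y)} ∧ φ.Realize (Sum.elim j x)}

variable {n : ℕ} {D : Set (Fin n → M)} [AddCommGroup D]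

/-- The graph of the addition of a group with underlying set `D ⊆ M ^ n`. -/
def addGraph (D : Set (Fin n → M)) [AddCommGroup D] : Set ((Fin n ⊕ Fin n) ⊕ Fin n → M) :=
  {p | ∃ a b : D, p = Sum.elim (Sum.elim a.1 b.1) (a + b).1}

/-- The group `D` is definable in `M` (with parameters). -/
def IsDefinableGroup (D : Set (Fin n → M)) [AddCommGroup D] : Prop :=
  (Set.univ : Set M).Definable L D ∧ (Set.univ : Set M).Definable L (addGraph D)

/-- An endogeny of `D ⊆ M ^ n`, as a subset of `M ^ (n + n)`. -/
def tupleGraph (φ : Endogeny D) : Set (Fin n ⊕ Fin n → M) :=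
  {p | ∃ a b : D, (a, b) ∈ φ.graph ∧ p = Sum.elim a.1 b.1}

/-- The endogeny `φ` is definable (with parameters). -/
def IsDefinableEndogeny (φ : Endogeny D) : Prop :=
  (Set.univ : Set M).Definable L (tupleGraph φ)

/-- The subgroup `B` of `D` is definable (with parameters). -/
def IsDefinableSubgroup (B : AddSubgroup D) : Prop :=
  (Set.univ : Set M).Definable L {x : Fin n → M | ∃ a ∈ B, x = a.1}

/-- `C^♯(Γ)`: the definable endogenies that sharply commute with every element of `Γ`. -/
def sharpCommutant (Γ : Set (Endogeny D)) : Set (Endogeny D) :=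
  {φ | IsDefinableEndogeny L φ ∧ ∀ γ ∈ Γ, SharplyCommute φ γ}

/-- `D` is absolutely `Γ`-minimal: every definable almost `Γ`-invariant subgroup is finite or
of finite index. -/
def AbsolutelyMinimal (Γ : Set (Endogeny D)) : Prop :=
  ∀ B : AddSubgroup D, IsDefinableSubgroup L B → AlmostInvariant Γ B →
    (B : Set D).Finite ∨ B.FiniteIndex

/-- The relations on `n`-tuples of the elementary extension `N` that belong to `Γ(N)`, for a set
`Γ` of definable endogenies invariant over `X`: those defined by `φ(x, y, b')` where `b'` has the
same type over `X` as some `b` for which `φ(x, y, b)` defines an element of `Γ`. -/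
def instances {N : Type w} [L.Structure N] (j : M ↪ₑ[L] N) (X : Set M) (Γ : Set (Endogeny D)) :
    Set (Set (Fin n ⊕ Fin n → N)) :=
  {R | ∃ (k : ℕ) (φ : L.Formula ((Fin n ⊕ Fin n) ⊕ Fin k)) (b : Fin k → M) (b' : Fin k → N),
    (∃ γ ∈ Γ, tupleGraph γ = {p | φ.Realize (Sum.elim p b)}) ∧ SameType L j X b b' ∧
      R = {p | φ.Realize (Sum.elim p b')}}

/-- `Γ` is an invariant set of definable endogenies over the parameter set `X`: it is a set of
instances of formulas `φ(x, y, b)`, and whether `φ(x, y, b)` defines an element of `Γ` depends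
only on `φ` and the type of `b` over `X`. -/
def IsInvariantOver (X : Set M) (Γ : Set (Endogeny D)) : Prop :=
  (∀ γ ∈ Γ, IsDefinableEndogeny L γ) ∧
    ∀ (k : ℕ) (φ : L.Formula ((Fin n ⊕ Fin n) ⊕ Fin k)) (b b' : Fin k → M),
      SameType L (FirstOrder.Language.ElementaryEmbedding.refl L M) X b b' →
      (∃ γ ∈ Γ, tupleGraph γ = {p | φ.Realize (Sum.elim p b)}) →
      ∃ γ ∈ Γ, tupleGraph γ = {p | φ.Realize (Sum.elim p b')}

/-- The relation `∼` in an elementary extension `N`: the set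
`(R - S)[D(N)] = {c | ∃ a, ∃ b₁ ∈ R[a], ∃ b₂ ∈ S[a], c + b₂ = b₁}` is finite. -/
def EquivalentIn (D : Set (Fin n → M)) [AddCommGroup D] {N : Type w} [L.Structure N]
    (j : M ↪ₑ[L] N) (R S : Set (Fin n ⊕ Fin n → N)) : Prop :=
  {c : Fin n → N | ∃ a b₁ b₂ : Fin n → N, Sum.elim a b₁ ∈ R ∧ Sum.elim a b₂ ∈ S ∧
    Sum.elim (Sum.elim c b₂) b₁ ∈ extend L j (addGraph D)}.Finite

/-- `Γ` is essentially unbounded: for every cardinal `μ` there is an elementary extension `N` of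
`M` in which `Γ(N)/∼` has more than `μ` elements. -/
def EssentiallyUnbounded (X : Set M) (Γ : Set (Endogeny D)) : Prop :=
  ∀ μ : Cardinal.{w}, ∃ (N : Type w) (_ : L.Structure N) (j : M ↪ₑ[L] N)
    (I : Set (Set (Fin n ⊕ Fin n → N))), I ⊆ instances L j X Γ ∧ μ < #I ∧
      I.Pairwise fun R S => ¬ EquivalentIn L D j R S

/-- `Γ` is essentially infinite: `Γ/∼` is infinite. -/
def EssentiallyInfinite (Γ : Set (Endogeny D)) : Prop := (EndogRing.mk '' Γ).Infinite

/-- `K ⊆ Endog(D)/∼` is a definable ring: there is a definable set `P` and a uniformly definable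
family `(c p)` of endogenies indexed by `P` such that `K` is the set of the classes of the `c p`,
and equality, addition and multiplication of these classes are definable in `P`. -/
def IsDefinableSubring (K : Subring (EndogRing D)) : Prop :=
  ∃ (m : ℕ) (P : Set (Fin m → M)) (c : P → Endogeny D),
    (Set.univ : Set M).Definable L P ∧
    (Set.univ : Set M).Definable L {q : Fin m ⊕ (Fin n ⊕ Fin n) → M |
      ∃ p : P, ∃ r ∈ tupleGraph (c p), q = Sum.elim p.1 r} ∧
    Set.range (fun p => EndogRing.mk (c p)) = (K : Set (EndogRing D)) ∧
    (Set.univ : Set M).Definable L {q : Fin m ⊕ Fin m → M | ∃ p₁ p₂ : P,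
      q = Sum.elim p₁.1 p₂.1 ∧ EndogRing.mk (c p₁) = EndogRing.mk (c p₂)} ∧
    (Set.univ : Set M).Definable L {q : (Fin m ⊕ Fin m) ⊕ Fin m → M | ∃ p₁ p₂ p₃ : P,
      q = Sum.elim (Sum.elim p₁.1 p₂.1) p₃.1 ∧
        EndogRing.mk (c p₁) + EndogRing.mk (c p₂) = EndogRing.mk (c p₃)} ∧
    (Set.univ : Set M).Definable L {q : (Fin m ⊕ Fin m) ⊕ Fin m → M | ∃ p₁ p₂ p₃ : P,
      q = Sum.elim (Sum.elim p₁.1 p₂.1) p₃.1 ∧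
        EndogRing.mk (c p₁) * EndogRing.mk (c p₂) = EndogRing.mk (c p₃)}

end Definability

end Endogenies

/-!
The proof takes place in a *tame* structure (`Tame`): definable sets of *coded* types, that is, of
interpretable sets, have a dimension, and small families of them are compact. A saturated model of
a finite-dimensional theory is tame (`Dimension.tame`). A recurring argument compares dimensions:
of two nested definable groups of equal dimension, the smaller has finite index in the larger, so a
definable group chosen with least or largest dimension is almost invariant, and absolute minimality
applies to it.

An essentially unbounded invariant set of endogenies contains a uniformly definable family, indexed
by a type-definable set, with arbitrarily many inequivalent members
(`EssentiallyUnbounded.exists_family`): by the pigeonhole principle, infinitely many inequivalent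
endogenies in an elementary extension are given by one formula and one type over `X`, and
arbitrarily many realizations of this type with the same property exist in the given model by
saturation. By symmetry, let this be so for `Γ`.

The bikatakernel `A₀` is finite (`MinimalPair.finite_Kat_left`, `MinimalPair.finite_Kat_right`).
Indeed, a right ideal of `Γ` containing an element not equivalent to zero has a finite common
kernel (`MinimalPair.finite_ker`), and by the pigeonhole principle and compactness, some nonzero
difference of members of the family annihilates the katakernels in question. On the quotient
`V = A / A₀` the endogenies of `Γ` and `Δ` induce rings `R` and `S` of definable endomorphisms, isomorphic
to the rings of classes. Since `A₀` is finite, definable endomorphisms of `V` lift to definable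
endogenies of `A`, so `R` and `S` are exact commutants of each other (`MinimalPair.commutantPair`).
Moreover `R` is prime, with finite witnesses.

The image `W` of a nonzero element of `R` of least rank is such that the elements of `R` mapping
`W` to itself act on `W` as zero or as injections. They act as a division ring, by a bound on the
indices of images of type-definable families (`surjective_of_domain`), and this division ring is
itself a type-definable family, since fractions of a family of largest dimension exhaust it
(`isFamily_of_division`). An infinite centralizer of least dimension in it is commutative, because
its noncentral elements have finite centralizers (`commutative_of_finite_centralizer`). The
division ring has finite dimension over this commutative subfield, hence also over its centre
(`finite_center`), so its centre is infinite and type-definable (`exists_central`). An infinite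
type-definable field acts definably, because lines have type-definable complements and are
therefore definable (`defSet_action`).

Finally, an idempotent of `R` with image `W` generates `R` as a two-sided ideal
(`CommutantPair.exists_units`). This identifies `R ⊓ S`, the common centre of `R` and `S`, with the
centre of the division ring on `W`, and `V` has finite dimension over it (`CommutantPair.field`).
The field `K` consists of the classes of the endogenies that lift elements of `R ⊓ S`; each is
indexed by the points of the coset that is its value at a fixed vector
(`isDefinableSubring_of_action`).
-/

namespace Endogenies

/-! ### Definable sets of coded types -/

/-- A coding of the points of `α` by tuples of elements of `M`: each code codes a unique point,
each point has a code, and it is a definable property of two tuples to code the same point.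
Types with such a coding are the interpretable sets of `M`. -/
class Coded (L : FirstOrder.Language.{u, v}) (M : Type w) [L.Structure M] (α : Type w) where
  ι : Type
  fin : Finite ι
  rel : α → (ι → M) → Prop
  unique : ∀ {c x y}, rel x c → rel y c → x = y
  surj : ∀ x, ∃ c, rel x c
  definable : (Set.univ : Set M).Definable L
    {p : ι ⊕ ι → M | ∃ x, rel x (p ∘ Sum.inl) ∧ rel x (p ∘ Sum.inr)}

attribute [instance] Coded.fin

section Coded

theorem _root_.Set.Definable.of_eq {L : FirstOrder.Language.{u, v}} {M : Type w} [L.Structure M]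
    {A : Set M} {ι : Type*} {s t : Set (ι → M)} (hs : A.Definable L s) (h : s = t) :
    A.Definable L t := h ▸ hs

variable (L : FirstOrder.Language.{u, v}) (M : Type w) [L.Structure M]
variable {α β γ δ : Type w} [Coded L M α] [Coded L M β] [Coded L M γ] [Coded L M δ]

/-- The tuple `c` codes the point `x`. -/
abbrev IsCode (x : α) (c : Coded.ι L M α → M) : Prop := Coded.rel x c

/-- The set of the codes of the points of `s`. -/
def codes (s : Set α) : Set (Coded.ι L M α → M) := {c | ∃ x ∈ s, IsCode L M x c}

/-- A set of points is definable (with parameters) if the set of its codes is. -/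
def DefSet (s : Set α) : Prop := (Set.univ : Set M).Definable L (codes L M s)

instance Coded.prod : Coded L M (α × β) where
  ι := Coded.ι L M α ⊕ Coded.ι L M β
  fin := inferInstance
  rel x c := IsCode L M x.1 (c ∘ Sum.inl) ∧ IsCode L M x.2 (c ∘ Sum.inr)
  unique h h' := Prod.ext (Coded.unique h.1 h'.1) (Coded.unique h.2 h'.2)
  surj x := by
    obtain ⟨c, hc⟩ := Coded.surj (L := L) (M := M) x.1
    obtain ⟨d, hd⟩ := Coded.surj (L := L) (M := M) x.2
    exact ⟨Sum.elim c d, hc, hd⟩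
  definable := by
    have h₁ := (Coded.definable (L := L) (M := M) (α := α)).preimage_comp
      (Sum.map Sum.inl Sum.inl : _ → (Coded.ι L M α ⊕ Coded.ι L M β) ⊕
        (Coded.ι L M α ⊕ Coded.ι L M β))
    have h₂ := (Coded.definable (L := L) (M := M) (α := β)).preimage_comp
      (Sum.map Sum.inr Sum.inr : _ → (Coded.ι L M α ⊕ Coded.ι L M β) ⊕
        (Coded.ι L M α ⊕ Coded.ι L M β))
    refine Set.Definable.of_eq (h₁.inter h₂) (Eq.symm ?_)
    ext p
    constructor
    · rintro ⟨x, ⟨h, h'⟩, k, k'⟩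
      exact ⟨⟨x.1, h, k⟩, ⟨x.2, h', k'⟩⟩
    · rintro ⟨⟨x, h, k⟩, ⟨y, h', k'⟩⟩
      exact ⟨(x, y), ⟨h, h'⟩, k, k'⟩

/-- A map is definable if its graph is. -/
def DefMap (f : α → β) : Prop := DefSet L M {p : α × β | f p.1 = p.2}

variable {L M}

theorem mem_codes_iff {s : Set α} {c : Coded.ι L M α → M} {x : α} (h : IsCode L M x c) :
    c ∈ codes L M s ↔ x ∈ s :=
  ⟨fun ⟨_, hy, h'⟩ => Coded.unique h h' ▸ hy, fun hx => ⟨x, hx, h⟩⟩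

theorem DefSet.of_eq {s t : Set α} (hs : DefSet L M s) (h : s = t) : DefSet L M t := h ▸ hs

variable (L M α) in
theorem DefSet.univ : DefSet L M (Set.univ : Set α) := by
  have h := (Coded.definable (L := L) (M := M) (α := α)).image_comp Sum.inl
  refine Set.Definable.of_eq (h) (Eq.symm ?_)
  ext c
  constructor
  · rintro ⟨x, -, h⟩
    exact ⟨Sum.elim c c, ⟨x, h, h⟩, rfl⟩
  · rintro ⟨p, ⟨x, h, -⟩, rfl⟩
    exact ⟨x, trivial, h⟩

variable (L M α) in
theorem DefSet.empty : DefSet L M (∅ : Set α) := by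
  have h : codes L M (∅ : Set α) = ∅ := by ext c; simp [codes]
  rw [DefSet, h]
  exact Set.definable_empty

theorem DefSet.inter {s t : Set α} (hs : DefSet L M s) (ht : DefSet L M t) :
    DefSet L M (s ∩ t) := by
  refine Set.Definable.of_eq (Set.Definable.inter hs ht) (Eq.symm ?_)
  ext c
  constructor
  · rintro ⟨x, ⟨h, h'⟩, hx⟩
    exact ⟨⟨x, h, hx⟩, ⟨x, h', hx⟩⟩
  · rintro ⟨⟨x, h, hx⟩, ⟨y, h', hy⟩⟩
    obtain rfl := Coded.unique hx hy
    exact ⟨x, ⟨h, h'⟩, hx⟩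

theorem DefSet.union {s t : Set α} (hs : DefSet L M s) (ht : DefSet L M t) :
    DefSet L M (s ∪ t) := by
  refine Set.Definable.of_eq (Set.Definable.union hs ht) (Eq.symm ?_)
  ext c
  simp [codes, or_and_right, exists_or]

theorem DefSet.compl {s : Set α} (hs : DefSet L M s) : DefSet L M sᶜ := by
  refine Set.Definable.of_eq
    (Set.Definable.inter (DefSet.univ L M α) (Set.Definable.compl hs)) (Eq.symm ?_)
  ext c
  constructor
  · rintro ⟨x, h, hx⟩
    exact ⟨⟨x, trivial, hx⟩, fun h' => h ((mem_codes_iff hx).1 h')⟩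
  · rintro ⟨⟨x, -, hx⟩, h⟩
    exact ⟨x, fun h' => h ⟨x, h', hx⟩, hx⟩

theorem DefSet.and {p q : α → Prop} (hp : DefSet L M {x | p x}) (hq : DefSet L M {x | q x}) :
    DefSet L M {x | p x ∧ q x} := hp.inter hq

theorem DefSet.or {p q : α → Prop} (hp : DefSet L M {x | p x}) (hq : DefSet L M {x | q x}) :
    DefSet L M {x | p x ∨ q x} := hp.union hq

theorem DefSet.not {p : α → Prop} (hp : DefSet L M {x | p x}) : DefSet L M {x | ¬ p x} :=
  hp.compl

theorem DefSet.imp {p q : α → Prop} (hp : DefSet L M {x | p x}) (hq : DefSet L M {x | q x}) :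
    DefSet L M {x | p x → q x} := by
  refine DefSet.of_eq (hp.not.or hq) ?_
  ext x
  exact imp_iff_not_or.symm

theorem DefSet.const (p : Prop) : DefSet L M {_x : α | p} := by
  by_cases hp : p
  · simpa [hp] using DefSet.univ L M α
  · simpa [hp] using DefSet.empty L M α

theorem DefSet.finite_iInter {ι : Type*} [Finite ι] {s : ι → Set α}
    (hs : ∀ i, DefSet L M (s i)) : DefSet L M (⋂ i, s i) := by
  classical
  have := Fintype.ofFinite ι
  have h : ∀ J : Finset ι, DefSet L M (⋂ i ∈ J, s i) := by
    intro J
    induction J using Finset.induction_on with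
    | empty => simpa using DefSet.univ L M α
    | insert a J _ ih => rw [Finset.set_biInter_insert]; exact (hs a).inter ih
  simpa using h Finset.univ

theorem DefSet.biInter_finset {ι : Type*} {s : ι → Set α} (J : Finset ι)
    (hs : ∀ i ∈ J, DefSet L M (s i)) : DefSet L M (⋂ i ∈ J, s i) := by
  have h : (⋂ i ∈ J, s i) = ⋂ i : J, s i := by ext; simp
  rw [h]
  exact DefSet.finite_iInter fun i => hs i i.2

theorem DefSet.finite_forall {ι : Type*} [Finite ι] {p : ι → α → Prop}
    (hs : ∀ i, DefSet L M {x | p i x}) : DefSet L M {x | ∀ i, p i x} := by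
  refine DefSet.of_eq (DefSet.finite_iInter hs) ?_
  ext; simp

theorem DefSet.exists {p : α → β → Prop} (h : DefSet L M {x : α × β | p x.1 x.2}) :
    DefSet L M {x | ∃ y, p x y} := by
  have h' := Set.Definable.image_comp (α := Coded.ι L M α) (β := Coded.ι L M α ⊕ Coded.ι L M β)
    h Sum.inl
  refine Set.Definable.of_eq (h') (Eq.symm ?_)
  ext c
  constructor
  · rintro ⟨x, ⟨y, h⟩, hx⟩
    obtain ⟨d, hd⟩ := Coded.surj (L := L) (M := M) y
    exact ⟨Sum.elim c d, ⟨(x, y), h, hx, hd⟩, rfl⟩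
  · rintro ⟨_, ⟨⟨x, y⟩, h, hx, -⟩, rfl⟩
    exact ⟨x, ⟨y, h⟩, hx⟩

theorem DefSet.forall {p : α → β → Prop} (h : DefSet L M {x : α × β | p x.1 x.2}) :
    DefSet L M {x | ∀ y, p x y} := by
  have h' := (DefSet.exists (L := L) (M := M) (p := fun x y => ¬ p x y) h.not).not
  simpa using h'

variable (L M) in
/-- A map which is given by a change of coordinates in the codes. -/
def IsCoord (f : α → β) : Prop :=
  ∃ e : Coded.ι L M β → Coded.ι L M α, ∀ c x, IsCode L M x c → IsCode L M (f x) (c ∘ e)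

omit [Coded L M α] in
theorem IsCoord.id [Coded L M α] : IsCoord L M (fun x : α => x) := ⟨fun i => i, fun _ _ h => h⟩

theorem IsCoord.fst {f : α → β × γ} (hf : IsCoord L M f) : IsCoord L M fun x => (f x).1 :=
  hf.imp' (fun e => e ∘ Sum.inl) fun _ he c x h => (he c x h).1

theorem IsCoord.snd {f : α → β × γ} (hf : IsCoord L M f) : IsCoord L M fun x => (f x).2 :=
  hf.imp' (fun e => e ∘ Sum.inr) fun _ he c x h => (he c x h).2

theorem IsCoord.prodMk {f : α → β} {g : α → γ} (hf : IsCoord L M f) (hg : IsCoord L M g) :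
    IsCoord L M fun x => (f x, g x) := by
  obtain ⟨e, he⟩ := hf
  obtain ⟨e', he'⟩ := hg
  exact ⟨Sum.elim e e', fun c x h => ⟨he c x h, he' c x h⟩⟩

theorem IsCoord.preimage {f : α → β} (hf : IsCoord L M f) {s : Set β} (hs : DefSet L M s) :
    DefSet L M (f ⁻¹' s) := by
  obtain ⟨e, he⟩ := hf
  refine Set.Definable.of_eq
    (Set.Definable.inter (DefSet.univ L M α) (Set.Definable.preimage_comp e hs)) (Eq.symm ?_)
  ext c
  constructor
  · rintro ⟨x, h, hx⟩
    exact ⟨⟨x, trivial, hx⟩, ⟨f x, h, he c x hx⟩⟩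
  · rintro ⟨⟨x, -, hx⟩, h⟩
    exact ⟨x, (mem_codes_iff (he c x hx)).1 h, hx⟩

theorem DefSet.diagonal : DefSet L M {p : α × α | p.1 = p.2} := by
  refine Set.Definable.of_eq (Coded.definable (L := L) (M := M) (α := α)) (Eq.symm ?_)
  ext p
  constructor
  · rintro ⟨⟨x, y⟩, h, hx, hy⟩
    obtain rfl : x = y := h
    exact ⟨x, hx, hy⟩
  · rintro ⟨x, hx, hy⟩
    exact ⟨(x, x), rfl, hx, hy⟩

theorem IsCoord.defMap {f : α → β} (hf : IsCoord L M f) : DefMap L M f := by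
  refine IsCoord.preimage (f := fun p : α × β => (f p.1, p.2)) ?_ DefSet.diagonal
  obtain ⟨e, he⟩ := hf
  exact ⟨Sum.map e (fun i => i), fun c x h => ⟨he _ _ h.1, h.2⟩⟩

theorem DefSet.singleton (x : α) : DefSet L M ({x} : Set α) := by
  obtain ⟨d, hd⟩ := Coded.surj (L := L) (M := M) x
  have h : (Set.univ : Set M).DefinableMap L
      (fun c : Coded.ι L M α → M => (Sum.elim c d : Coded.ι L M α ⊕ Coded.ι L M α → M)) := by
    rintro (i | i)
    · exact Set.DefinableFun.proj L (i := i)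
    · exact FirstOrder.Language.definableFun_const L _ (Set.mem_univ (d i))
  have h' := Set.Definable.preimage_map h (Coded.definable (L := L) (M := M) (α := α))
  refine Set.Definable.of_eq (h') (Eq.symm ?_)
  ext c
  constructor
  · rintro ⟨y, rfl, hy⟩
    exact ⟨y, hy, hd⟩
  · rintro ⟨y, hy, hy'⟩
    exact ⟨x, rfl, Coded.unique hy' hd ▸ hy⟩

theorem DefSet.of_finite {s : Set α} (hs : s.Finite) : DefSet L M s := by
  induction s, hs using Set.Finite.induction_on with
  | empty => exact DefSet.empty L M α
  | insert _ _ ih => rw [Set.insert_eq]; exact (DefSet.singleton _).union ih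

theorem DefMap.preimage {f : α → β} (hf : DefMap L M f) {s : Set β} (hs : DefSet L M s) :
    DefSet L M (f ⁻¹' s) := by
  have h : DefSet L M {p : α × β | f p.1 = p.2 ∧ p.2 ∈ s} :=
    DefSet.and hf (IsCoord.id.snd.preimage hs)
  refine DefSet.of_eq (DefSet.exists (p := fun x y => f x = y ∧ y ∈ s) h) ?_
  ext x
  simp

theorem DefSet.mem {s : Set β} (hs : DefSet L M s) {f : α → β} (hf : DefMap L M f) :
    DefSet L M {x | f x ∈ s} := hf.preimage hs

theorem DefMap.id : DefMap L M (fun x : α => x) := IsCoord.id.defMap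

theorem DefMap.const (y : β) : DefMap L M (fun _ : α => y) := by
  have h := (IsCoord.id.snd : IsCoord L M (fun x : α × β => x.2)).preimage (DefSet.singleton y)
  refine DefSet.of_eq h ?_
  ext p; exact eq_comm

theorem DefMap.comp {g : β → γ} {f : α → β} (hg : DefMap L M g) (hf : DefMap L M f) :
    DefMap L M fun x => g (f x) := by
  have h₁ := (IsCoord.prodMk IsCoord.id.fst.fst IsCoord.id.snd :
    IsCoord L M fun x : (α × γ) × β => (x.1.1, x.2)).preimage hf
  have h₂ := (IsCoord.prodMk IsCoord.id.snd IsCoord.id.fst.snd :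
    IsCoord L M fun x : (α × γ) × β => (x.2, x.1.2)).preimage hg
  refine DefSet.of_eq
    (DefSet.exists (p := fun (x : α × γ) y => f x.1 = y ∧ g y = x.2) (h₁.inter h₂)) ?_
  ext x
  simp

theorem DefMap.fst {f : α → β × γ} (hf : DefMap L M f) : DefMap L M fun x => (f x).1 :=
  DefMap.comp (g := fun x : β × γ => x.1) IsCoord.id.fst.defMap hf

theorem DefMap.snd {f : α → β × γ} (hf : DefMap L M f) : DefMap L M fun x => (f x).2 :=
  DefMap.comp (g := fun x : β × γ => x.2) IsCoord.id.snd.defMap hf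

theorem DefMap.prodMk {f : α → β} {g : α → γ} (hf : DefMap L M f) (hg : DefMap L M g) :
    DefMap L M fun x => (f x, g x) := by
  have h₁ := (IsCoord.prodMk IsCoord.id.fst IsCoord.id.snd.fst :
    IsCoord L M fun x : α × (β × γ) => (x.1, x.2.1)).preimage hf
  have h₂ := (IsCoord.prodMk IsCoord.id.fst IsCoord.id.snd.snd :
    IsCoord L M fun x : α × (β × γ) => (x.1, x.2.2)).preimage hg
  refine DefSet.of_eq (h₁.inter h₂) ?_
  ext x
  simp [Prod.ext_iff]

theorem DefSet.eq {f g : α → β} (hf : DefMap L M f) (hg : DefMap L M g) :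
    DefSet L M {x | f x = g x} := (hf.prodMk hg).preimage DefSet.diagonal

theorem DefMap.of_graph {f : α → β} {s : Set (α × β)} (hs : DefSet L M s)
    (h : ∀ x y, f x = y ↔ (x, y) ∈ s) : DefMap L M f := by
  refine DefSet.of_eq hs ?_
  ext p; exact (h p.1 p.2).symm

theorem DefSet.image {f : α → β} (hf : DefMap L M f) {s : Set α} (hs : DefSet L M s) :
    DefSet L M (f '' s) := by
  have h : DefSet L M {p : β × α | p.2 ∈ s ∧ f p.2 = p.1} :=
    (hs.mem DefMap.id.snd).and (DefSet.eq (hf.comp DefMap.id.snd) DefMap.id.fst)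
  exact DefSet.exists (p := fun y x => x ∈ s ∧ f x = y) h

theorem DefSet.prod {s : Set α} {t : Set β} (hs : DefSet L M s) (ht : DefSet L M t) :
    DefSet L M (s ×ˢ t) := (hs.mem DefMap.id.fst).and (ht.mem DefMap.id.snd)

/-! Tuples, subtypes and quotients of coded types are coded. -/

instance Coded.fun (ι : Type) [Finite ι] : Coded L M (ι → α) where
  ι := ι × Coded.ι L M α
  fin := inferInstance
  rel x c := ∀ i, IsCode L M (x i) fun j => c (i, j)
  unique h h' := funext fun i => Coded.unique (h i) (h' i)
  surj x := by
    choose c hc using fun i => Coded.surj (L := L) (M := M) (x i)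
    exact ⟨fun p => c p.1 p.2, hc⟩
  definable := by
    have h := Set.definable_iInter_of_finite (A := (Set.univ : Set M)) (L := L) fun i : ι =>
      (Coded.definable (L := L) (M := M) (α := α)).preimage_comp
        (Sum.map (fun j => (i, j)) (fun j => (i, j)) :
          _ → (ι × Coded.ι L M α) ⊕ (ι × Coded.ι L M α))
    refine Set.Definable.of_eq (h) (Eq.symm ?_)
    ext p
    simp only [Set.mem_iInter]
    constructor
    · rintro ⟨x, h, h'⟩ i
      exact ⟨x i, h i, h' i⟩
    · intro h
      choose x hx hx' using h
      exact ⟨x, hx, hx'⟩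

theorem DefMap.apply {ι : Type} [Finite ι] {f : β → ι → α} (hf : DefMap L M f) (i : ι) :
    DefMap L M fun x => f x i := by
  refine DefMap.comp (g := fun x : ι → α => x i) (IsCoord.defMap ?_) hf
  exact ⟨fun j => (i, j), fun c x h => h i⟩

theorem DefMap.pi {ι : Type} [Finite ι] {f : β → ι → α} (hf : ∀ i, DefMap L M fun x => f x i) :
    DefMap L M f := by
  refine DefSet.of_eq (DefSet.finite_forall (p := fun i (x : β × (ι → α)) =>
    f x.1 i = x.2 i) fun i => DefSet.eq ((hf i).comp DefMap.id.fst) (DefMap.id.snd.apply i)) ?_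
  ext x
  exact funext_iff.symm

variable (L M) in
/-- A definable set of points of a coded type is a coded type. -/
@[reducible]
def Coded.subtype {s : Set α} (hs : DefSet L M s) : Coded L M s where
  ι := Coded.ι L M α
  fin := inferInstance
  rel x c := IsCode L M (x : α) c
  unique h h' := Subtype.ext (Coded.unique h h')
  surj x := Coded.surj (x : α)
  definable := by
    have h := Set.Definable.inter (Coded.definable (L := L) (M := M) (α := α))
      (Set.Definable.preimage_comp Sum.inl hs)
    refine Set.Definable.of_eq (h) (Eq.symm ?_)
    ext p
    constructor
    · rintro ⟨x, h, h'⟩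
      exact ⟨⟨x, h, h'⟩, ⟨x, x.2, h⟩⟩
    · rintro ⟨⟨x, h, h'⟩, h''⟩
      exact ⟨⟨x, (mem_codes_iff h).1 h''⟩, h, h'⟩

variable (L M) in
/-- The quotient of a coded type by a definable equivalence relation is a coded type. -/
@[reducible]
def Coded.ofSurjective {f : α → β} (hf : Function.Surjective f)
    (h : DefSet L M {p : α × α | f p.1 = f p.2}) : Coded L M β where
  ι := Coded.ι L M α
  fin := inferInstance
  rel y c := ∃ x, f x = y ∧ IsCode L M x c
  unique := by
    rintro c _ _ ⟨x, rfl, h⟩ ⟨y, rfl, h'⟩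
    rw [Coded.unique h h']
  surj y := by
    obtain ⟨x, rfl⟩ := hf y
    obtain ⟨c, hc⟩ := Coded.surj (L := L) (M := M) x
    exact ⟨c, x, rfl, hc⟩
  definable := by
    refine Set.Definable.of_eq h ?_
    ext p
    constructor
    · rintro ⟨⟨x, y⟩, h, hx, hy⟩
      exact ⟨f x, ⟨x, rfl, hx⟩, ⟨y, Eq.symm h, hy⟩⟩
    · rintro ⟨_, ⟨x, rfl, hx⟩, ⟨y, h, hy⟩⟩
      exact ⟨(x, y), h.symm, hx, hy⟩

variable (L M) in
/-- The structure itself is coded, by tuples of length one. -/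
instance Coded.self : Coded L M M where
  ι := Unit
  fin := inferInstance
  rel x c := c () = x
  unique h h' := h.symm.trans h'
  surj x := ⟨fun _ => x, rfl⟩
  definable := by
    refine Set.Definable.of_eq (Set.DefinableFun.ofPred_eq (L := L) (A := (Set.univ : Set M))
      (f := fun p : Unit ⊕ Unit → M => p (Sum.inl ()))
      (g := fun p : Unit ⊕ Unit → M => p (Sum.inr ()))
      (Set.DefinableFun.proj L) (Set.DefinableFun.proj L)) (Eq.symm ?_)
    ext p
    simp [eq_comm]

theorem defSet_tuple_iff {ι : Type} [Finite ι] {s : Set (ι → M)} :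
    DefSet L M s ↔ (Set.univ : Set M).Definable L s := by
  have h : codes L M s = (fun g : ι × Unit → M => g ∘ fun i => (i, ())) ⁻¹' s := by
    ext c
    constructor
    · rintro ⟨x, hx, h⟩
      have h' : c ∘ (fun i => (i, ())) = x := funext h
      exact (congrArg (· ∈ s) h').mpr hx
    · intro hc
      exact ⟨_, hc, fun i => rfl⟩
  constructor
  · intro hs
    have := Set.Definable.preimage_comp (fun x : ι × Unit => x.1) hs
    rw [h] at this
    exact this
  · intro hs
    rw [DefSet, h]
    exact Set.Definable.preimage_comp (fun i => (i, ())) hs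

end Coded

/-! ### Compactness and dimension -/

/-- A structure with a dimension on its interpretable sets (the empty set having dimension zero)
in which definable sets are `κ`-compact, for an uncountable cardinal `κ`. As the dimension of the
empty set is not distinguished from that of a point, the lower fibre inequality asks for non-empty
fibres. -/
class Tame (L : FirstOrder.Language.{u, v}) (M : Type w) [L.Structure M] where
  κ : Cardinal.{w}
  aleph0_lt : ℵ₀ < κ
  compact : ∀ {α : Type w} [Coded L M α] {ι : Type w} (D : ι → Set α), #ι < κ →
    (∀ i, DefSet L M (D i)) → (∀ J : Finset ι, (⋂ i ∈ J, D i).Nonempty) → (⋂ i, D i).Nonempty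
  dm : ∀ {α : Type w} [Coded L M α], Set α → ℕ
  dm_mono : ∀ {α : Type w} [Coded L M α] {s t : Set α}, DefSet L M s → DefSet L M t → s ⊆ t →
    dm s ≤ dm t
  dm_eq_zero : ∀ {α : Type w} [Coded L M α] {s : Set α}, DefSet L M s → (dm s = 0 ↔ s.Finite)
  add_le_dm : ∀ {α β : Type w} [Coded L M α] [Coded L M β] {s : Set α} {t : Set β} {f : α → β}
    {k : ℕ}, DefSet L M s → DefSet L M t → DefMap L M f → t.Nonempty →
    (∀ y ∈ t, (s ∩ f ⁻¹' {y}).Nonempty ∧ k ≤ dm (s ∩ f ⁻¹' {y})) → dm t + k ≤ dm s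
  dm_le_add : ∀ {α β : Type w} [Coded L M α] [Coded L M β] {s : Set α} {t : Set β} {f : α → β}
    {k : ℕ}, DefSet L M s → DefSet L M t → DefMap L M f → Set.MapsTo f s t →
    (∀ y ∈ t, dm (s ∩ f ⁻¹' {y}) ≤ k) → dm s ≤ dm t + k

section TypeDefinable

variable (L : FirstOrder.Language.{u, v}) (M : Type w) [L.Structure M] [Tame L M]
variable {α β γ : Type w} [Coded L M α] [Coded L M β] [Coded L M γ]

/-- A set is type-definable if it is an intersection of fewer than `κ` definable sets. -/
def TypeDef (s : Set α) : Prop :=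
  ∃ (ι : Type w) (D : ι → Set α), #ι < Tame.κ L M ∧ (∀ i, DefSet L M (D i)) ∧ s = ⋂ i, D i

variable {L M}

theorem DefSet.typeDef {s : Set α} (hs : DefSet L M s) : TypeDef L M s :=
  ⟨PUnit, fun _ => s, by simpa using one_lt_aleph0.trans (Tame.aleph0_lt (L := L) (M := M)),
    fun _ => hs, (Set.iInter_const s).symm⟩

theorem mk_finset_lt {κ : Cardinal.{w}} (hκ : ℵ₀ < κ) {ι : Type w} (h : #ι < κ) :
    #(Finset ι) < κ := by
  rcases finite_or_infinite ι with hι | hι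
  · exact (lt_aleph0_of_finite _).trans hκ
  · rwa [mk_finset_of_infinite]

variable (L M) in
theorem mk_ulift_nat_lt : #(ULift.{w} ℕ) < Tame.κ L M := by
  simpa using Tame.aleph0_lt (L := L) (M := M)

theorem TypeDef.inter {s t : Set α} (hs : TypeDef L M s) (ht : TypeDef L M t) :
    TypeDef L M (s ∩ t) := by
  obtain ⟨ι, D, hι, hD, rfl⟩ := hs
  obtain ⟨ι', D', hι', hD', rfl⟩ := ht
  refine ⟨ι ⊕ ι', Sum.elim D D', ?_, by rintro (i | i); exacts [hD i, hD' i], ?_⟩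
  · rw [mk_sum, lift_id, lift_id]
    exact add_lt_of_lt (Tame.aleph0_lt (L := L) (M := M)).le hι hι'
  · ext x; simp

theorem TypeDef.union {s t : Set α} (hs : TypeDef L M s) (ht : TypeDef L M t) :
    TypeDef L M (s ∪ t) := by
  obtain ⟨ι, D, hι, hD, rfl⟩ := hs
  obtain ⟨ι', D', hι', hD', rfl⟩ := ht
  refine ⟨ι × ι', fun p => D p.1 ∪ D' p.2, ?_, fun p => (hD p.1).union (hD' p.2), ?_⟩
  · rw [mk_prod, lift_id, lift_id]
    exact mul_lt_of_lt (Tame.aleph0_lt (L := L) (M := M)).le hι hι'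
  · ext x
    simp only [Set.mem_union, Set.mem_iInter, Prod.forall]
    constructor
    · rintro (h | h) i j
      exacts [.inl (h i), .inr (h j)]
    · intro h
      by_contra! h'
      obtain ⟨⟨i, hi⟩, ⟨j, hj⟩⟩ := h'
      exact (h i j).elim hi hj

theorem TypeDef.preimage {f : α → β} (hf : DefMap L M f) {s : Set β} (hs : TypeDef L M s) :
    TypeDef L M (f ⁻¹' s) := by
  obtain ⟨ι, D, hι, hD, rfl⟩ := hs
  exact ⟨ι, fun i => f ⁻¹' D i, hι, fun i => hf.preimage (hD i), Set.preimage_iInter⟩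

theorem TypeDef.prod {s : Set α} {t : Set β} (hs : TypeDef L M s) (ht : TypeDef L M t) :
    TypeDef L M (s ×ˢ t) :=
  (hs.preimage (DefMap.id.fst : DefMap L M fun x : α × β => x.1)).inter
    (ht.preimage (DefMap.id.snd : DefMap L M fun x : α × β => x.2))

/-- Saturation for a type-definable set and a small family of definable conditions. -/
theorem TypeDef.nonempty_iInter {s : Set α} (hs : TypeDef L M s) {ι : Type w} {D : ι → Set α}
    (hι : #ι < Tame.κ L M) (hD : ∀ i, DefSet L M (D i))
    (h : ∀ J : Finset ι, (s ∩ ⋂ i ∈ J, D i).Nonempty) : (s ∩ ⋂ i, D i).Nonempty := by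
  classical
  obtain ⟨ι', D', hι', hD', rfl⟩ := hs
  have := Tame.compact (L := L) (M := M) (Sum.elim D' D) ?_ ?_ ?_
  · obtain ⟨x, hx⟩ := this
    refine ⟨x, ?_⟩
    simpa using hx
  · rw [mk_sum, lift_id, lift_id]
    exact add_lt_of_lt (Tame.aleph0_lt (L := L) (M := M)).le hι' hι
  · rintro (i | i); exacts [hD' i, hD i]
  · intro J
    obtain ⟨x, hx, hx'⟩ := h (J.preimage Sum.inr Sum.inr_injective.injOn)
    refine ⟨x, ?_⟩
    simp only [Set.mem_iInter, Finset.mem_preimage] at hx hx' ⊢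
    rintro (i | i) hi
    exacts [hx i, hx' i hi]

/-- Saturation for a type-definable set and a decreasing sequence of definable conditions. -/
theorem TypeDef.nonempty_of_antitone {s : Set α} (hs : TypeDef L M s) {D : ℕ → Set α}
    (hD : ∀ i, DefSet L M (D i)) (hD' : Antitone D) (h : ∀ i, (s ∩ D i).Nonempty) :
    ∃ x ∈ s, ∀ i, x ∈ D i := by
  have := hs.nonempty_iInter (D := fun i : ULift.{w} ℕ => D i.down) (mk_ulift_nat_lt L M)
    (fun i => hD i.down) ?_
  · obtain ⟨x, hx, hx'⟩ := this
    exact ⟨x, hx, fun i => Set.mem_iInter.1 hx' ⟨i⟩⟩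
  · intro J
    obtain ⟨x, hx, hx'⟩ := h (J.sup ULift.down)
    refine ⟨x, hx, ?_⟩
    simp only [Set.mem_iInter]
    exact fun i hi => hD' (Finset.le_sup hi) hx'

theorem TypeDef.exists {p : α → β → Prop} (h : TypeDef L M {x : α × β | p x.1 x.2}) :
    TypeDef L M {x | ∃ y, p x y} := by
  obtain ⟨ι, D, hι, hD, hp⟩ := h
  refine ⟨Finset ι, fun J => {x | ∃ y, (x, y) ∈ ⋂ i ∈ J, D i}, mk_finset_lt Tame.aleph0_lt hι,
    fun J => DefSet.exists (DefSet.biInter_finset J fun i _ => hD i), ?_⟩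
  ext x
  rw [Set.mem_iInter]
  constructor
  · rintro ⟨y, hy⟩ J
    have : (x, y) ∈ ⋂ i, D i := hp ▸ hy
    exact ⟨y, Set.mem_iInter₂.2 fun i _ => Set.mem_iInter.1 this i⟩
  · intro h
    have hD' : ∀ i, DefSet L M {y : β | (x, y) ∈ D i} := fun i =>
      (hD i).mem ((DefMap.const x).prodMk DefMap.id)
    obtain ⟨y, hy⟩ := Tame.compact (L := L) (M := M) (fun i => {y : β | (x, y) ∈ D i}) hι hD'
      (fun J => by
        obtain ⟨y, hy⟩ := h J
        exact ⟨y, by simpa using hy⟩)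
    refine ⟨y, ?_⟩
    change (x, y) ∈ {x : α × β | p x.1 x.2}
    rw [hp]
    simpa using hy

theorem TypeDef.of_eq {s t : Set α} (hs : TypeDef L M s) (h : s = t) : TypeDef L M t := h ▸ hs

theorem TypeDef.image {f : α → β} (hf : DefMap L M f) {s : Set α} (hs : TypeDef L M s) :
    TypeDef L M (f '' s) := by
  have h : TypeDef L M {p : β × α | p.2 ∈ s ∧ f p.2 = p.1} :=
    (hs.preimage DefMap.id.snd).inter
      (DefSet.eq (hf.comp DefMap.id.snd) DefMap.id.fst).typeDef
  exact TypeDef.exists (p := fun y x => x ∈ s ∧ f x = y) h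

/-- A type-definable set with a type-definable complement is definable. -/
theorem TypeDef.defSet {s : Set α} (hs : TypeDef L M s) (hs' : TypeDef L M sᶜ) :
    DefSet L M s := by
  obtain ⟨ι', D', hι', hD', hs'⟩ := hs'
  have hdis : ¬ (s ∩ ⋂ i, D' i).Nonempty := by rw [← hs']; simp
  -- By compactness finitely many of the conditions defining the complement already exclude `s`.
  have := mt (hs.nonempty_iInter hι' hD') hdis
  push Not at this
  obtain ⟨J, hJ⟩ := this
  have h : s = (⋂ i ∈ J, D' i)ᶜ := by
    apply Set.Subset.antisymm
    · exact fun x hx hx' => Set.notMem_empty x (hJ ▸ ⟨hx, hx'⟩)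
    · intro x hx
      by_contra hx'
      have : x ∈ ⋂ i, D' i := hs' ▸ hx'
      exact hx (Set.mem_iInter₂.2 fun i _ => Set.mem_iInter.1 this i)
  rw [h]
  exact (DefSet.biInter_finset J fun i _ => hD' i).compl

/-- A definable set containing the product of two type-definable sets contains the product of
two definable sets containing them. -/
theorem TypeDef.exists_box {s : Set α} {t : Set β} (hs : TypeDef L M s) (ht : TypeDef L M t)
    {U : Set (α × β)} (hU : DefSet L M U) (h : s ×ˢ t ⊆ U) :
    ∃ Z Z', DefSet L M Z ∧ DefSet L M Z' ∧ s ⊆ Z ∧ t ⊆ Z' ∧ Z ×ˢ Z' ⊆ U := by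
  obtain ⟨ι, D, hι, hD, rfl⟩ := hs
  -- The points of `s` with a bad partner in `t` form an empty type-definable set; compactness
  -- gives a definable `Z ⊇ s` none of whose points has a bad partner in `t`.
  have h₁ : TypeDef L M {x : α | ∃ y, y ∈ t ∧ (x, y) ∉ U} :=
    TypeDef.exists (p := fun x y => y ∈ t ∧ (x, y) ∉ U)
      ((ht.preimage DefMap.id.snd).inter hU.compl.typeDef)
  obtain ⟨ι₁, D₁, hι₁, hD₁, h₁⟩ := h₁
  have h₂ : ¬ ((⋂ i, D₁ i) ∩ ⋂ i, D i).Nonempty := by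
    rw [← h₁]
    rintro ⟨x, ⟨y, hy, hxy⟩, hx⟩
    exact hxy (h ⟨hx, hy⟩)
  have := mt (TypeDef.nonempty_iInter ⟨ι₁, D₁, hι₁, hD₁, rfl⟩ hι hD) h₂
  push Not at this
  obtain ⟨J, hJ⟩ := this
  have hZ : DefSet L M (⋂ i ∈ J, D i) := DefSet.biInter_finset J fun i _ => hD i
  have hZt : ∀ x ∈ ⋂ i ∈ J, D i, ∀ y ∈ t, (x, y) ∈ U := by
    intro x hx y hy
    by_contra hxy
    have : x ∈ ⋂ i, D₁ i := h₁ ▸ ⟨y, hy, hxy⟩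
    exact Set.notMem_empty x (hJ ▸ ⟨this, hx⟩)
  refine ⟨⋂ i ∈ J, D i, {y | ∀ x, x ∈ ⋂ i ∈ J, D i → (x, y) ∈ U}, hZ, ?_, ?_, ?_, ?_⟩
  · exact DefSet.forall (p := fun y x => x ∈ ⋂ i ∈ J, D i → (x, y) ∈ U)
      ((hZ.mem DefMap.id.snd).imp (hU.mem (DefMap.id.snd.prodMk DefMap.id.fst)))
  · exact fun x hx => Set.mem_iInter₂.2 fun i _ => Set.mem_iInter.1 hx i
  · exact fun y hy x hx => hZt x hx y hy
  · exact fun p hp => hp.2 p.1 hp.1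

/-- If the members of a family indexed by a type-definable set contain arbitrarily large finite
`Q`-cliques, one of them contains `Q`-cliques of all finite sizes. -/
theorem TypeDef.exists_cliques {s : Set α} (hs : TypeDef L M s) {Q : α → β → β → Prop}
    (hQ : DefSet L M {p : α × (β × β) | Q p.1 p.2.1 p.2.2})
    (h : ∀ t : ℕ, ∃ x ∈ s, ∃ u : Fin t → β, ∀ i j, i ≠ j → Q x (u i) (u j)) :
    ∃ x ∈ s, ∀ t : ℕ, ∃ u : Fin t → β, ∀ i j, i ≠ j → Q x (u i) (u j) := by
  refine hs.nonempty_of_antitone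
    (D := fun t => {x | ∃ u : Fin t → β, ∀ i j, i ≠ j → Q x (u i) (u j)}) ?_ ?_ ?_
  · intro t
    refine DefSet.exists (p := fun x (u : Fin t → β) => ∀ i j, i ≠ j → Q x (u i) (u j)) ?_
    refine DefSet.finite_forall fun i => DefSet.finite_forall fun j => (DefSet.const _).imp ?_
    exact hQ.mem (DefMap.id.fst.prodMk ((DefMap.id.snd.apply i).prodMk (DefMap.id.snd.apply j)))
  · rintro m n hmn x ⟨u, hu⟩
    exact ⟨fun i => u (Fin.castLE hmn i), fun i j hij =>
      hu _ _ fun h => hij (Fin.castLE_injective hmn h)⟩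
  · intro t
    obtain ⟨x, hx, hu⟩ := h t
    exact ⟨x, hx, hu⟩

end TypeDefinable

section Dimension

variable (L : FirstOrder.Language.{u, v}) (M : Type w) [L.Structure M] [Tame L M]
variable {α β γ : Type w} [Coded L M α] [Coded L M β] [Coded L M γ]

/-- The dimension of a definable set, the empty set having dimension zero. -/
abbrev dm (s : Set α) : ℕ := Tame.dm (L := L) (M := M) s

/-- The dimension of a type-definable set: the least dimension of a definable set containing
it. -/
noncomputable def tdm (s : Set α) : ℕ := sInf {d | ∃ Z, DefSet L M Z ∧ s ⊆ Z ∧ dm L M Z = d}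

variable {L M}

theorem dm_le_of_injOn {s : Set α} {t : Set β} {f : α → β} (hs : DefSet L M s)
    (ht : DefSet L M t) (hf : DefMap L M f) (hst : Set.MapsTo f s t) (hinj : Set.InjOn f s) :
    dm L M s ≤ dm L M t := by
  refine Tame.dm_le_add (k := 0) hs ht hf hst fun y _ => le_of_eq ?_
  refine (Tame.dm_eq_zero (hs.inter (hf.preimage (DefSet.singleton y)))).2 ?_
  refine Set.Subsingleton.finite ?_
  rintro x ⟨hx, rfl⟩ x' ⟨hx', h⟩
  exact hinj hx hx' h.symm

theorem add_le_dm_prod {s : Set α} {t : Set β} (hs : DefSet L M s) (ht : DefSet L M t)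
    (hs' : s.Nonempty) (ht' : t.Nonempty) : dm L M s + dm L M t ≤ dm L M (s ×ˢ t) := by
  refine Tame.add_le_dm (f := fun x : α × β => x.1) (hs.prod ht) hs DefMap.id.fst hs'
    fun x hx => ⟨?_, ?_⟩
  · obtain ⟨y, hy⟩ := ht'
    exact ⟨(x, y), ⟨hx, hy⟩, rfl⟩
  · refine dm_le_of_injOn (f := fun y => (x, y)) ht
      ((hs.prod ht).inter ((DefSet.singleton x).mem DefMap.id.fst))
      ((DefMap.const x).prodMk DefMap.id) (fun y hy => ⟨⟨hx, hy⟩, rfl⟩) ?_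
    intro y _ y' _ h
    exact (Prod.ext_iff.1 h).2

theorem tdm_le {s Z : Set α} (hZ : DefSet L M Z) (h : s ⊆ Z) : tdm L M s ≤ dm L M Z :=
  Nat.sInf_le ⟨Z, hZ, h, rfl⟩

theorem exists_dm_eq_tdm (s : Set α) : ∃ Z, DefSet L M Z ∧ s ⊆ Z ∧ dm L M Z = tdm L M s :=
  Nat.sInf_mem (s := {d | ∃ Z, DefSet L M Z ∧ s ⊆ Z ∧ dm L M Z = d})
    ⟨_, Set.univ, DefSet.univ L M α, Set.subset_univ s, rfl⟩

theorem tdm_le_dm_univ (s : Set α) : tdm L M s ≤ dm L M (Set.univ : Set α) :=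
  tdm_le (DefSet.univ L M α) (Set.subset_univ s)

theorem one_le_tdm {s : Set α} (hs : s.Infinite) : 1 ≤ tdm L M s := by
  obtain ⟨Z, hZ, hsZ, h⟩ := exists_dm_eq_tdm (L := L) (M := M) s
  rw [← h, Nat.one_le_iff_ne_zero]
  exact fun h0 => hs (((Tame.dm_eq_zero hZ).1 h0).subset hsZ)

/-- A definable map that is injective on the product of two type-definable sets adds up their
dimensions. -/
theorem add_le_tdm_image {s : Set α} {t : Set β} (hs : TypeDef L M s) (ht : TypeDef L M t)
    (hs' : s.Nonempty) (ht' : t.Nonempty) {f : α × β → γ} (hf : DefMap L M f)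
    (hinj : Set.InjOn f (s ×ˢ t)) :
    tdm L M s + tdm L M t ≤ tdm L M (f '' s ×ˢ t) := by
  obtain ⟨Q, hQ, hstQ, hdQ⟩ := exists_dm_eq_tdm (L := L) (M := M) (f '' s ×ˢ t)
  have hU : DefSet L M {p : (α × β) × (α × β) | f p.1 = f p.2 → p.1 = p.2} :=
    (DefSet.eq (hf.comp DefMap.id.fst) (hf.comp DefMap.id.snd)).imp
      (DefSet.eq DefMap.id.fst DefMap.id.snd)
  -- Injectivity extends to definable sets containing the given type-definable ones.
  obtain ⟨P, P', hP, hP', hsP, hsP', hPP'⟩ := (hs.prod ht).exists_box (hs.prod ht) hU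
    fun p hp h => hinj hp.1 hp.2 h
  obtain ⟨Z, Z', hZ, hZ', hsZ, htZ', hZZ'⟩ := hs.exists_box ht
    ((hP.inter hP').inter (hf.preimage hQ))
    fun p hp => ⟨⟨hsP hp, hsP' hp⟩, hstQ ⟨p, hp, rfl⟩⟩
  calc tdm L M s + tdm L M t ≤ dm L M Z + dm L M Z' :=
        Nat.add_le_add (tdm_le hZ hsZ) (tdm_le hZ' htZ')
    _ ≤ dm L M (Z ×ˢ Z') := add_le_dm_prod hZ hZ' (hs'.mono hsZ) (ht'.mono htZ')
    _ ≤ dm L M Q := by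
        refine dm_le_of_injOn (hZ.prod hZ') hQ hf (fun p hp => (hZZ' hp).2) ?_
        intro p hp p' hp' h
        exact hPP' (a := (p, p')) ⟨(hZZ' hp).1.1, (hZZ' hp').1.2⟩ h
    _ = _ := hdQ

end Dimension

/-! ### Definable groups -/

section Group

/-- The addition of the group `V` is definable. -/
class DefAdd (L : FirstOrder.Language.{u, v}) (M : Type w) [L.Structure M] (V : Type w)
    [Coded L M V] [AddCommGroup V] : Prop where
  add : DefMap L M fun p : V × V => p.1 + p.2

variable {L : FirstOrder.Language.{u, v}} {M : Type w} [L.Structure M]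
variable {α β V : Type w} [Coded L M α] [Coded L M β] [Coded L M V] [AddCommGroup V] [DefAdd L M V]

theorem DefMap.add {f g : α → V} (hf : DefMap L M f) (hg : DefMap L M g) :
    DefMap L M fun x => f x + g x :=
  DefMap.comp (g := fun p : V × V => p.1 + p.2) DefAdd.add (hf.prodMk hg)

theorem DefMap.neg {f : α → V} (hf : DefMap L M f) : DefMap L M fun x => -f x := by
  refine DefMap.of_graph (s := {p : α × V | f p.1 + p.2 = 0})
    (DefSet.eq ((hf.comp DefMap.id.fst).add DefMap.id.snd) (DefMap.const 0)) fun x y => ?_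
  exact neg_eq_iff_add_eq_zero

theorem DefMap.sub {f g : α → V} (hf : DefMap L M f) (hg : DefMap L M g) :
    DefMap L M fun x => f x - g x := by
  simpa only [sub_eq_add_neg] using hf.add hg.neg

theorem DefMap.finset_sum {ι : Type*} (J : Finset ι) {f : ι → α → V}
    (hf : ∀ i ∈ J, DefMap L M (f i)) : DefMap L M fun x => ∑ i ∈ J, f i x := by
  classical
  induction J using Finset.induction_on with
  | empty => simpa using DefMap.const (0 : V)
  | insert a J ha ih =>
    simp only [Finset.sum_insert ha]
    exact (hf a (Finset.mem_insert_self a J)).add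
      (ih fun i hi => hf i (Finset.mem_insert_of_mem hi))

theorem DefSet.sup {B C : AddSubgroup V} (hB : DefSet L M (B : Set V))
    (hC : DefSet L M (C : Set V)) : DefSet L M ((B ⊔ C : AddSubgroup V) : Set V) := by
  refine ((hB.prod hC).image (DefAdd.add (L := L) (M := M) (V := V))).of_eq ?_
  ext x
  simp only [Set.mem_image, Set.mem_prod, Prod.exists, SetLike.mem_coe, AddSubgroup.mem_sup]
  exact ⟨fun ⟨a, b, ⟨ha, hb⟩, h⟩ => ⟨a, ha, b, hb, h⟩,
    fun ⟨a, ha, b, hb, h⟩ => ⟨a, b, ⟨ha, hb⟩, h⟩⟩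

variable (L M) in
/-- The quotient of a definable group by a definable subgroup is coded. -/
@[reducible]
def Coded.quotient {B : AddSubgroup V} (hB : DefSet L M (B : Set V)) : Coded L M (V ⧸ B) :=
  Coded.ofSurjective L M (f := fun x : V => (x : V ⧸ B)) Quotient.mk_surjective <| by
    refine (hB.mem (DefMap.id.fst.neg.add DefMap.id.snd)).of_eq ?_
    ext p
    exact (QuotientAddGroup.eq (s := B)).symm

theorem DefMap.quotient_mk {B : AddSubgroup V} (hB : DefSet L M (B : Set V)) :
    letI := Coded.quotient L M hB
    DefMap L M (fun x : V => (x : V ⧸ B)) := by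
  let _ := Coded.quotient L M hB
  refine Set.Definable.of_eq (hB.mem (DefMap.id.fst.neg.add DefMap.id.snd) :
    DefSet L M {p : V × V | -p.1 + p.2 ∈ B}) ?_
  ext c
  constructor
  · rintro ⟨⟨x, y⟩, h, hx, hy⟩
    exact ⟨(x, (y : V ⧸ B)), (QuotientAddGroup.eq (s := B)).2 h, hx, ⟨y, rfl, hy⟩⟩
  · rintro ⟨⟨x, _⟩, h, hx, ⟨y, rfl, hy⟩⟩
    exact ⟨(x, y), (QuotientAddGroup.eq (s := B)).1 h, hx, hy⟩

variable [Tame L M]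

/-- A definable subgroup of full dimension has finite index. -/
theorem relIndex_ne_zero_of_dm_le {B C : AddSubgroup V} (hB : DefSet L M (B : Set V))
    (hC : DefSet L M (C : Set V)) (hBC : B ≤ C) (h : dm L M (C : Set V) ≤ dm L M (B : Set V)) :
    B.relIndex C ≠ 0 := by
  let _ := Coded.quotient L M hB
  have hmk := DefMap.quotient_mk hB
  -- The fibres of `C → C / B` are cosets of `B`, so `C / B` has dimension zero.
  have hfib := Tame.add_le_dm (k := dm L M (B : Set V)) hC (hC.image hmk) hmk
    ⟨_, 0, C.zero_mem, rfl⟩ ?_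
  · have h0 : dm L M ((fun x : V => (x : V ⧸ B)) '' C) = 0 := by
      have h' : dm L M ((fun x : V => (x : V ⧸ B)) '' C) + dm L M (B : Set V) ≤
        dm L M (C : Set V) := hfib
      omega
    have hfin := (Tame.dm_eq_zero (hC.image hmk)).1 h0
    have := hfin.to_subtype
    have : Finite (C ⧸ B.addSubgroupOf C) := by
      refine Finite.of_injective (β := (fun x : V => (x : V ⧸ B)) '' (C : Set V))
        (fun q => ⟨Quotient.liftOn' q (fun x : C => ((x : V) : V ⧸ B)) fun x y h => ?_, ?_⟩) ?_
      · rw [QuotientAddGroup.leftRel_apply] at h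
        exact (QuotientAddGroup.eq (s := B)).2 h
      · induction q using QuotientAddGroup.induction_on with
        | H x => exact ⟨x, x.2, rfl⟩
      · intro q q' h
        induction q using QuotientAddGroup.induction_on with
        | H x =>
        induction q' using QuotientAddGroup.induction_on with
        | H y =>
        have h' := (QuotientAddGroup.eq (s := B)).1 (Subtype.ext_iff.1 h)
        exact QuotientAddGroup.eq.2 h'
    exact (AddSubgroup.finiteIndex_of_finite_quotient (H := B.addSubgroupOf C)).index_ne_zero
  · rintro _ ⟨c, hc, rfl⟩
    refine ⟨⟨c, hc, rfl⟩, ?_⟩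
    refine dm_le_of_injOn (f := fun x => c + x) hB
      (hC.inter (hmk.preimage (DefSet.singleton _)))
      ((DefMap.const c).add DefMap.id) (fun x hx => ⟨C.add_mem hc (hBC hx), ?_⟩)
      (fun x _ y _ h => add_left_cancel h)
    exact ((QuotientAddGroup.eq (s := B)).2 (by simpa using hx)).symm

/-- The dimensions of the image and of the kernel of a definable homomorphism on a definable
subgroup. -/
theorem dm_image_add_dm_ker_le {W : Type w} [Coded L M W] [AddCommGroup W] {f : V →+ W}
    (hf : DefMap L M f) {B : AddSubgroup V} (hB : DefSet L M (B : Set V)) :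
    dm L M (f '' B) + dm L M {x | x ∈ B ∧ f x = 0} ≤ dm L M (B : Set V) := by
  refine Tame.add_le_dm hB (hB.image hf) hf ⟨_, 0, B.zero_mem, rfl⟩ ?_
  rintro _ ⟨b, hb, rfl⟩
  refine ⟨⟨b, hb, rfl⟩, dm_le_of_injOn (f := fun x => b + x)
    (hB.and (DefSet.eq hf (DefMap.const 0)))
    (hB.inter (hf.preimage (DefSet.singleton _))) ((DefMap.const b).add DefMap.id)
    (fun x hx => ⟨B.add_mem hb hx.1, ?_⟩) (fun x _ y _ h => add_left_cancel h)⟩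
  simp [hx.2]

end Group

/-! ### Saturated models of finite-dimensional theories are tame -/

section Compact

variable {L : FirstOrder.Language.{u, v}} {M : Type w} [L.Structure M]
variable {α β : Type w} [Coded L M α] [Coded L M β]

variable (L M α) in
/-- Small families of definable subsets of `α` with the finite intersection property have a
common point. -/
def IsCompact (κ : Cardinal.{w}) : Prop :=
  ∀ ⦃ι : Type w⦄ (D : ι → Set α), #ι < κ → (∀ i, DefSet L M (D i)) →
    (∀ J : Finset ι, (⋂ i ∈ J, D i).Nonempty) → (⋂ i, D i).Nonempty

theorem IsSaturated.isCompact {κ : Cardinal.{w}} (hκ : ℵ₀ < κ) (hM : IsSaturated L M κ) :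
    IsCompact L M M κ := by
  classical
  intro ι D hι hD hJ
  -- Each definable set uses finitely many parameters, so fewer than `κ` parameters occur.
  have h₁ : ∀ i, ∃ A₀ : Finset M, (A₀ : Set M).Definable L (codes L M (D i)) := fun i => by
    obtain ⟨A₀, -, h⟩ := Set.definable_iff_finitely_definable.1 (hD i)
    exact ⟨A₀, h⟩
  choose A₀ hA₀ using h₁
  have hB : #(⋃ i, (A₀ i : Set M) : Set M) < κ := by
    refine (mk_iUnion_le _).trans_lt (mul_lt_of_lt hκ.le hι ?_)
    refine lt_of_le_of_lt (ciSup_le' fun i => ?_) hκ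
    exact (lt_aleph0_of_finite _).le
  have h₂ := fun i => Set.definable_iff_exists_formula_sum.1
    ((hA₀ i).mono (Set.subset_iUnion (fun i => (A₀ i : Set M)) i))
  choose φ hφ using h₂
  have key : ∀ i m, (φ i).Realize (Sum.elim (fun b => (b : M)) fun _ : Unit => m) ↔ m ∈ D i := by
    intro i m
    have := Set.ext_iff.1 (hφ i) (fun _ : Unit => m)
    refine this.symm.trans ⟨?_, fun h => ⟨m, h, rfl⟩⟩
    rintro ⟨x, hx, rfl⟩
    exact hx
  obtain ⟨m, hm⟩ := hM _ hB (Set.range φ) fun q hq => by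
    choose i hi using fun ψ : q => hq ψ.2
    obtain ⟨m, hm⟩ := hJ (Finset.univ.image i)
    refine ⟨m, fun ψ hψ => ?_⟩
    have h := hi ⟨ψ, hψ⟩
    dsimp only at h
    rw [← h, key]
    exact Set.mem_iInter₂.1 hm _ (Finset.mem_image_of_mem i (Finset.mem_univ _))
  exact ⟨m, Set.mem_iInter.2 fun i => (key i m).1 (hm _ ⟨i, rfl⟩)⟩

theorem IsCompact.of_surjective {κ : Cardinal.{w}} (h : IsCompact L M α κ) {f : α → β}
    (hf : DefMap L M f) (hs : Function.Surjective f) : IsCompact L M β κ := by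
  intro ι D hι hD hJ
  obtain ⟨x, hx⟩ := h (fun i => f ⁻¹' D i) hι (fun i => hf.preimage (hD i)) fun J => by
    obtain ⟨y, hy⟩ := hJ J
    obtain ⟨x, rfl⟩ := hs y
    exact ⟨x, by simpa using hy⟩
  exact ⟨f x, by simpa using hx⟩

/-- Compactness of a product: a first coordinate is chosen for the projections of the finite
intersections, and then a second one. -/
theorem IsCompact.prod {κ : Cardinal.{w}} (hκ : ℵ₀ < κ) (h : IsCompact L M α κ)
    (h' : IsCompact L M β κ) : IsCompact L M (α × β) κ := by
  classical
  intro ι D hι hD hJ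
  obtain ⟨x, hx⟩ := h (fun J : Finset ι => {x : α | ∃ y, (x, y) ∈ ⋂ i ∈ J, D i})
    (mk_finset_lt hκ hι)
    (fun J => DefSet.exists (DefSet.biInter_finset J fun i _ => hD i)) fun 𝒥 => by
      obtain ⟨⟨x, y⟩, hxy⟩ := hJ (𝒥.sup fun J => J)
      refine ⟨x, Set.mem_iInter₂.2 fun J hJ => ⟨y, ?_⟩⟩
      simp only [Set.mem_iInter] at hxy ⊢
      exact fun i hi => hxy i (Finset.le_sup (f := fun J => J) hJ hi)
  -- The chosen `x` extends to a point of each finite intersection.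
  obtain ⟨y, hy⟩ := h' (fun i => {y : β | (x, y) ∈ D i}) hι
    (fun i => (hD i).mem ((DefMap.const x).prodMk DefMap.id)) fun J => by
      obtain ⟨y, hy⟩ := Set.mem_iInter.1 hx J
      exact ⟨y, by simpa using hy⟩
  exact ⟨(x, y), by simpa using hy⟩

theorem IsCompact.fin {κ : Cardinal.{w}} (hκ : ℵ₀ < κ) (h : IsCompact L M M κ) (k : ℕ) :
    IsCompact L M (Fin k → M) κ := by
  induction k with
  | zero =>
    intro ι D hι hD hJ
    refine ⟨Fin.elim0, Set.mem_iInter.2 fun i => ?_⟩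
    obtain ⟨x, hx⟩ := hJ {i}
    rw [Subsingleton.elim Fin.elim0 x]
    simpa using hx
  | succ k ih =>
    refine (h.prod hκ ih).of_surjective (f := fun p i => Fin.cons (α := fun _ => M) p.1 p.2 i)
      (DefMap.pi fun i => ?_) fun x => ⟨(x 0, Fin.tail x), Fin.cons_self_tail x⟩
    refine Fin.cases ?_ (fun j => ?_) i
    · exact DefMap.id.fst
    · exact DefMap.id.snd.apply j

theorem IsCompact.coded {κ : Cardinal.{w}} (hκ : ℵ₀ < κ) (h : IsCompact L M M κ) :
    IsCompact L M α κ := by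
  have h' : IsCompact L M (Coded.ι L M α → M) κ := by
    refine (h.fin hκ (Nat.card (Coded.ι L M α))).of_surjective
      (f := fun x i => x (Finite.equivFin _ i)) (DefMap.pi fun i => DefMap.id.apply _) fun x =>
      ⟨fun j => x ((Finite.equivFin _).symm j), by simp⟩
  intro ι D hι hD hJ
  rcases isEmpty_or_nonempty ι with hι' | ⟨⟨i₀⟩⟩
  · simpa using hJ ∅
  · obtain ⟨c, hc⟩ := h' (fun i => codes L M (D i)) hι (fun i => defSet_tuple_iff.2 (hD i))
      fun J => by
        obtain ⟨x, hx⟩ := hJ J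
        obtain ⟨c, hc⟩ := Coded.surj (L := L) (M := M) x
        exact ⟨c, Set.mem_iInter₂.2 fun i hi => ⟨x, Set.mem_iInter₂.1 hx i hi, hc⟩⟩
    rw [Set.mem_iInter] at hc
    obtain ⟨x, -, hx⟩ := hc i₀
    exact ⟨x, Set.mem_iInter.2 fun i => (mem_codes_iff hx).1 (hc i)⟩

end Compact

section Dimension

variable {L : FirstOrder.Language.{u, v}} {M : Type w} [L.Structure M]
variable {α β : Type w} [Coded L M α] [Coded L M β]

variable (L M α) in
/-- The code of a point, as a tuple indexed by an initial segment of the natural numbers. -/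
noncomputable def Coded.reindex (x : Fin (Nat.card (Coded.ι L M α)) → M) : Coded.ι L M α → M :=
  x ∘ Finite.equivFin (Coded.ι L M α)

theorem exists_reindex (v : α) : ∃ x, IsCode L M v (Coded.reindex L M α x) := by
  obtain ⟨c, hc⟩ := Coded.surj (L := L) (M := M) v
  refine ⟨c ∘ (Finite.equivFin _).symm, ?_⟩
  have : Coded.reindex L M α (c ∘ (Finite.equivFin _).symm) = c := by
    ext i; simp [Coded.reindex]
  rwa [this]

/-- A definable set of points of a coded type, as an interpretable set. -/
noncomputable def DefSet.interp {s : Set α} (hs : DefSet L M s) :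
    InterpSet L M (Nat.card (Coded.ι L M α)) where
  E x y := ∃ v ∈ s, IsCode L M v (Coded.reindex L M α x) ∧ IsCode L M v (Coded.reindex L M α y)
  symm := fun ⟨v, hv, h, h'⟩ => ⟨v, hv, h', h⟩
  trans := by
    rintro x y z ⟨v, hv, h, h'⟩ ⟨v', _, k, k'⟩
    obtain rfl := Coded.unique h' k
    exact ⟨v, hv, h, k'⟩
  definable := by
    have h := (Set.Definable.inter (Coded.definable (L := L) (M := M) (α := α))
      (Set.Definable.preimage_comp Sum.inl hs)).preimage_comp
      (Sum.map (Finite.equivFin _) (Finite.equivFin _) : _ → Fin _ ⊕ Fin _)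
    refine h.of_eq ?_
    ext p
    constructor
    · rintro ⟨⟨x, h, h'⟩, h''⟩
      exact ⟨x, (mem_codes_iff h).1 h'', h, h'⟩
    · rintro ⟨x, hx, h, h'⟩
      exact ⟨⟨x, h, h'⟩, ⟨x, hx, h⟩⟩

theorem DefSet.interp_isSubset {s t : Set α} (hs : DefSet L M s) (ht : DefSet L M t)
    (hst : s ⊆ t) : hs.interp.IsSubset ht.interp := by
  intro x y
  constructor
  · rintro ⟨v, hv, h, h'⟩
    exact ⟨⟨v, hst hv, h, h'⟩, ⟨v, hv, h, h⟩⟩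
  · rintro ⟨⟨v, _, h, h'⟩, ⟨v', hv', k, -⟩⟩
    obtain rfl := Coded.unique h k
    exact ⟨v, hv', h, h'⟩

/-- The points of the interpretable set associated with `s` are the elements of `s`. -/
noncomputable def DefSet.ptEquiv {s : Set α} (hs : DefSet L M s) : hs.interp.Pt ≃ s :=
  Equiv.ofBijective
    (Quotient.lift (fun x : {x // hs.interp.E x x} => (⟨x.2.choose, x.2.choose_spec.1⟩ : s))
      (by
        rintro ⟨x, hx⟩ ⟨y, hy⟩ ⟨v, _, h, h'⟩
        refine Subtype.ext ?_
        exact (Coded.unique hx.choose_spec.2.1 h).trans (Coded.unique hy.choose_spec.2.1 h').symm))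
    (by
      constructor
      · rintro ⟨x, hx⟩ ⟨y, hy⟩ h
        refine Quotient.sound ⟨_, hx.choose_spec.1, hx.choose_spec.2.1, ?_⟩
        have h' : hx.choose = hy.choose := Subtype.ext_iff.1 h
        rw [h']
        exact hy.choose_spec.2.1
      · rintro ⟨v, hv⟩
        obtain ⟨x, hx⟩ := exists_reindex (L := L) (M := M) v
        have hxx : hs.interp.E x x := ⟨v, hv, hx, hx⟩
        exact ⟨Quotient.mk _ ⟨x, hxx⟩, Subtype.ext (Coded.unique hxx.choose_spec.2.1 hx)⟩)

/-- A definable map, as an interpretable function. -/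
noncomputable def DefMap.interp {f : α → β} (hf : DefMap L M f) {s : Set α} {t : Set β}
    (hs : DefSet L M s) (ht : DefSet L M t) (h : Set.MapsTo f s t) :
    hs.interp.Fun ht.interp where
  F x y := ∃ v ∈ s, IsCode L M v (Coded.reindex L M α x) ∧
    IsCode L M (f v) (Coded.reindex L M β y)
  dom := fun ⟨v, hv, h₁, h₂⟩ => ⟨⟨v, hv, h₁, h₁⟩, ⟨f v, h hv, h₂, h₂⟩⟩
  congr := by
    rintro x x' y y' ⟨v, _, h₁, h₁'⟩ ⟨z, _, h₂, h₂'⟩ ⟨v', hv', h₃, h₃'⟩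
    obtain rfl := Coded.unique h₁ h₃
    obtain rfl := Coded.unique h₂ h₃'
    exact ⟨v, hv', h₁', h₂'⟩
  total := by
    rintro x ⟨v, hv, h₁, -⟩
    obtain ⟨y, hy⟩ := exists_reindex (L := L) (M := M) (f v)
    exact ⟨y, v, hv, h₁, hy⟩
  unique := by
    rintro x y y' ⟨v, hv, h₁, h₂⟩ ⟨v', _, h₃, h₄⟩
    obtain rfl := Coded.unique h₁ h₃
    exact ⟨f v, h hv, h₂, h₄⟩
  definable := by
    have h := (hf.and (hs.mem DefMap.id.fst)).preimage_comp
      (Sum.map (Finite.equivFin _) (Finite.equivFin _) : _ → Fin _ ⊕ Fin _)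
    refine Set.Definable.of_eq h ?_
    ext p
    constructor
    · rintro ⟨⟨x, y⟩, ⟨hxy, hx⟩, h, h'⟩
      obtain rfl : f x = y := hxy
      exact ⟨x, hx, h, h'⟩
    · rintro ⟨x, hx, h, h'⟩
      exact ⟨(x, f x), ⟨rfl, hx⟩, h, h'⟩

theorem DefMap.fiber_interp {f : α → β} (hf : DefMap L M f) {s : Set α} {t : Set β}
    (hs : DefSet L M s) (ht : DefSet L M t) (h : Set.MapsTo f s t) {y : β}
    {d : Fin (Nat.card (Coded.ι L M β)) → M} (hd : IsCode L M y (Coded.reindex L M β d)) :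
    (hf.interp hs ht h).fiber d = (hs.inter (hf.preimage (DefSet.singleton y))).interp := by
  have : ((hf.interp hs ht h).fiber d).E =
      (hs.inter (hf.preimage (DefSet.singleton y))).interp.E := by
    ext x x'
    constructor
    · rintro ⟨⟨v, hv, h₁, h₂⟩, ⟨v', _, h₃, h₄⟩⟩
      obtain rfl := Coded.unique h₁ h₃
      exact ⟨v, ⟨hv, Coded.unique h₄ hd⟩, h₁, h₂⟩
    · rintro ⟨v, ⟨hv, rfl⟩, h₁, h₂⟩
      exact ⟨⟨v, hv, h₁, h₂⟩, ⟨v, hv, h₁, hd⟩⟩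
  generalize (hf.interp hs ht h).fiber d = X at this ⊢
  cases X
  cases this
  rfl

end Dimension

section Construction

variable {L : FirstOrder.Language.{u, v}} {T : L.Theory} {M : Type w} [L.Structure M]
  [M ⊨ T] [Nonempty M] (D : Dimension.{u, v, w} T)
variable {α β : Type w} [Coded L M α] [Coded L M β]

/-- The dimension of an interpretable set of a model. -/
noncomputable def Dimension.dimOf {n : ℕ} (X : InterpSet L M n) : WithBot ℕ :=
  D.dim (FirstOrder.Language.Theory.ModelType.of T M) X

theorem Dimension.dimOf_of_finite {s : Set α} (hs : DefSet L M s) (hne : s.Nonempty)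
    (hfin : s.Finite) : D.dimOf hs.interp = 0 := by
  have := hfin.to_subtype
  obtain ⟨x, hx⟩ := hne
  exact (D.dim_eq_zero (FirstOrder.Language.Theory.ModelType.of T M) hs.interp
    ⟨hs.ptEquiv.symm ⟨x, hx⟩⟩).2 (Finite.of_equiv _ hs.ptEquiv.symm)

theorem Dimension.dimOf_mono {s t : Set α} (hs : DefSet L M s) (ht : DefSet L M t)
    (hst : s ⊆ t) : D.dimOf hs.interp ≤ D.dimOf ht.interp := by
  have := D.dim_union (FirstOrder.Language.Theory.ModelType.of T M) hs.interp ht.interp ht.interp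
    (hs.interp_isSubset ht hst) (ht.interp_isSubset ht subset_rfl) fun x h => .inr h
  exact (le_max_left _ _).trans this.ge

theorem Dimension.dimOf_nonneg {s : Set α} (hs : DefSet L M s) (hne : s.Nonempty) :
    0 ≤ D.dimOf hs.interp := by
  obtain ⟨x, hx⟩ := hne
  rw [← D.dimOf_of_finite (DefSet.singleton (L := L) (M := M) x) (Set.singleton_nonempty x)
    (Set.finite_singleton x)]
  exact D.dimOf_mono _ _ (Set.singleton_subset_iff.2 hx)

variable (M) in
open scoped Classical in
/-- The dimension of a definable set of points, as a natural number. -/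
noncomputable def Dimension.natDim (s : Set α) : ℕ :=
  if h : DefSet L M s then (D.dimOf h.interp).unbotD 0 else 0

theorem Dimension.coe_natDim {s : Set α} (hs : DefSet L M s) (hne : s.Nonempty) :
    ((D.natDim M s : ℕ) : WithBot ℕ) = D.dimOf hs.interp := by
  rw [Dimension.natDim, dif_pos hs]
  have h := D.dimOf_nonneg hs hne
  cases hd : D.dimOf hs.interp with
  | bot => rw [hd] at h; exact absurd h (by decide)
  | coe n => rfl

theorem Dimension.natDim_empty : D.natDim M (∅ : Set α) = 0 := by
  rw [Dimension.natDim, dif_pos (DefSet.empty L M α)]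
  have : D.dimOf (DefSet.empty L M α).interp = ⊥ :=
    D.dim_empty (FirstOrder.Language.Theory.ModelType.of T M) _
      (DefSet.empty L M α).ptEquiv.isEmpty
  rw [this]
  rfl

/-- A sufficiently saturated model of a finite-dimensional theory is tame. -/
@[reducible]
noncomputable def Dimension.tame {κ : Cardinal.{w}} (hκ : ℵ₀ < κ) (hM : IsSaturated L M κ) :
    Tame L M where
  κ := κ
  aleph0_lt := hκ
  compact D hι hD hJ := (hM.isCompact hκ).coded hκ D hι hD hJ
  dm := D.natDim M
  dm_mono := by
    intro α _ s t hs ht hst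
    rcases s.eq_empty_or_nonempty with rfl | hne
    · rw [D.natDim_empty]; exact Nat.zero_le _
    · have := D.dimOf_mono hs ht hst
      rw [← D.coe_natDim hs hne, ← D.coe_natDim ht (hne.mono hst)] at this
      exact_mod_cast this
  dm_eq_zero := by
    intro α _ s hs
    rcases s.eq_empty_or_nonempty with rfl | hne
    · simp [D.natDim_empty]
    · have h := D.coe_natDim hs hne
      have h' : D.dimOf hs.interp = 0 ↔ Finite hs.interp.Pt :=
        D.dim_eq_zero (FirstOrder.Language.Theory.ModelType.of T M) hs.interp
          (hs.ptEquiv.symm.nonempty_congr.1 hne.to_subtype)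
      rw [← h, hs.ptEquiv.finite_iff] at h'
      exact_mod_cast h'
  add_le_dm := by
    intro α β _ _ s t f k hs ht hf hne h
    -- The function is restricted to the preimage of `t`, so that it becomes an interpretable
    -- function into `t`.
    have hs' := hs.inter (hf.preimage ht)
    have hmaps : Set.MapsTo f (s ∩ f ⁻¹' t) t := fun x hx => hx.2
    have hne' : (s ∩ f ⁻¹' t).Nonempty := by
      obtain ⟨y, hy⟩ := hne
      obtain ⟨x, hx, rfl⟩ := (h y hy).1
      exact ⟨x, hx, hy⟩
    have key : D.dimOf ht.interp + k ≤ D.dimOf hs'.interp := by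
      refine D.le_dim (FirstOrder.Language.Theory.ModelType.of T M) hs'.interp ht.interp
        (hf.interp hs' ht hmaps) k ?_
      rintro d ⟨y, hy, hd, -⟩
      have e := hf.fiber_interp hs' ht hmaps hd
      refine le_of_le_of_eq ?_ (congrArg D.dimOf e.symm)
      have e' : s ∩ f ⁻¹' {y} ⊆ s ∩ f ⁻¹' t ∩ f ⁻¹' {y} := by
        rintro x ⟨hx, rfl⟩
        exact ⟨⟨hx, hy⟩, rfl⟩
      refine le_trans ?_ (D.dimOf_mono (hs.inter (hf.preimage (DefSet.singleton y))) _ e')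
      rw [← D.coe_natDim _ (h y hy).1]
      exact_mod_cast (h y hy).2
    have hle := D.dimOf_mono hs' hs Set.inter_subset_left
    have := key.trans hle
    rw [← D.coe_natDim ht hne, ← D.coe_natDim hs (hne'.mono Set.inter_subset_left)] at this
    exact_mod_cast this
  dm_le_add := by
    intro α β _ _ s t f k hs ht hf hst h
    rcases s.eq_empty_or_nonempty with rfl | hne
    · rw [D.natDim_empty]; exact Nat.zero_le _
    have key : D.dimOf hs.interp ≤ D.dimOf ht.interp + k := by
      refine D.dim_le (FirstOrder.Language.Theory.ModelType.of T M) hs.interp ht.interp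
        (hf.interp hs ht hst) k ?_
      rintro d ⟨y, hy, hd, -⟩
      have e := hf.fiber_interp hs ht hst hd
      refine le_of_eq_of_le (congrArg D.dimOf e) ?_
      rcases (s ∩ f ⁻¹' {y}).eq_empty_or_nonempty with hem | hne'
      · have : D.dimOf (hs.inter (hf.preimage (DefSet.singleton y))).interp = ⊥ := by
          refine D.dim_empty (FirstOrder.Language.Theory.ModelType.of T M) _ ?_
          have := Set.isEmpty_coe_sort.2 hem
          exact (hs.inter (hf.preimage (DefSet.singleton y))).ptEquiv.isEmpty
        rw [this]
        exact bot_le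
      · rw [← D.coe_natDim _ hne']
        exact_mod_cast h y hy
    rw [← D.coe_natDim hs hne, ← D.coe_natDim ht (hne.image f |>.mono hst.image_subset)] at key
    exact_mod_cast key

end Construction

/-! ### Transfer to elementary extensions -/

section Transfer

variable {L : FirstOrder.Language.{u, v}} {M N : Type w} [L.Structure M] [L.Structure N]
variable {α β : Type}

/-- `S` and `S'` are the sets defined by one formula, with parameters in `M`, in `M` and in its
elementary extension `N`. -/
def Corresponds (j : M ↪ₑ[L] N) (S : Set (α → M)) (S' : Set (α → N)) : Prop :=
  ∃ χ : L.Formula (M ⊕ α), S = {x | χ.Realize (Sum.elim id x)} ∧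
    S' = {x | χ.Realize (Sum.elim j x)}

variable {j : M ↪ₑ[L] N} {S T : Set (α → M)} {S' T' : Set (α → N)}

theorem Corresponds.inter (h : Corresponds j S S') (h' : Corresponds j T T') :
    Corresponds j (S ∩ T) (S' ∩ T') := by
  obtain ⟨χ, rfl, rfl⟩ := h
  obtain ⟨χ', rfl, rfl⟩ := h'
  exact ⟨χ ⊓ χ', by ext; simp, by ext; simp⟩

theorem Corresponds.compl (h : Corresponds j S S') : Corresponds j Sᶜ S'ᶜ := by
  obtain ⟨χ, rfl, rfl⟩ := h
  refine ⟨χ.not, ?_, ?_⟩ <;> · ext; simp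

theorem Corresponds.iInter {ι : Type*} [Finite ι] {S : ι → Set (α → M)} {S' : ι → Set (α → N)}
    (h : ∀ i, Corresponds j (S i) (S' i)) : Corresponds j (⋂ i, S i) (⋂ i, S' i) := by
  choose χ hS hS' using h
  refine ⟨FirstOrder.Language.Formula.iInf χ, ?_, ?_⟩ <;> · ext; simp [hS, hS']

theorem Corresponds.preimage_comp (f : α → β) (h : Corresponds j S S') :
    Corresponds j {x : β → M | x ∘ f ∈ S} {x : β → N | x ∘ f ∈ S'} := by
  obtain ⟨χ, rfl, rfl⟩ := h
  refine ⟨χ.relabel (Sum.map id f), ?_, ?_⟩ <;>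
  · ext x
    simp [Sum.elim_comp_map]

theorem Corresponds.exists [Finite β] {S : Set (α ⊕ β → M)} {S' : Set (α ⊕ β → N)}
    (h : Corresponds j S S') :
    Corresponds j {x | ∃ y, Sum.elim x y ∈ S} {x | ∃ y, Sum.elim x y ∈ S'} := by
  obtain ⟨χ, rfl, rfl⟩ := h
  refine ⟨(χ.relabel (Equiv.sumAssoc M α β).symm).iExs β, ?_, ?_⟩ <;>
  · ext x
    simp only [Set.mem_ofPred_eq, FirstOrder.Language.Formula.realize_iExs,
      FirstOrder.Language.Formula.realize_relabel]
    refine exists_congr fun y => ?_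
    refine iff_of_eq (congrArg _ ?_)
    ext (i | i | i) <;> rfl

theorem Corresponds.eq (i k : α) :
    Corresponds j {x | x i = x k} {x | x i = x k} := by
  refine ⟨(FirstOrder.Language.Term.var (Sum.inr i)).equal
    (FirstOrder.Language.Term.var (Sum.inr k)), ?_, ?_⟩ <;>
  · ext x
    simp [FirstOrder.Language.Formula.realize_equal]

theorem Corresponds.nonempty [Finite α] (h : Corresponds j S S') (hS : S'.Nonempty) :
    S.Nonempty := by
  obtain ⟨χ, rfl, rfl⟩ := h
  obtain ⟨x, hx⟩ := hS
  have h₁ : (χ.iExs α).Realize (j ∘ id) :=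
    FirstOrder.Language.Formula.realize_iExs.2 ⟨x, hx⟩
  rw [j.map_formula] at h₁
  exact FirstOrder.Language.Formula.realize_iExs.1 h₁

theorem Corresponds.subset [Finite α] (h : Corresponds j S S') (h' : Corresponds j T T')
    (hST : S ⊆ T) : S' ⊆ T' := by
  by_contra hc
  obtain ⟨x, hx, hx'⟩ := Set.not_subset.1 hc
  obtain ⟨y, hy, hy'⟩ := (h.inter h'.compl).nonempty ⟨x, hx, hx'⟩
  exact hy' (hST hy)

theorem Corresponds.extend_eq [Finite α] (h : Corresponds j S S') : extend L j S = S' := by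
  ext x
  constructor
  · rintro ⟨φ, hφ, hx⟩
    have h' : Corresponds j S {x | φ.Realize (Sum.elim j x)} := ⟨φ, hφ, rfl⟩
    exact h'.subset h subset_rfl hx
  · intro hx
    obtain ⟨χ, hS, rfl⟩ := h
    exact ⟨χ, hS, hx⟩

theorem Corresponds.definable (h : Corresponds j S S') : (Set.univ : Set M).Definable L S := by
  obtain ⟨χ, rfl, -⟩ := h
  refine Set.definable_iff_exists_formula_sum.2
    ⟨χ.relabel (Sum.map (fun m => ⟨m, trivial⟩) id), ?_⟩
  ext x
  simp only [Set.mem_ofPred_eq, FirstOrder.Language.Formula.realize_relabel]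
  refine iff_of_eq (congrArg _ ?_)
  ext (i | i) <;> rfl

theorem exists_corresponds (j : M ↪ₑ[L] N) (h : (Set.univ : Set M).Definable L S) :
    ∃ S', Corresponds j S S' := by
  obtain ⟨φ, rfl⟩ := Set.definable_iff_exists_formula_sum.1 h
  refine ⟨_, φ.relabel (Sum.map Subtype.val id), ?_, rfl⟩
  ext x
  simp only [Set.mem_ofPred_eq, FirstOrder.Language.Formula.realize_relabel]
  refine iff_of_eq (congrArg _ ?_)
  ext (i | i) <;> rfl

theorem corresponds_formula (j : M ↪ₑ[L] N) {X : Set M} (ψ : L.Formula (X ⊕ α)) :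
    Corresponds j {x | ψ.Realize (Sum.elim (fun b : X => (b : M)) x)}
      {x | ψ.Realize (Sum.elim (fun b : X => j b) x)} := by
  refine ⟨ψ.relabel (Sum.map Subtype.val id), ?_, ?_⟩ <;>
  · ext x
    simp only [Set.mem_ofPred_eq, FirstOrder.Language.Formula.realize_relabel]
    refine iff_of_eq (congrArg _ ?_)
    ext (i | i) <;> rfl

theorem corresponds_formula' (j : M ↪ₑ[L] N) (φ : L.Formula α) :
    Corresponds j {x | φ.Realize x} {x | φ.Realize x} := by
  refine ⟨φ.relabel Sum.inr, ?_, ?_⟩ <;>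
  · ext x
    simp only [Set.mem_ofPred_eq, FirstOrder.Language.Formula.realize_relabel]
    refine iff_of_eq (congrArg _ ?_)
    ext i; rfl

/-- For a family `S` of relations and the graph `G` of an addition, the tuples `(b, b', c)` such
that `c` is a difference of a value of `S_b` and a value of `S_b'` at some point. -/
def differences {P : Type w} {n k : ℕ} (S : Set ((Fin n ⊕ Fin n) ⊕ Fin k → P))
    (G : Set ((Fin n ⊕ Fin n) ⊕ Fin n → P)) : Set ((Fin k ⊕ Fin k) ⊕ Fin n → P) :=
  {x | ∃ y : Fin 3 × Fin n → P, Sum.elim x y ∈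
    {z | z ∘ Sum.elim (Sum.elim (fun l => .inr (0, l)) (fun l => .inr (1, l)))
      (fun l => .inl (.inl (.inl l))) ∈ S} ∩
    ({z | z ∘ Sum.elim (Sum.elim (fun l => .inr (0, l)) (fun l => .inr (2, l)))
      (fun l => .inl (.inl (.inr l))) ∈ S} ∩
    {z | z ∘ Sum.elim (Sum.elim (fun l => .inl (.inr l)) (fun l => .inr (2, l)))
      (fun l => .inr (1, l)) ∈ G})}

theorem mem_differences {P : Type w} {n k : ℕ} {S : Set ((Fin n ⊕ Fin n) ⊕ Fin k → P)}
    {G : Set ((Fin n ⊕ Fin n) ⊕ Fin n → P)} {b b' : Fin k → P} {c : Fin n → P} :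
    Sum.elim (Sum.elim b b') c ∈ differences S G ↔ ∃ a b₁ b₂ : Fin n → P,
      Sum.elim (Sum.elim a b₁) b ∈ S ∧ Sum.elim (Sum.elim a b₂) b' ∈ S ∧
      Sum.elim (Sum.elim c b₂) b₁ ∈ G := by
  constructor
  · rintro ⟨y, h₁, h₂, h₃⟩
    refine ⟨fun l => y (0, l), fun l => y (1, l), fun l => y (2, l), ?_, ?_, ?_⟩
    · refine (congrArg (· ∈ S) ?_).mp h₁
      ext ((l | l) | l) <;> rfl
    · refine (congrArg (· ∈ S) ?_).mp h₂
      ext ((l | l) | l) <;> rfl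
    · refine (congrArg (· ∈ G) ?_).mp h₃
      ext ((l | l) | l) <;> rfl
  · rintro ⟨a, b₁, b₂, h₁, h₂, h₃⟩
    refine ⟨fun p => ![a, b₁, b₂] p.1 p.2, ?_, ?_, ?_⟩
    · refine (congrArg (· ∈ S) ?_).mp h₁
      ext ((l | l) | l) <;> rfl
    · refine (congrArg (· ∈ S) ?_).mp h₂
      ext ((l | l) | l) <;> rfl
    · refine (congrArg (· ∈ G) ?_).mp h₃
      ext ((l | l) | l) <;> rfl

theorem Corresponds.differences {n k : ℕ} {S : Set ((Fin n ⊕ Fin n) ⊕ Fin k → M)}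
    {S' : Set ((Fin n ⊕ Fin n) ⊕ Fin k → N)} (hS : Corresponds j S S')
    {G : Set ((Fin n ⊕ Fin n) ⊕ Fin n → M)} {G' : Set ((Fin n ⊕ Fin n) ⊕ Fin n → N)}
    (hG : Corresponds j G G') : Corresponds j (differences S G) (differences S' G') :=
  ((hS.preimage_comp _).inter ((hS.preimage_comp _).inter (hG.preimage_comp _))).exists

/-- The tuples `(b_i)` such that for all `i ≠ i'` there are `t` distinct tuples `c` with
`(b_i, b_i', c)` in `D`. -/
def cliques {P : Type w} {n k : ℕ} (m t : ℕ) (D : Set ((Fin k ⊕ Fin k) ⊕ Fin n → P)) :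
    Set (Fin m × Fin k → P) :=
  ⋂ i : {i : Fin m × Fin m // i.1 ≠ i.2}, {b | ∃ y : Fin t × Fin n → P, Sum.elim b y ∈
    (⋂ s : Fin t, {z | z ∘ Sum.elim (Sum.elim (fun l => .inl (i.1.1, l))
      (fun l => .inl (i.1.2, l))) (fun l => .inr (s, l)) ∈ D}) ∩
    ⋂ s : {s : Fin t × Fin t // s.1 ≠ s.2},
      (⋂ l : Fin n, {z | z (.inr (s.1.1, l)) = z (.inr (s.1.2, l))})ᶜ}

theorem mem_cliques {P : Type w} {n k m t : ℕ} {D : Set ((Fin k ⊕ Fin k) ⊕ Fin n → P)}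
    {b : Fin m × Fin k → P} : b ∈ cliques m t D ↔ ∀ i i', i ≠ i' →
      ∃ u : Fin t → Fin n → P, Function.Injective u ∧
        ∀ s, Sum.elim (Sum.elim (fun l => b (i, l)) fun l => b (i', l)) (u s) ∈ D := by
  have key : ∀ i i' (y : Fin t × Fin n → P) s,
      ((Sum.elim b y ∘ Sum.elim (Sum.elim (fun l => .inl (i, l))
      (fun l => .inl (i', l))) (fun l => .inr (s, l))) : (Fin k ⊕ Fin k) ⊕ Fin n → P) =
      Sum.elim (Sum.elim (fun l => b (i, l)) fun l => b (i', l)) (fun l => y (s, l)) := by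
    intro i i' y s
    ext ((l | l) | l) <;> rfl
  simp only [cliques, Set.mem_iInter, Subtype.forall, Prod.forall, Set.mem_ofPred_eq,
    Set.mem_inter_iff, Set.mem_compl_iff, key]
  refine forall_congr' fun i => forall_congr' fun i' => forall_congr' fun _ => ?_
  constructor
  · rintro ⟨y, h, h'⟩
    refine ⟨fun s l => y (s, l), fun s s' hs => ?_, h⟩
    by_contra hss
    exact h' s s' hss fun l => congrFun hs l
  · rintro ⟨u, h, h'⟩
    exact ⟨fun p => u p.1 p.2, h', fun s s' hs hl => hs (h (funext hl))⟩

theorem Corresponds.cliques {n k : ℕ} {D : Set ((Fin k ⊕ Fin k) ⊕ Fin n → M)}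
    {D' : Set ((Fin k ⊕ Fin k) ⊕ Fin n → N)} (h : Corresponds j D D') (m t : ℕ) :
    Corresponds j (cliques m t D) (cliques m t D') :=
  Corresponds.iInter fun _ => Corresponds.exists <|
    (Corresponds.iInter fun _ => h.preimage_comp _).inter <|
      Corresponds.iInter fun _ => (Corresponds.iInter fun _ => Corresponds.eq _ _).compl

end Transfer

section Unbounded

variable {L : FirstOrder.Language.{u, v}} {M : Type w} [L.Structure M]

theorem lift_mk_formula_lt {κ : Cardinal.{w}} (hκ : ℵ₀ < κ)
    (hL : Cardinal.lift.{w} L.card < Cardinal.lift.{max u v} κ) {α : Type w} (hα : #α < κ) :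
    #(L.Formula α) < Cardinal.lift.{max u v} κ := by
  have h₁ : #(L.Formula α) ≤ #(Σ n, L.BoundedFormula α n) :=
    mk_le_of_injective (f := fun φ : L.Formula α => ⟨0, φ⟩) fun φ ψ h => by simpa using h
  refine (h₁.trans FirstOrder.Language.BoundedFormula.card_le).trans_lt ?_
  have hκ' : ℵ₀ < Cardinal.lift.{max u v} κ := by simpa using hκ
  exact max_lt hκ' (add_lt_of_lt hκ'.le (lift_lt.2 hα) hL)

theorem lift_mk_formula_le_of_finite {κ : Cardinal.{w}} (hκ : ℵ₀ < κ)
    (hL : Cardinal.lift.{w} L.card < Cardinal.lift.{max u v} κ) {α : Type} [Finite α] :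
    Cardinal.lift.{w} #(L.Formula α) ≤ Cardinal.lift.{max u v} κ := by
  have h₁ : #(L.Formula α) ≤ #(Σ n, L.BoundedFormula α n) :=
    mk_le_of_injective (f := fun φ : L.Formula α => ⟨0, φ⟩) fun φ ψ h => by simpa using h
  refine (lift_le.2 (h₁.trans FirstOrder.Language.BoundedFormula.card_le)).trans ?_
  have hκ' : ℵ₀ ≤ Cardinal.lift.{max u v} κ := by simpa using hκ.le
  have hα : #α < ℵ₀ := lt_aleph0_of_finite α
  simp only [lift_max, lift_add, lift_lift, lift_aleph0]
  refine max_le hκ' (add_le_of_le hκ' ?_ ?_)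
  · exact (lift_lt_aleph0.2 hα).le.trans hκ'
  · simpa using hL.le

/-- Among the relations of an essentially unbounded family, infinitely many are given by one
formula and one type over `X`. -/
theorem exists_infinite_instances {κ : Cardinal.{w}} (hκ : ℵ₀ < κ)
    (hL : Cardinal.lift.{w} L.card < Cardinal.lift.{max u v} κ)
    {n : ℕ} {A : Set (Fin n → M)} [AddCommGroup A] {X : Set M} {Γ : Set (Endogeny A)}
    (h : EssentiallyUnbounded L X Γ) :
    ∃ (N : Type w) (_ : L.Structure N) (j : M ↪ₑ[L] N) (k : ℕ)
      (φ : L.Formula ((Fin n ⊕ Fin n) ⊕ Fin k)) (b : Fin k → M) (B : Set (Fin k → N)),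
      (∃ γ ∈ Γ, tupleGraph γ = {p | φ.Realize (Sum.elim p b)}) ∧ (∀ b' ∈ B, SameType L j X b b') ∧
      B.Infinite ∧ B.Pairwise fun b₁ b₂ => ¬ EquivalentIn L A j
        {p | φ.Realize (Sum.elim p b₁)} {p | φ.Realize (Sum.elim p b₂)} := by
  -- The formulas are transported to the universe of `M`, where the pigeonhole principle applies.
  have hemb : ∀ k, Nonempty (L.Formula ((Fin n ⊕ Fin n) ⊕ Fin k) ↪ κ.out) := fun k => by
    rw [← lift_mk_le', mk_out]
    exact lift_mk_formula_le_of_finite hκ hL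
  have f := fun k => (hemb k).some
  obtain ⟨N, hN, j, I, hI, hμ, hpair⟩ :=
    h (max ℵ₀ #(Σ k : ℕ, κ.out × (Fin k → M)))
  have : Infinite I := infinite_iff.2 ((le_max_left _ _).trans hμ.le)
  have key : ∀ R : I, ∃ θ : Σ k : ℕ, κ.out × (Fin k → M),
      ∃ (φ : L.Formula ((Fin n ⊕ Fin n) ⊕ Fin θ.1)) (b' : Fin θ.1 → N),
      f θ.1 φ = θ.2.1 ∧ (∃ γ ∈ Γ, tupleGraph γ = {p | φ.Realize (Sum.elim p θ.2.2)}) ∧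
        SameType L j X θ.2.2 b' ∧ R = {p | φ.Realize (Sum.elim p b')} := by
    rintro ⟨R, hR⟩
    obtain ⟨k, φ, b, b', h₁, h₂, h₃⟩ := hI hR
    exact ⟨⟨k, f k φ, b⟩, φ, b', rfl, h₁, h₂, h₃⟩
  choose F hF using key
  -- There are more relations than pairs of a formula and a tuple of `M`.
  obtain ⟨θ, hθ⟩ := exists_infinite_fiber F ((le_max_right _ _).trans_lt hμ)
  obtain ⟨R₀, hR₀⟩ : Nonempty (F ⁻¹' {θ}) := hθ.nonempty
  obtain rfl : F R₀ = θ := hR₀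
  obtain ⟨φ, -, hφ, hγ, -⟩ := hF R₀
  have key₂ : ∀ R : F ⁻¹' {F R₀}, ∃ b' : Fin (F R₀).1 → N, SameType L j X (F R₀).2.2 b' ∧
      (R.1 : Set (Fin n ⊕ Fin n → N)) = {p | φ.Realize (Sum.elim p b')} := by
    rintro ⟨R, hR⟩
    have hR' : F R = F R₀ := hR
    have h₀ := hF R
    rw [hR'] at h₀
    obtain ⟨φ', b', h₁, -, h₂, h₃⟩ := h₀
    obtain rfl : φ' = φ := (f _).injective (h₁.trans hφ.symm)
    exact ⟨b', h₂, h₃⟩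
  choose g hg hg' using key₂
  have hginj : Function.Injective g := fun R R' h => by
    refine Subtype.ext (Subtype.ext ?_)
    rw [hg', hg', h]
  refine ⟨N, hN, j, (F R₀).1, φ, (F R₀).2.2, Set.range g, hγ, ?_,
    Set.infinite_range_of_injective hginj, ?_⟩
  · rintro _ ⟨R, rfl⟩
    exact hg R
  · rintro _ ⟨R, rfl⟩ _ ⟨R', rfl⟩ hne
    have := hpair R.1.2 R'.1.2 fun h => hne (congrArg g (Subtype.ext (Subtype.ext h)))
    rwa [hg' R, hg' R'] at this

/-- An invariant essentially unbounded set of endogenies contains a uniformly definable family,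
indexed by a type-definable set, with arbitrarily many pairwise inequivalent members. -/
theorem EssentiallyUnbounded.exists_family [Tame L M]
    (hL : Cardinal.lift.{w} L.card < Cardinal.lift.{max u v} (Tame.κ L M))
    {n : ℕ} {A : Set (Fin n → M)} [AddCommGroup A] (hA : IsDefinableGroup L A) [Coded L M A]
    (hval : DefMap L M (Subtype.val : A → Fin n → M))
    {X : Set M} (hX : #X < Tame.κ L M) {Γ : Set (Endogeny A)} (hΓ : IsInvariantOver L X Γ)
    (h : EssentiallyUnbounded L X Γ) :
    ∃ (k : ℕ) (Y : Set (Fin k → M)) (c : (Fin k → M) → Endogeny A)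
      (Φ : Set ((Fin k → M) × (A × A))), TypeDef L M Y ∧ DefSet L M Φ ∧
      (∀ y ∈ Y, c y ∈ Γ ∧ ∀ p, p ∈ (c y).graph ↔ (y, p) ∈ Φ) ∧
      ∀ m, ∃ b : Fin m → Fin k → M, (∀ i, b i ∈ Y) ∧
        ∀ i i', i ≠ i' → ¬ Endogeny.Equivalent (c (b i)) (c (b i')) := by
  have hκ := Tame.aleph0_lt (L := L) (M := M)
  obtain ⟨N, _, j, k, φ, b₀, B, hb₀, hB, hBinf, hBpair⟩ := exists_infinite_instances hκ hL h
  have hS := corresponds_formula' j φ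
  obtain ⟨G', hG⟩ := exists_corresponds j hA.2
  have hD := hS.differences hG
  set D := differences {x : (Fin n ⊕ Fin n) ⊕ Fin k → M | φ.Realize x} (addGraph A)
  set D' := differences {x : (Fin n ⊕ Fin n) ⊕ Fin k → N | φ.Realize x} G'
  -- the conditions on a tuple saying that it realizes the type of `b₀` over `X`
  let W : L.Formula (X ⊕ Fin k) → Set (Fin k → M) := fun ψ =>
    {b | ψ.Realize (Sum.elim (fun x : X => (x : M)) b₀) ↔
      ψ.Realize (Sum.elim (fun x : X => (x : M)) b)}
  have hW : ∀ w : Set.range W, ∃ w', Corresponds j w.1 w' ∧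
      ∀ b', SameType L j X b₀ b' → b' ∈ w' := by
    rintro ⟨_, ψ, rfl⟩
    have hψ := corresponds_formula j ψ
    by_cases hb : ψ.Realize (Sum.elim (fun x : X => (x : M)) b₀)
    · refine ⟨_, ?_, fun b' hb' => (hb' ψ).1 hb⟩
      have e : W ψ = {b | ψ.Realize (Sum.elim (fun x : X => (x : M)) b)} := by
        ext b
        simp [W, hb]
      exact (congrArg (Corresponds j · _) e).mpr hψ
    · refine ⟨_, ?_, fun b' hb' h' => hb ((hb' ψ).2 h')⟩
      have e : W ψ = {b | ψ.Realize (Sum.elim (fun x : X => (x : M)) b)}ᶜ := by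
        ext b
        simp [W, hb]
      exact (congrArg (Corresponds j · _) e).mpr hψ.compl
  choose W' hWW' hW' using hW
  have hcard : #(Set.range W) < Tame.κ L M := by
    have h₁ := mk_range_le_lift (f := W)
    have h₂ : #(L.Formula (X ⊕ Fin k)) < _ := lift_mk_formula_lt hκ hL (α := X ⊕ Fin k) (by
      rw [mk_sum]
      refine add_lt_of_lt hκ.le (by simpa using hX) ?_
      exact (lift_lt_aleph0.2 (lt_aleph0_of_finite _)).trans hκ)
    refine lift_lt.{w, max u v w}.1 (h₁.trans_lt ?_)
    have := lift_lt.{max u v w, w}.2 h₂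
    simpa using this
  -- By invariance the realizations of the type of `b₀` over `X` all define elements of `Γ`.
  let Y : Set (Fin k → M) := ⋂ w : Set.range W, w.1
  have hWdef : ∀ w : Set.range W, DefSet L M w.1 := fun w =>
    defSet_tuple_iff.2 (hWW' w).definable
  have hY : TypeDef L M Y := ⟨Set.range W, fun w => w.1, hcard, hWdef, rfl⟩
  have hYmem : ∀ y ∈ Y, ∃ γ ∈ Γ, tupleGraph γ = {p | φ.Realize (Sum.elim p y)} := by
    intro y hy
    refine hΓ.2 k φ b₀ y (fun ψ => ?_) hb₀
    exact Set.mem_iInter.1 hy ⟨_, ψ, rfl⟩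
  classical
  let c : (Fin k → M) → Endogeny A := fun y => if hy : y ∈ Y then (hYmem y hy).choose else 0
  have hc : ∀ y ∈ Y, c y ∈ Γ ∧ tupleGraph (c y) = {p | φ.Realize (Sum.elim p y)} := by
    intro y hy
    simp only [c, dif_pos hy]
    exact (hYmem y hy).choose_spec
  refine ⟨k, Y, c, {p | φ.Realize (Sum.elim (Sum.elim p.2.1.1 p.2.2.1) p.1)}, hY, ?_, ?_, ?_⟩
  · have hφ : DefSet L M {x : (Fin n ⊕ Fin n) ⊕ Fin k → M | φ.Realize x} :=
      defSet_tuple_iff.2 hS.definable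
    refine hφ.mem (f := fun p : (Fin k → M) × (A × A) =>
      Sum.elim (Sum.elim p.2.1.1 p.2.2.1) p.1) (DefMap.pi ?_)
    rintro ((l | l) | l)
    · exact (hval.comp DefMap.id.snd.fst).apply l
    · exact (hval.comp DefMap.id.snd.snd).apply l
    · exact DefMap.id.fst.apply l
  · rintro y hy
    refine ⟨(hc y hy).1, ?_⟩
    rintro ⟨a, a'⟩
    have h₁ := Set.ext_iff.1 (hc y hy).2 (Sum.elim a.1 a'.1)
    refine Iff.trans ?_ h₁
    refine ⟨fun h => ⟨a, a', h, rfl⟩, ?_⟩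
    rintro ⟨d, d', h, he⟩
    obtain rfl : a = d := Subtype.ext (funext fun i => congrFun he (Sum.inl i))
    obtain rfl : a' = d' := Subtype.ext (funext fun i => congrFun he (Sum.inr i))
    exact h
  · intro m
    obtain ⟨b'⟩ : Nonempty (Fin m ↪ B) := by
      have := hBinf.to_subtype
      exact ⟨Fin.valEmbedding.trans (Infinite.natEmbedding B)⟩
    -- `cliques m t D` says of `m` tuples that any two of them have at least `t` differences. In
    -- `N` this holds for all `t`; being expressible, it is consistent in `M` with the type of
    -- each tuple over `X`, and saturation gives a realization in `M` for all `t` at once.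
    have hs : TypeDef L M {x : Fin m × Fin k → M | ∀ i, (fun l => x (i, l)) ∈ Y} := by
      refine ⟨Set.range W, fun w => {x | ∀ i, (fun l => x (i, l)) ∈ w.1}, hcard, fun w => ?_, ?_⟩
      · exact DefSet.finite_forall fun i =>
          (hWdef w).mem (DefMap.pi fun l => DefMap.id.apply (i, l))
      · ext x
        simp only [Y, Set.mem_iInter, Set.mem_ofPred_eq]
        exact forall_comm
    have hcl := hs.nonempty_of_antitone (D := fun t => cliques m t D) ?_ ?_ ?_
    · obtain ⟨x, hx, hx'⟩ := hcl
      refine ⟨fun i l => x (i, l), hx, fun i i' hii heq => ?_⟩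
      obtain ⟨F, hF, hF'⟩ := Endogeny.equivalent_iff.1 heq
      -- Equivalent endogenies have finitely many differences, so too few for a large `t`.
      have hfin : {d : Fin n → M | Sum.elim (Sum.elim (fun l => x (i, l)) fun l => x (i', l)) d ∈
          D}.Finite := by
        refine (hF.image Subtype.val).subset fun d hd => ?_
        obtain ⟨a, b₁, b₂, h₁, h₂, d', b₂', h₃⟩ := mem_differences.1 hd
        have k₁ := Set.ext_iff.1 (hc _ (hx i)).2 (Sum.elim a b₁)
        have k₂ := Set.ext_iff.1 (hc _ (hx i')).2 (Sum.elim a b₂)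
        obtain ⟨e, f, hef, he⟩ := k₁.2 h₁
        obtain ⟨e', f', hef', he'⟩ := k₂.2 h₂
        obtain rfl : e = e' := Subtype.ext (funext fun i =>
          (congrFun he (Sum.inl i)).symm.trans (congrFun he' (Sum.inl i)))
        obtain rfl : f' = b₂' := Subtype.ext (funext fun i =>
          (congrFun he' (Sum.inr i)).symm.trans (congrFun h₃ (Sum.inl (Sum.inr i))))
        have hf : f = d' + f' := Subtype.ext (funext fun i =>
          (congrFun he (Sum.inr i)).symm.trans (congrFun h₃ (Sum.inr i)))
        refine ⟨d', ?_, (funext fun i => congrFun h₃ (Sum.inl (Sum.inl i))).symm⟩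
        have := hF' e f f' hef hef'
        rwa [hf, add_sub_cancel_right] at this
      obtain ⟨u, hu, hu'⟩ := mem_cliques.1 (hx' (hfin.toFinset.card + 1)) i i' hii
      have := Finset.card_le_card_of_injOn (s := Finset.univ) (t := hfin.toFinset) u
        (fun s _ => by simpa using hu' s) hu.injOn
      simp at this
    · exact fun t => defSet_tuple_iff.2 (hD.cliques m t).definable
    · intro t t' htt x hx
      refine mem_cliques.2 fun i i' hii => ?_
      obtain ⟨u, hu, hu'⟩ := mem_cliques.1 hx i i' hii
      exact ⟨fun s => u (Fin.castLE htt s), hu.comp (Fin.castLE_injective htt), fun s => hu' _⟩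
    · intro t
      have hmem : (fun p : Fin m × Fin k => (b' p.1).1 p.2) ∈ cliques m t D' := by
        refine mem_cliques.2 fun i i' hii => ?_
        have hne := hBpair (b' i).2 (b' i').2 fun h => hii (b'.injective (Subtype.ext h))
        have hinf : {d : Fin n → N | Sum.elim (Sum.elim (b' i).1 (b' i').1) d ∈ D'}.Infinite := by
          refine fun hfin => hne (hfin.subset ?_)
          rintro d ⟨a, b₁, b₂, h₁, h₂, h₃⟩
          rw [hG.extend_eq] at h₃
          exact mem_differences.2 ⟨a, b₁, b₂, h₁, h₂, h₃⟩
        have := hinf.to_subtype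
        let u := (Fin.valEmbedding (n := t)).trans (Infinite.natEmbedding
          {d : Fin n → N | Sum.elim (Sum.elim (b' i).1 (b' i').1) d ∈ D'})
        exact ⟨fun s : Fin t => (u s).1, Subtype.val_injective.comp u.injective,
          fun s => (u s).2⟩
      have := (DefSet.typeDef (defSet_tuple_iff.2 (hD.cliques m t).definable)).nonempty_iInter
        (D := fun w : Set.range W => {x : Fin m × Fin k → M | ∀ i, (fun l => x (i, l)) ∈ w.1})
        hcard (fun w => DefSet.finite_forall fun i =>
          (hWdef w).mem (DefMap.pi fun l => DefMap.id.apply (i, l))) ?_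
      · obtain ⟨x, hx, hx'⟩ := this
        refine ⟨x, fun i => Set.mem_iInter.2 fun w => ?_, hx⟩
        exact Set.mem_iInter.1 hx' w i
      · intro J
        have hcor := (hD.cliques m t).inter (Corresponds.iInter fun w : J =>
          Corresponds.iInter fun i : Fin m => (hWW' w.1).preimage_comp fun l => (i, l))
        -- Finitely many conditions on the tuples hold in `N`, so they can be satisfied in `M`.
        obtain ⟨x, hx, hx'⟩ := hcor.nonempty ⟨_, hmem, Set.mem_iInter.2 fun w =>
          Set.mem_iInter.2 fun i => hW' w.1 _ (hB _ (b' i).2)⟩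
        refine ⟨x, hx, Set.mem_iInter₂.2 fun w hw i => ?_⟩
        exact Set.mem_iInter.1 (Set.mem_iInter.1 hx' ⟨w, hw⟩) i

end Unbounded

/-! ### Kernels, images and sharp commutation -/

theorem exists_forall_nat_le {α : Type*} {p : α → Prop} (f : α → ℕ) (h : ∃ a, p a) :
    ∃ a, p a ∧ ∀ b, p b → f a ≤ f b := by
  obtain ⟨a, ha, hmin⟩ := WellFounded.has_min (measure f).wf {a | p a} h
  exact ⟨a, ha, fun b hb => not_lt.1 (hmin b hb)⟩

theorem exists_forall_le_nat {α : Type*} {p : α → Prop} (f : α → ℕ) (h : ∃ a, p a) {N : ℕ}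
    (hN : ∀ a, p a → f a ≤ N) : ∃ a, p a ∧ ∀ b, p b → f b ≤ f a := by
  obtain ⟨a, ha, hmin⟩ := exists_forall_nat_le (fun a => N - f a) h
  refine ⟨a, ha, fun b hb => ?_⟩
  have := hmin b hb
  have := hN a ha
  have := hN b hb
  omega

/-- Having finite index in `C` passes to subgroups of `C + F`, for `F` finite. -/
theorem relIndex_ne_zero_of_le_sup {A : Type*} [AddCommGroup A] {B C F H : AddSubgroup A}
    (hB : B.relIndex C ≠ 0) (hF : (F : Set A).Finite) (hH : H ≤ C ⊔ F) : B.relIndex H ≠ 0 := by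
  refine fun h => ?_
  refine AddSubgroup.relIndex_ne_zero_trans hB (L := C ⊔ F) ?_
    (AddSubgroup.relIndex_eq_zero_of_le_right hH h)
  rw [sup_comm, AddSubgroup.relIndex_sup_right]
  have := hF.to_subtype
  exact fun h => Nat.card_pos.ne' (zero_dvd_iff.1 (h ▸ AddSubgroup.relIndex_dvd_card C F))

theorem finite_sup {A : Type*} [AddCommGroup A] {B C : AddSubgroup A} (hB : (B : Set A).Finite)
    (hC : (C : Set A).Finite) : ((B ⊔ C : AddSubgroup A) : Set A).Finite := by
  refine (hB.image2 (fun x y => x + y) hC).subset fun x hx => ?_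
  obtain ⟨b, hb, c, hc, h⟩ := AddSubgroup.mem_sup.1 hx
  exact ⟨b, hb, c, hc, h⟩

theorem finite_finset_sup {A ι : Type*} [AddCommGroup A] {B : ι → AddSubgroup A} {Z : Finset ι}
    (h : ∀ z ∈ Z, (B z : Set A).Finite) : ((Z.sup B : AddSubgroup A) : Set A).Finite := by
  classical
  induction Z using Finset.induction_on with
  | empty => simp
  | insert z Z _ ih =>
    rw [Finset.sup_insert]
    exact finite_sup (h z (Finset.mem_insert_self z Z))
      (ih fun z' hz' => h z' (Finset.mem_insert_of_mem hz'))

namespace Endogeny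

variable {A : Type*} [AddCommGroup A] {φ ψ : Endogeny A} {a b : A} {B C : AddSubgroup A}

theorem mem_sub : (a, b) ∈ (φ - ψ).graph ↔
    ∃ b₁ b₂, (a, b₁) ∈ φ.graph ∧ (a, b₂) ∈ ψ.graph ∧ b₁ - b₂ = b := by
  constructor
  · rintro ⟨b₁, b₂, h₁, h₂, h⟩
    exact ⟨b₁, -b₂, h₁, h₂, by simpa using h⟩
  · rintro ⟨b₁, b₂, h₁, h₂, h⟩
    exact ⟨b₁, -b₂, h₁, by rw [mem_neg, neg_neg]; exact h₂, by simpa [sub_eq_add_neg] using h⟩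

theorem mem_kat : b ∈ φ.kat ↔ (0, b) ∈ φ.graph := Iff.rfl

/-- The kernel `{a | 0 ∈ φ[a]}` of an endogeny. -/
def ker (φ : Endogeny A) : AddSubgroup A where
  carrier := {a | (a, 0) ∈ φ.graph}
  zero_mem' := φ.graph.zero_mem
  add_mem' {a b} ha hb := by simpa using φ.graph.add_mem ha hb
  neg_mem' {a} ha := by simpa using φ.graph.neg_mem ha

theorem mem_ker : a ∈ φ.ker ↔ (a, 0) ∈ φ.graph := Iff.rfl

theorem image_mono (h : B ≤ C) : φ.image B ≤ φ.image C := fun _ ⟨a, ha, hb⟩ => ⟨a, h ha, hb⟩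

theorem kat_le_image : φ.kat ≤ φ.image B := fun _ h => ⟨0, B.zero_mem, h⟩

theorem image_bot : φ.image ⊥ = φ.kat := by
  refine le_antisymm ?_ kat_le_image
  rintro b ⟨a, rfl, h⟩
  exact h

theorem image_mul : (φ * ψ).image B = φ.image (ψ.image B) := by
  ext b
  constructor
  · rintro ⟨a, ha, z, hz, hb⟩
    exact ⟨z, ⟨a, ha, hz⟩, hb⟩
  · rintro ⟨z, ⟨a, ha, hz⟩, hb⟩
    exact ⟨a, ha, z, hz, hb⟩

theorem kat_mul : (φ * ψ).kat = φ.image ψ.kat := by rw [← image_bot, image_mul, image_bot]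

theorem kat_add : (φ + ψ).kat = φ.kat ⊔ ψ.kat := by
  ext b
  rw [AddSubgroup.mem_sup]
  constructor
  · rintro ⟨b₁, b₂, h₁, h₂, h⟩
    exact ⟨b₁, h₁, b₂, h₂, h⟩
  · rintro ⟨b₁, h₁, b₂, h₂, h⟩
    exact ⟨b₁, b₂, h₁, h₂, h⟩

theorem finite_kat' : (φ.kat : Set A).Finite := φ.finite_kat

theorem image_sup_le : φ.image (B ⊔ C) ≤ φ.image B ⊔ φ.image C := by
  rintro x ⟨a, ha, hx⟩
  obtain ⟨b, hb, c, hc, rfl⟩ := AddSubgroup.mem_sup.1 ha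
  obtain ⟨y, hy⟩ := φ.total b
  refine AddSubgroup.mem_sup.2 ⟨y, ⟨b, hb, hy⟩, x - y, ⟨c, hc, ?_⟩, by abel⟩
  simpa using φ.graph.sub_mem hx hy

theorem image_finset_sup_le {ι : Type*} (Z : Finset ι) (f : ι → AddSubgroup A) :
    φ.image (Z.sup f) ≤ Z.sup (fun z => φ.image (f z)) ⊔ φ.kat := by
  classical
  induction Z using Finset.induction_on with
  | empty => simp [image_bot]
  | insert z Z _ ih =>
    rw [Finset.sup_insert, Finset.sup_insert, sup_assoc]
    exact image_sup_le.trans (sup_le_sup_left ih _)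

theorem finite_image' (h : (B : Set A).Finite) : (φ.image B : Set A).Finite := φ.finite_image h

theorem mul_assoc' (φ ψ χ : Endogeny A) : φ * ψ * χ = φ * (ψ * χ) := by
  ext ⟨a, b⟩
  constructor
  · rintro ⟨x, hx, y, hy, hb⟩
    exact ⟨y, ⟨x, hx, hy⟩, hb⟩
  · rintro ⟨y, ⟨x, hx, hy⟩, hb⟩
    exact ⟨x, hx, y, hy, hb⟩

theorem class_eq_zero_iff : EndogRing.mk φ = 0 ↔ (φ.image ⊤ : Set A).Finite := by
  rw [← EndogRing.mk_zero, EndogRing.mk_eq_mk, equivalent_iff]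
  constructor
  · rintro ⟨F, hF, h⟩
    refine hF.subset ?_
    rintro b ⟨a, -, hb⟩
    simpa using h a b 0 hb rfl
  · intro h
    refine ⟨_, h, fun a b c hb hc => ?_⟩
    obtain rfl : c = 0 := hc
    rw [sub_zero]
    exact ⟨a, trivial, hb⟩

theorem mk_sub : EndogRing.mk (φ - ψ) = EndogRing.mk φ - EndogRing.mk ψ :=
  (sub_eq_add_neg (EndogRing.mk φ) (EndogRing.mk ψ)).symm

theorem mk_sub_eq_zero_iff : EndogRing.mk (φ - ψ) = 0 ↔ Equivalent φ ψ := by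
  rw [mk_sub, sub_eq_zero, EndogRing.mk_eq_mk]

/-- The kernel of `φ` has finite index relatively to `C` exactly when `φ[C]` is finite. -/
theorem relIndex_ker_ne_zero_iff : φ.ker.relIndex C ≠ 0 ↔ (φ.image C : Set A).Finite := by
  constructor
  · intro h
    have : (φ.ker.addSubgroupOf C).FiniteIndex := ⟨h⟩
    have hfin : Finite (C ⧸ φ.ker.addSubgroupOf C) := inferInstance
    refine Set.Finite.subset (φ.finite_image
      (Set.finite_range fun q : C ⧸ φ.ker.addSubgroupOf C => (q.out : A))) ?_
    rintro b ⟨c, hc, hb⟩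
    refine ⟨_, ⟨((⟨c, hc⟩ : C) : C ⧸ φ.ker.addSubgroupOf C), rfl⟩, ?_⟩
    have h₁ := QuotientAddGroup.mk_out_eq_add (φ.ker.addSubgroupOf C) ⟨c, hc⟩
    obtain ⟨k, hk⟩ := h₁
    dsimp only
    rw [hk]
    have hk' : ((k : C) : A) ∈ φ.ker := k.2
    simpa using φ.graph.add_mem hb (mem_ker.1 hk')
  · intro h
    have := h.to_subtype
    choose f hf using φ.total
    have : Finite (C ⧸ φ.ker.addSubgroupOf C) := by
      refine Finite.of_injective (β := (φ.image C : Set A))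
        (fun q => ⟨f (q.out : A), q.out, q.out.2, hf _⟩) fun q q' h => ?_
      have h' : f (q.out : A) = f (q'.out : A) := Subtype.ext_iff.1 h
      rw [← q.out_eq', ← q'.out_eq', QuotientAddGroup.eq]
      change -(q.out : A) + (q'.out : A) ∈ φ.ker
      have := φ.graph.sub_mem (hf q'.out) (hf q.out)
      rw [mem_ker]
      simpa [h', sub_eq_neg_add] using this
    exact (AddSubgroup.finiteIndex_of_finite_quotient (H := φ.ker.addSubgroupOf C)).index_ne_zero

theorem sharplyCommute_iff : SharplyCommute φ ψ ↔
    ∀ a b c, (a, b) ∈ (φ * ψ).graph → (a, c) ∈ (ψ * φ).graph → b - c ∈ φ.kat ⊔ ψ.kat := by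
  constructor
  · intro h a b c hb hc
    exact h ⟨a, trivial, mem_sub.2 ⟨b, c, hb, hc, rfl⟩⟩
  · rintro h x ⟨a, -, hx⟩
    obtain ⟨b, c, hb, hc, rfl⟩ := mem_sub.1 hx
    exact h a b c hb hc

theorem _root_.Endogenies.SharplyCommute.symm (h : SharplyCommute φ ψ) : SharplyCommute ψ φ := by
  rw [sharplyCommute_iff] at h ⊢
  intro a b c hb hc
  rw [← neg_sub, sup_comm]
  exact neg_mem (h a c b hc hb)

theorem _root_.Endogenies.SharplyCommute.image_kat_le (h : SharplyCommute φ ψ) :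
    ψ.image φ.kat ≤ φ.kat ⊔ ψ.kat := by
  rintro b ⟨a, ha, hb⟩
  have := sharplyCommute_iff.1 h 0 0 b ⟨0, ψ.graph.zero_mem, φ.graph.zero_mem⟩ ⟨a, ha, hb⟩
  simpa using this

/-- A sharply commuting endogeny maps `φ[B]` into `φ[ψ[B]]`, up to the katakernels. -/
theorem _root_.Endogenies.SharplyCommute.image_image_le (h : SharplyCommute φ ψ) :
    ψ.image (φ.image B) ≤ φ.image (ψ.image B) ⊔ ψ.kat := by
  rintro c ⟨y, ⟨a, ha, hy⟩, hc⟩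
  obtain ⟨z, hz⟩ := ψ.total a
  obtain ⟨b, hb⟩ := φ.total z
  obtain ⟨k, hk, l, hl, hkl⟩ := AddSubgroup.mem_sup.1
    (sharplyCommute_iff.1 h a b c ⟨z, hz, hb⟩ ⟨y, hy, hc⟩)
  refine AddSubgroup.mem_sup.2 ⟨b - k, ⟨z, ⟨a, ha, hz⟩, ?_⟩, -l, neg_mem hl, ?_⟩
  · simpa using φ.graph.sub_mem hb hk
  · rw [eq_comm, ← sub_eq_zero]
    have : c - (b - k + -l) = (k + l) - (b - c) := by abel
    rw [this, hkl, sub_self]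

/-- The endogeny `A × F`, all of whose values are the finite subgroup `F`. -/
def const (F : AddSubgroup A) (hF : (F : Set A).Finite) : Endogeny A where
  graph := AddSubgroup.prod ⊤ F
  total _ := ⟨0, AddSubgroup.mem_prod.2 ⟨trivial, F.zero_mem⟩⟩
  finite_kat := hF.subset fun _ hb => (AddSubgroup.mem_prod.1 hb).2

theorem mem_const {F : AddSubgroup A} {hF : (F : Set A).Finite} :
    (a, b) ∈ (const F hF).graph ↔ b ∈ F :=
  AddSubgroup.mem_prod.trans (and_iff_right trivial)

theorem kat_const {F : AddSubgroup A} {hF : (F : Set A).Finite} : (const F hF).kat = F := by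
  ext; rw [mem_kat, mem_const]

theorem sharplyCommute_const {F : AddSubgroup A} {hF : (F : Set A).Finite}
    (h : ψ.image F ≤ F ⊔ ψ.kat) : SharplyCommute (const F hF) ψ := by
  rw [sharplyCommute_iff, kat_const]
  rintro a b c ⟨z, hz, hb⟩ ⟨y, hy, hc⟩
  exact sub_mem (AddSubgroup.mem_sup_left (mem_const.1 hb)) (h ⟨y, mem_const.1 hy, hc⟩)

end Endogeny

theorem PreSubring.sub_mem {A : Type*} [AddCommGroup A] (Γ : PreSubring A) {φ ψ : Endogeny A}
    (hφ : φ ∈ Γ.carrier) (hψ : ψ ∈ Γ.carrier) : φ - ψ ∈ Γ.carrier :=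
  Γ.add_mem hφ (Γ.neg_mem hψ)

/-! ### Minimal pairs of mutual sharp commutants -/

section MinimalPairs

open Endogeny

variable {L : FirstOrder.Language.{u, v}} {M : Type w} [L.Structure M]
variable {A : Type w} [Coded L M A] [AddCommGroup A]

variable (L M) in
/-- `Γ` and `Δ` are mutual sharp commutants, and `A` is absolutely `(Γ, Δ)`-minimal. -/
structure MinimalPair (Γ Δ : PreSubring A) : Prop where
  mem_left : ∀ φ, φ ∈ Γ.carrier ↔ DefSet L M (φ.graph : Set (A × A)) ∧
    ∀ δ ∈ Δ.carrier, SharplyCommute φ δ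
  mem_right : ∀ φ, φ ∈ Δ.carrier ↔ DefSet L M (φ.graph : Set (A × A)) ∧
    ∀ γ ∈ Γ.carrier, SharplyCommute φ γ
  minimal : ∀ B : AddSubgroup A, DefSet L M (B : Set A) →
    (∀ γ ∈ Γ.carrier, B.relIndex (γ.image B) ≠ 0) →
    (∀ δ ∈ Δ.carrier, B.relIndex (δ.image B) ≠ 0) → (B : Set A).Finite ∨ B.index ≠ 0

variable {Γ Δ : PreSubring A}

theorem MinimalPair.symm (h : MinimalPair L M Γ Δ) : MinimalPair L M Δ Γ where
  mem_left := h.mem_right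
  mem_right := h.mem_left
  minimal B hB hΓ hΔ := h.minimal B hB hΔ hΓ

theorem MinimalPair.defSet (h : MinimalPair L M Γ Δ) {γ : Endogeny A} (hγ : γ ∈ Γ.carrier) :
    DefSet L M (γ.graph : Set (A × A)) := ((h.mem_left γ).1 hγ).1

theorem MinimalPair.sharp (h : MinimalPair L M Γ Δ) {γ δ : Endogeny A} (hγ : γ ∈ Γ.carrier)
    (hδ : δ ∈ Δ.carrier) : SharplyCommute γ δ := ((h.mem_left γ).1 hγ).2 δ hδ

theorem defSet_image {φ : Endogeny A} (hφ : DefSet L M (φ.graph : Set (A × A)))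
    {B : AddSubgroup A} (hB : DefSet L M (B : Set A)) : DefSet L M (φ.image B : Set A) :=
  DefSet.exists (p := fun b a => a ∈ B ∧ (a, b) ∈ φ.graph)
    ((hB.mem DefMap.id.snd).and (hφ.mem (DefMap.id.snd.prodMk DefMap.id.fst)))

theorem defSet_ker {φ : Endogeny A} (hφ : DefSet L M (φ.graph : Set (A × A))) :
    DefSet L M (φ.ker : Set A) :=
  hφ.mem (DefMap.id.prodMk (DefMap.const 0))

/-- A finite subgroup that is stable under `Δ` is the katakernel of an element of `Γ`. -/
theorem MinimalPair.const_mem (h : MinimalPair L M Γ Δ) {F : AddSubgroup A}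
    (hF : (F : Set A).Finite) (hΔ : ∀ δ ∈ Δ.carrier, δ.image F ≤ F ⊔ δ.kat) :
    const F hF ∈ Γ.carrier := by
  refine (h.mem_left _).2 ⟨?_, fun δ hδ => sharplyCommute_const (hΔ δ hδ)⟩
  refine ((DefSet.of_finite hF).mem (f := fun p : A × A => p.2) DefMap.id.snd).of_eq ?_
  ext ⟨a, b⟩
  exact mem_const.symm

variable [Tame L M] [DefAdd L M A]

/-- In a right ideal of `Γ` that does not consist of endogenies equivalent to zero, finitely many
elements have a finite common kernel: a common kernel of least dimension is almost invariant. -/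
theorem MinimalPair.finite_ker (h : MinimalPair L M Γ Δ) {I : Set (Endogeny A)}
    (hI : I ⊆ Γ.carrier) (hI' : ∀ γ ∈ I, ∀ γ' ∈ Γ.carrier, γ * γ' ∈ I) {γ₀ : Endogeny A}
    (h₀ : γ₀ ∈ I) (hγ₀ : EndogRing.mk γ₀ ≠ 0) :
    ∃ J : Finset (Endogeny A), ↑J ⊆ I ∧ {a : A | ∀ γ ∈ J, a ∈ γ.ker}.Finite := by
  classical
  let B : Finset (Endogeny A) → AddSubgroup A := fun J => ⨅ γ : J, γ.1.ker
  have hB : ∀ J : Finset (Endogeny A), ↑J ⊆ I → DefSet L M (B J : Set A) := by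
    intro J hJ
    refine (DefSet.finite_forall (p := fun (γ : J) (a : A) => a ∈ γ.1.ker) fun γ =>
      defSet_ker (h.defSet (hI (hJ γ.2)))).of_eq ?_
    ext a
    simp [B]
  obtain ⟨J, hJ, hmin⟩ := exists_forall_nat_le (fun J => dm L M (B J : Set A))
    (p := fun J => ↑J ⊆ I) ⟨∅, by simp⟩
  have hBJ : (B J : Set A) = {a | ∀ γ ∈ J, a ∈ γ.ker} := by
    ext a
    simp [B]
  -- by minimality of the dimension, every element of `I` is finite on `B J`
  have hfin : ∀ γ ∈ I, (γ.image (B J) : Set A).Finite := by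
    intro γ hγ
    have hJ' : ((insert γ J : Finset (Endogeny A)) : Set (Endogeny A)) ⊆ I := by
      rw [Finset.coe_insert]
      exact Set.insert_subset hγ hJ
    have hle : B (insert γ J) ≤ B J :=
      le_iInf fun γ' => iInf_le (fun γ'' : (insert γ J : Finset (Endogeny A)) => γ''.1.ker)
        ⟨γ'.1, Finset.mem_insert_of_mem γ'.2⟩
    have hle' : B (insert γ J) ≤ γ.ker :=
      iInf_le (fun γ'' : (insert γ J : Finset (Endogeny A)) => γ''.1.ker)
        ⟨γ, Finset.mem_insert_self γ J⟩
    have := relIndex_ne_zero_of_dm_le (hB _ hJ') (hB J hJ) hle (hmin _ hJ')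
    refine relIndex_ker_ne_zero_iff.1 fun h0 => this ?_
    exact Nat.eq_zero_of_zero_dvd (h0 ▸ AddSubgroup.relIndex_dvd_of_le_left (B J) hle')
  refine ⟨J, hJ, hBJ ▸ ?_⟩
  -- `I` being a right ideal, `γ * γ'` is finite on `B J` for `γ ∈ J` and `γ' ∈ Γ`, and `γ * δ` is
  -- so for `δ ∈ Δ` by sharp commutation; hence `B J` is almost invariant. It is not of finite
  -- index, for then `γ₀` would be equivalent to zero.
  refine (h.minimal (B J) (hB J hJ) ?_ ?_).resolve_right fun hidx => hγ₀ ?_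
  · intro γ' hγ'
    refine AddSubgroup.relIndex_iInf_ne_zero fun γ => relIndex_ker_ne_zero_iff.2 ?_
    rw [← image_mul]
    exact hfin _ (hI' _ (hJ γ.2) _ hγ')
  · intro δ hδ
    refine AddSubgroup.relIndex_iInf_ne_zero fun γ => relIndex_ker_ne_zero_iff.2 ?_
    have hs := (h.sharp (hI (hJ γ.2)) hδ).symm
    have hle : γ.1.image (δ.image (B J)) ≤ δ.image (γ.1.image (B J)) ⊔ γ.1.kat :=
      hs.image_image_le
    have h₁ : (δ.image (γ.1.image (B J)) : Set A).Finite := finite_image' (hfin _ (hJ γ.2))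
    refine Set.Finite.subset ?_ hle
    exact finite_sup h₁ finite_kat'
  · rw [class_eq_zero_iff, ← relIndex_ker_ne_zero_iff, AddSubgroup.relIndex_top_right]
    have h₁ := relIndex_ker_ne_zero_iff.2 (hfin γ₀ h₀)
    rw [← AddSubgroup.relIndex_top_right] at hidx ⊢
    exact AddSubgroup.relIndex_ne_zero_trans h₁ hidx

end MinimalPairs

/-! ### Primeness and finiteness of the katakernels -/

section Katakernels

open Endogeny

variable {L : FirstOrder.Language.{u, v}} {M : Type w} [L.Structure M]
variable {A : Type w} [Coded L M A] [AddCommGroup A]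
variable {Γ Δ : PreSubring A}

section Prime

variable [DefAdd L M A]

theorem defSet_finset_sup {ι : Type*} {B : ι → AddSubgroup A} {Z : Finset ι}
    (h : ∀ z ∈ Z, DefSet L M (B z : Set A)) :
    DefSet L M ((Z.sup B : AddSubgroup A) : Set A) := by
  classical
  induction Z using Finset.induction_on with
  | empty => exact DefSet.of_finite (by simp)
  | insert z Z _ ih =>
    rw [Finset.sup_insert]
    exact DefSet.sup (h z (Finset.mem_insert_self z Z))
      (ih fun z' hz' => h z' (Finset.mem_insert_of_mem hz'))

variable [Tame L M]

/-- `Γ` is prime on the right modulo `∼`, and finitely many elements of `Γ` witness it: a sum of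
images `(z * y)[A]` of largest dimension is almost invariant. -/
theorem MinimalPair.prime_right (h : MinimalPair L M Γ Δ) {y : Endogeny A} (hy : y ∈ Γ.carrier)
    (hy₀ : EndogRing.mk y ≠ 0) : ∃ Z : Finset (Endogeny A), ↑Z ⊆ Γ.carrier ∧
      ∀ x : Endogeny A, (∀ z ∈ Z, EndogRing.mk (x * z * y) = 0) → EndogRing.mk x = 0 := by
  classical
  let C : Finset (Endogeny A) → AddSubgroup A := fun Z => Z.sup fun z => (z * y).image ⊤
  have hCdef : ∀ Z : Finset (Endogeny A), ↑Z ⊆ Γ.carrier → DefSet L M (C Z : Set A) := by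
    intro Z hZ
    refine defSet_finset_sup fun z hz => defSet_image (h.defSet (Γ.mul_mem (hZ hz) hy)) ?_
    exact DefSet.univ L M A
  -- `1` is kept in `Z` so that `C Z` contains the infinite group `y[A]`.
  obtain ⟨Z, ⟨hZ, h1⟩, hmax⟩ := exists_forall_le_nat (fun Z => dm L M (C Z : Set A))
    (p := fun Z => ↑Z ⊆ Γ.carrier ∧ (1 : Endogeny A) ∈ Z) ⟨{1}, by simpa using Γ.one_mem, by simp⟩
    (N := dm L M (Set.univ : Set A))
    fun Z hZ => Tame.dm_mono (hCdef Z hZ.1) (DefSet.univ L M A) (Set.subset_univ _)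
  have hinf : ¬ (C Z : Set A).Finite := by
    intro hfin
    refine hy₀ ?_
    rw [← one_mul (EndogRing.mk y), ← EndogRing.mk_one, ← EndogRing.mk_mul, class_eq_zero_iff]
    exact hfin.subset (Finset.le_sup (f := fun z => (z * y).image ⊤) h1)
  have hidx : (C Z).index ≠ 0 := by
    refine (h.minimal (C Z) (hCdef Z hZ) ?_ ?_).resolve_left hinf
    · intro γ hγ
      -- `γ` maps `C Z` into the sum `C Z'`, in which `C Z` has finite index by maximality.
      let Z' := Z ∪ Z.image (γ * ·)
      have hZ' : ↑Z' ⊆ Γ.carrier ∧ (1 : Endogeny A) ∈ Z' := by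
        refine ⟨fun z hz => ?_, Finset.mem_union_left _ h1⟩
        rcases Finset.mem_union.1 (Finset.mem_coe.1 hz) with hz | hz
        · exact hZ hz
        · obtain ⟨z', hz', rfl⟩ := Finset.mem_image.1 hz
          exact Γ.mul_mem hγ (hZ hz')
      have hle : C Z ≤ C Z' := Finset.sup_mono Finset.subset_union_left
      refine relIndex_ne_zero_of_le_sup (relIndex_ne_zero_of_dm_le (hCdef Z hZ) (hCdef Z' hZ'.1)
        hle (hmax Z' hZ')) (finite_kat' (φ := γ)) ?_
      refine (image_finset_sup_le _ _).trans (sup_le_sup_right (Finset.sup_le fun z hz => ?_) _)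
      rw [← image_mul, ← mul_assoc']
      exact Finset.le_sup (f := fun z => (z * y).image ⊤)
        (Finset.mem_union_right _ (Finset.mem_image_of_mem _ hz))
    · intro δ hδ
      refine relIndex_ne_zero_of_le_sup (C := C Z) ?_ (finite_kat' (φ := δ)) ?_
      · rw [AddSubgroup.relIndex_self]
        exact one_ne_zero
      refine (image_finset_sup_le _ _).trans (sup_le (Finset.sup_le fun z hz => ?_) le_sup_right)
      refine (h.sharp (Γ.mul_mem (hZ hz) hy) hδ).image_image_le.trans (sup_le_sup_right ?_ _)
      exact (image_mono le_top).trans (Finset.le_sup (f := fun z => (z * y).image ⊤) hz)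
  refine ⟨Z, hZ, fun x hx => ?_⟩
  -- `x` is finite on `C Z`, which has finite index in `A`.
  rw [class_eq_zero_iff, ← relIndex_ker_ne_zero_iff, AddSubgroup.relIndex_top_right]
  have h₁ : x.ker.relIndex (C Z) ≠ 0 := by
    rw [relIndex_ker_ne_zero_iff]
    refine Set.Finite.subset (finite_sup (finite_finset_sup
      (B := fun z => x.image ((z * y).image ⊤))
      (Z := Z) fun z hz => ?_) (finite_kat' (φ := x))) (image_finset_sup_le _ _)
    rw [← image_mul, ← mul_assoc', ← class_eq_zero_iff]
    exact hx z hz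
  rw [← AddSubgroup.relIndex_top_right] at hidx ⊢
  exact AddSubgroup.relIndex_ne_zero_trans h₁ hidx

/-- `Γ` is prime on the left modulo `∼`, and finitely many elements of `Γ` witness it. -/
theorem MinimalPair.prime_left (h : MinimalPair L M Γ Δ) {y : Endogeny A} (hy : y ∈ Γ.carrier)
    (hy₀ : EndogRing.mk y ≠ 0) : ∃ Z : Finset (Endogeny A), ↑Z ⊆ Γ.carrier ∧
      ∀ x : Endogeny A, (∀ z ∈ Z, EndogRing.mk (y * z * x) = 0) → EndogRing.mk x = 0 := by
  classical
  -- The right ideal `y Γ` has finitely many elements with a finite common kernel.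
  obtain ⟨J, hJ, hfin⟩ := h.finite_ker (I := (y * ·) '' Γ.carrier) (γ₀ := y * 1)
    (by rintro _ ⟨z, hz, rfl⟩; exact Γ.mul_mem hy hz)
    (by
      rintro _ ⟨z, hz, rfl⟩ γ hγ
      exact ⟨z * γ, Γ.mul_mem hz hγ, (mul_assoc' y z γ).symm⟩)
    ⟨1, Γ.one_mem, rfl⟩ (by rwa [EndogRing.mk_mul, EndogRing.mk_one, mul_one])
  obtain ⟨Z, hZ, rfl⟩ := Finset.subset_set_image_iff.1 hJ
  refine ⟨Z, hZ, fun x hx => ?_⟩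
  let B : AddSubgroup A := ⨅ z : Z, (y * z.1).ker
  have hB : (B : Set A).Finite := by
    refine hfin.subset fun a ha => ?_
    simpa [B] using ha
  -- Up to finite index `x[A]` lies in that finite kernel.
  have h₁ : B.relIndex (x.image ⊤) ≠ 0 := by
    refine AddSubgroup.relIndex_iInf_ne_zero fun z => relIndex_ker_ne_zero_iff.2 ?_
    rw [← image_mul, ← class_eq_zero_iff]
    exact hx z.1 z.2
  have h₂ : (⊥ : AddSubgroup A).relIndex B ≠ 0 := by
    have := hB.to_subtype
    rw [AddSubgroup.relIndex_bot_left]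
    exact Nat.card_pos.ne'
  have h₃ := AddSubgroup.relIndex_ne_zero_trans h₂ h₁
  rw [AddSubgroup.relIndex_bot_left] at h₃
  rw [class_eq_zero_iff]
  have := Nat.finite_of_card_ne_zero h₃
  exact Set.toFinite _

end Prime

/-! ### Stable finite subgroups -/

/-- The subgroup `F` is mapped by `Δ` into itself, up to the katakernels. -/
def Stable (Δ : PreSubring A) (F : AddSubgroup A) : Prop :=
  ∀ δ ∈ Δ.carrier, δ.image F ≤ F ⊔ δ.kat

theorem Stable.exists_mem {F : AddSubgroup A} (h : Stable Δ F) {δ : Endogeny A}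
    (hδ : δ ∈ Δ.carrier) {a : A} (ha : a ∈ F) : ∃ t ∈ F, (a, t) ∈ δ.graph := by
  obtain ⟨x, hx⟩ := δ.total a
  obtain ⟨t, ht, k, hk, rfl⟩ := AddSubgroup.mem_sup.1 (h δ hδ ⟨a, ha, hx⟩)
  exact ⟨t, ht, by simpa using δ.graph.sub_mem hx hk⟩

theorem MinimalPair.stable_kat (h : MinimalPair L M Γ Δ) {γ : Endogeny A} (hγ : γ ∈ Γ.carrier) :
    Stable Δ γ.kat := fun _ hδ => (h.sharp hγ hδ).image_kat_le

/-- The katakernels of the elements of `Γ` are directed, as `Γ` is closed under sums. -/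
theorem mem_Kat_iff {a : A} : a ∈ Kat Γ ↔ ∃ γ ∈ Γ.carrier, a ∈ γ.kat := by
  constructor
  · intro h
    refine AddSubgroup.iSup_induction' (C := fun a _ => ∃ γ ∈ Γ.carrier, a ∈ γ.kat) _
      (fun γ a ha => ?_) ⟨0, Γ.zero_mem, AddSubgroup.zero_mem _⟩ ?_ h
    · by_cases hγ : γ ∈ Γ.carrier
      · exact ⟨γ, hγ, by simpa [hγ] using ha⟩
      · obtain rfl : a = 0 := by simpa [hγ] using ha
        exact ⟨0, Γ.zero_mem, AddSubgroup.zero_mem _⟩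
    · rintro a b - - ⟨γ, hγ, ha⟩ ⟨γ', hγ', hb⟩
      refine ⟨γ + γ', Γ.add_mem hγ hγ', ?_⟩
      rw [kat_add]
      exact AddSubgroup.add_mem_sup ha hb
  · rintro ⟨γ, hγ, ha⟩
    exact (le_iSup₂_of_le γ hγ le_rfl : γ.kat ≤ Kat Γ) ha

theorem kat_le_Kat {γ : Endogeny A} (hγ : γ ∈ Γ.carrier) : γ.kat ≤ Kat Γ :=
  fun _ ha => mem_Kat_iff.2 ⟨γ, hγ, ha⟩

theorem exists_monotone_kat (g : ℕ → Endogeny A) (hg : ∀ i, g i ∈ Γ.carrier) :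
    ∃ F : ℕ → Endogeny A, (∀ i, F i ∈ Γ.carrier) ∧ Monotone (fun i => (F i).kat) ∧
      ∀ i, (g i).kat ≤ (F i).kat := by
  let F : ℕ → Endogeny A := fun i => Nat.rec (g 0) (fun j φ => φ + g (j + 1)) i
  have hF : ∀ i, F (i + 1) = F i + g (i + 1) := fun i => rfl
  refine ⟨F, fun i => ?_, monotone_nat_of_le_succ fun i => ?_, fun i => ?_⟩
  · induction i with
    | zero => exact hg 0
    | succ i ih => exact Γ.add_mem ih (hg _)
  · rw [hF, kat_add]
    exact le_sup_left
  · cases i with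
    | zero => exact le_rfl
    | succ i =>
      rw [hF, kat_add]
      exact le_sup_right

/-- Either the katakernels have bounded size, and the largest one is everything, or there is a
countable increasing sequence of them with infinite union. -/
theorem finite_Kat_or (Γ : PreSubring A) : (Kat Γ : Set A).Finite ∨
    ∃ F : ℕ → Endogeny A, (∀ i, F i ∈ Γ.carrier) ∧ Monotone (fun i => (F i).kat) ∧
      (⋃ i, ((F i).kat : Set A)).Infinite := by
  by_cases hN : ∃ N, ∀ γ ∈ Γ.carrier, (γ.kat : Set A).ncard ≤ N
  · obtain ⟨N, hN⟩ := hN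
    left
    obtain ⟨γ, hγ, hmax⟩ := exists_forall_le_nat (fun γ : Endogeny A => (γ.kat : Set A).ncard)
      ⟨0, Γ.zero_mem⟩ hN
    refine (finite_kat' (φ := γ)).subset fun a ha => ?_
    obtain ⟨γ', hγ', ha⟩ := mem_Kat_iff.1 ha
    have hsum := Γ.add_mem hγ hγ'
    have heq := Set.eq_of_subset_of_ncard_le (s := (γ.kat : Set A)) (t := (γ + γ').kat)
      (by rw [kat_add]; exact fun x hx => AddSubgroup.mem_sup_left hx) (hmax _ hsum) finite_kat'
    rw [heq, kat_add]
    exact AddSubgroup.mem_sup_right ha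
  · right
    push Not at hN
    choose g hg hg' using hN
    obtain ⟨F, hF, hF', hFg⟩ := exists_monotone_kat g hg
    refine ⟨F, hF, hF', fun hfin => ?_⟩
    have := hg' (⋃ i, ((F i).kat : Set A)).ncard
    refine this.not_ge (Set.ncard_le_ncard (fun x hx => ?_) hfin)
    exact Set.mem_iUnion.2 ⟨_, hFg _ hx⟩

theorem exists_ne_forall_eq {α β : Type*} [Finite α] [Finite β] {m : ℕ} (hm : Nat.card (α → β) < m)
    (g : Fin m → α → β) : ∃ i i', i ≠ i' ∧ g i = g i' := by
  have := Fintype.ofFinite (α → β)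
  refine Fintype.exists_ne_map_eq_of_card_lt g ?_
  rwa [Fintype.card_fin, Fintype.card_eq_nat_card]

section Tame

variable [Tame L M]

/-- Uniform finiteness: the finite sets of a definable family indexed by a type-definable set
have bounded size. -/
theorem TypeDef.exists_ncard_le {α β : Type w} [Coded L M α] [Coded L M β] {s : Set α}
    (hs : TypeDef L M s) {R : Set (α × β)} (hR : DefSet L M R)
    (hfin : ∀ x ∈ s, {b | (x, b) ∈ R}.Finite) : ∃ N, ∀ x ∈ s, {b | (x, b) ∈ R}.ncard ≤ N := by
  by_contra! hc
  -- A member with arbitrarily many points would exist by compactness.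
  obtain ⟨x, hx, hcl⟩ := hs.exists_cliques
    (Q := fun x b b' => (x, b) ∈ R ∧ (x, b') ∈ R ∧ b ≠ b')
    ((hR.mem (DefMap.id.fst.prodMk DefMap.id.snd.fst)).and
      ((hR.mem (DefMap.id.fst.prodMk DefMap.id.snd.snd)).and
        (DefSet.eq DefMap.id.snd.fst DefMap.id.snd.snd).not)) (fun t => by
    obtain ⟨x, hx, ht⟩ := hc t
    have := (hfin x hx).fintype
    rw [Set.ncard_eq_toFinset_card _ (hfin x hx)] at ht
    obtain ⟨u⟩ : Nonempty (Fin t ↪ (hfin x hx).toFinset) :=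
      Function.Embedding.nonempty_of_card_le (by simpa using ht.le)
    refine ⟨x, hx, fun i => u i, fun i j hij => ⟨?_, ?_, fun h => hij ?_⟩⟩
    · simpa using (u i).2
    · simpa using (u j).2
    · exact u.injective (Subtype.ext h))
  obtain ⟨u, hu⟩ := hcl ({b | (x, b) ∈ R}.ncard + 2)
  have hinj : Function.Injective u := fun i j h => by
    by_contra hij
    exact (hu i j hij).2.2 h
  have hmem : Set.range u ⊆ {b | (x, b) ∈ R} := by
    rintro _ ⟨i, rfl⟩
    obtain ⟨j, hj⟩ := exists_ne i
    exact (hu i j hj.symm).1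
  have h₁ := Set.ncard_le_ncard hmem (hfin x hx)
  rw [← Set.image_univ, Set.ncard_image_of_injective _ hinj, Set.ncard_univ, Nat.card_fin] at h₁
  omega

variable [DefAdd L M A]
variable {β : Type w} [Coded L M β] {Y : Set β} {c : β → Endogeny A} {Φ : Set (β × (A × A))}

/-- In a uniformly definable family of endogenies with arbitrarily many inequivalent members,
some nonzero difference annihilates a given union of finite subsets, as soon as the values of the
family on each of them can be chosen in a fixed finite set. -/
theorem exists_annihilator (hY : TypeDef L M Y) (hΦ : DefSet L M Φ)
    (hc : ∀ y ∈ Y, ∀ p, p ∈ (c y).graph ↔ (y, p) ∈ Φ)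
    (hlarge : ∀ m, ∃ b : Fin m → β, (∀ i, b i ∈ Y) ∧
      ∀ i i', i ≠ i' → ¬ Equivalent (c (b i)) (c (b i')))
    {F : ℕ → Set A} (hF : Monotone F) (hfin : ∀ i, (F i).Finite)
    (hT : ∀ i, ∃ T : Set A, T.Finite ∧ ∀ y ∈ Y, ∀ f ∈ F i, ∃ t ∈ T, (f, t) ∈ (c y).graph) :
    ∃ y ∈ Y, ∃ y' ∈ Y, EndogRing.mk (c y - c y') ≠ 0 ∧ ∀ i, ∀ f ∈ F i, f ∈ (c y - c y').ker := by
  -- The set `E` of the `((y, y'), x)` with `x ∈ (c y - c y')[A]` is definable for `y, y' ∈ Y`.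
  have hE : DefSet L M {x : (β × β) × A | ∃ p : A × (A × A), (x.1.1, (p.1, p.2.1)) ∈ Φ ∧
      (x.1.2, (p.1, p.2.2)) ∈ Φ ∧ p.2.1 - p.2.2 = x.2} :=
    DefSet.exists (p := fun (x : (β × β) × A) (p : A × (A × A)) => (x.1.1, (p.1, p.2.1)) ∈ Φ ∧
      (x.1.2, (p.1, p.2.2)) ∈ Φ ∧ p.2.1 - p.2.2 = x.2) <|
    (hΦ.mem (DefMap.id.fst.fst.fst.prodMk (DefMap.id.snd.fst.prodMk DefMap.id.snd.snd.fst))).and <|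
    (hΦ.mem (DefMap.id.fst.fst.snd.prodMk (DefMap.id.snd.fst.prodMk DefMap.id.snd.snd.snd))).and <|
    DefSet.eq (DefMap.id.snd.snd.fst.sub DefMap.id.snd.snd.snd) DefMap.id.fst.snd
  have hEmem : ∀ y ∈ Y, ∀ y' ∈ Y, ∀ x, ((y, y'), x) ∈ {x : (β × β) × A | ∃ p : A × (A × A),
      (x.1.1, (p.1, p.2.1)) ∈ Φ ∧ (x.1.2, (p.1, p.2.2)) ∈ Φ ∧ p.2.1 - p.2.2 = x.2} ↔
      x ∈ (c y - c y').image ⊤ := by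
    intro y hy y' hy' x
    constructor
    · rintro ⟨p, h₁, h₂, h₃⟩
      exact ⟨p.1, trivial, mem_sub.2 ⟨_, _, (hc y hy _).2 h₁, (hc y' hy' _).2 h₂, h₃⟩⟩
    · rintro ⟨a, -, ha⟩
      obtain ⟨z, z', h₁, h₂, h₃⟩ := mem_sub.1 ha
      exact ⟨(a, z, z'), (hc y hy _).1 h₁, (hc y' hy' _).1 h₂, h₃⟩
  set E := {x : (β × β) × A | ∃ p : A × (A × A),
      (x.1.1, (p.1, p.2.1)) ∈ Φ ∧ (x.1.2, (p.1, p.2.2)) ∈ Φ ∧ p.2.1 - p.2.2 = x.2}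
  -- The `i`-th condition: `c y` and `c y'` have a common value at each point of `F i`, and `(c y
  -- - c y')[A]` has at least `i` elements.
  let D : ℕ → Set (β × β) := fun i =>
    {x | (∀ f : F i, ∃ z, (x.1, (f.1, z)) ∈ Φ ∧ (x.2, (f.1, z)) ∈ Φ) ∧
      ∃ u : Fin i → A, ∀ s s', (x, u s) ∈ E ∧ (s ≠ s' → u s ≠ u s')}
  have key := (hY.prod hY).nonempty_of_antitone (D := D) ?_ ?_ ?_
  · obtain ⟨⟨y, y'⟩, ⟨hy, hy'⟩, hD⟩ := key
    refine ⟨y, hy, y', hy', fun h0 => ?_, fun i f hf => ?_⟩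
    · rw [class_eq_zero_iff] at h0
      obtain ⟨u, hu⟩ := (hD (h0.toFinset.card + 1)).2
      have := Finset.card_le_card_of_injOn (s := Finset.univ) (t := h0.toFinset) u
        (fun s _ => by simpa using (hEmem y hy y' hy' _).1 (hu s s).1)
        (fun s _ s' _ h => by
          by_contra hss
          exact (hu s s').2 hss h)
      simp at this
    · obtain ⟨z, h₁, h₂⟩ := (hD i).1 ⟨f, hf⟩
      exact mem_sub.2 ⟨z, z, (hc y hy _).2 h₁, (hc y' hy' _).2 h₂, sub_self z⟩
  · intro i
    have := (hfin i).to_subtype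
    refine (DefSet.finite_forall fun f : F i => DefSet.exists (p := fun (x : β × β) z =>
      (x.1, (f.1, z)) ∈ Φ ∧ (x.2, (f.1, z)) ∈ Φ) ?_).and
      (DefSet.exists (p := fun (x : β × β) (u : Fin i → A) =>
        ∀ s s', (x, u s) ∈ E ∧ (s ≠ s' → u s ≠ u s')) ?_)
    · exact (hΦ.mem (DefMap.id.fst.fst.prodMk ((DefMap.const f.1).prodMk DefMap.id.snd))).and
        (hΦ.mem (DefMap.id.fst.snd.prodMk ((DefMap.const f.1).prodMk DefMap.id.snd)))
    · exact DefSet.finite_forall fun s => DefSet.finite_forall fun s' =>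
        (hE.mem (DefMap.id.fst.prodMk (DefMap.id.snd.apply s))).and <| (DefSet.const _).imp
          (DefSet.eq (DefMap.id.snd.apply s) (DefMap.id.snd.apply s')).not
  · rintro i j hij x ⟨h₁, u, hu⟩
    exact ⟨fun f => h₁ ⟨f.1, hF hij f.2⟩, fun s => u (Fin.castLE hij s), fun s s' =>
      ⟨(hu _ (Fin.castLE hij s')).1, fun h => (hu _ _).2 fun h' => h (Fin.castLE_injective hij h')⟩⟩
  · intro i
    obtain ⟨T, hT, hTc⟩ := hT i
    have := (hfin i).to_subtype
    have := hT.to_subtype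
    -- Two of more than `|T| ^ |F i|` members take the same chosen values in `T` on `F i`.
    obtain ⟨b, hb, hb'⟩ := hlarge (Nat.card (F i → T) + 1)
    choose g hg hg' using fun j (f : F i) => hTc (b j) (hb j) f.1 f.2
    obtain ⟨j, j', hj, hjj⟩ := exists_ne_forall_eq (Nat.lt_succ_self _)
      (fun j f => (⟨g j f, hg j f⟩ : T))
    refine ⟨(b j, b j'), ⟨hb j, hb j'⟩, fun f => ⟨g j f, (hc _ (hb j) _).1 (hg' j f), ?_⟩, ?_⟩
    · have : g j f = g j' f := Subtype.ext_iff.1 (congrFun hjj f)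
      rw [this]
      exact (hc _ (hb j') _).1 (hg' j' f)
    · have hinf : ((c (b j) - c (b j')).image ⊤ : Set A).Infinite := by
        intro h0
        exact hb' j j' hj (mk_sub_eq_zero_iff.1 (class_eq_zero_iff.2 h0))
      have := hinf.to_subtype
      let u := (Fin.valEmbedding (n := i)).trans
        (Infinite.natEmbedding ((c (b j) - c (b j')).image ⊤ : Set A))
      exact ⟨fun s => (u s).1, fun s s' => ⟨(hEmem _ (hb j) _ (hb j') _).2 (u s).2,
        fun h h' => h (u.injective (Subtype.ext h'))⟩⟩

/-- If `Γ` contains a large uniformly definable family, the katakernel of `Δ` is finite. -/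
theorem MinimalPair.finite_Kat_right (h : MinimalPair L M Γ Δ) (hY : TypeDef L M Y)
    (hΦ : DefSet L M Φ) (hc : ∀ y ∈ Y, c y ∈ Γ.carrier ∧ ∀ p, p ∈ (c y).graph ↔ (y, p) ∈ Φ)
    (hlarge : ∀ m, ∃ b : Fin m → β, (∀ i, b i ∈ Y) ∧
      ∀ i i', i ≠ i' → ¬ Equivalent (c (b i)) (c (b i'))) : (Kat Δ : Set A).Finite := by
  refine (finite_Kat_or Δ).resolve_right ?_
  rintro ⟨F, hF, hF', hinf⟩
  obtain ⟨y, hy, y', hy', hne, hker⟩ := exists_annihilator hY hΦ (fun y hy => (hc y hy).2) hlarge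
    (F := fun i => (F i).kat) hF' (fun i => finite_kat') fun i => ⟨_, finite_kat' (φ := F i),
      fun y hy f hf => (h.symm.stable_kat (hF i)).exists_mem (hc y hy).1 hf⟩
  -- The elements of `Γ` annihilating an infinite increasing union of katakernels form a right
  -- ideal, not all equivalent to zero; so that union is finite.
  have key := h.finite_ker
    (I := {γ | γ ∈ Γ.carrier ∧ ∀ i, (F i).kat ≤ γ.ker}) (fun γ hγ => hγ.1)
    (fun γ hγ γ' hγ' => ⟨Γ.mul_mem hγ.1 hγ', fun i a ha => ?_⟩)
    ⟨Γ.sub_mem (hc y hy).1 (hc y' hy').1, hker⟩ hne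
  · obtain ⟨J, hJ, hfin⟩ := key
    exact hinf (hfin.subset (Set.iUnion_subset fun i a ha γ hγ => (hJ hγ).2 i ha))
  · obtain ⟨t, ht, hat⟩ := (h.symm.stable_kat (hF i)).exists_mem hγ' ha
    exact ⟨t, hat, hγ.2 i ht⟩

/-- Given finitely many nonzero elements of `Γ`, some nonzero element of `Γ` annihilates every
`Γ`-stable subgroup that one of them annihilates: by primeness the given elements have a nonzero
product with suitable factors in between. -/
theorem MinimalPair.exists_ker_of_finset (h : MinimalPair L M Γ Δ)
    (h1 : EndogRing.mk (1 : Endogeny A) ≠ 0) (s : Finset (Endogeny A))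
    (hs : ∀ d ∈ s, d ∈ Γ.carrier ∧ EndogRing.mk d ≠ 0) :
    ∃ y ∈ Γ.carrier, EndogRing.mk y ≠ 0 ∧
      ∀ F, Stable Γ F → (∃ d ∈ s, F ≤ d.ker) → F ≤ y.ker := by
  classical
  induction s using Finset.induction_on with
  | empty => exact ⟨1, Γ.one_mem, h1, by simp⟩
  | insert d s _ ih =>
    obtain ⟨y, hy, hy₀, hyF⟩ := ih fun d' hd' => hs d' (Finset.mem_insert_of_mem hd')
    obtain ⟨hd, hd₀⟩ := hs d (Finset.mem_insert_self d s)
    obtain ⟨Z, hZ, hprime⟩ := h.prime_right hy hy₀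
    obtain ⟨z, hz, hz₀⟩ : ∃ z ∈ Z, EndogRing.mk (d * z * y) ≠ 0 := by
      by_contra! hc
      exact hd₀ (hprime d hc)
    refine ⟨d * z * y, Γ.mul_mem (Γ.mul_mem hd (hZ hz)) hy, hz₀, ?_⟩
    rintro F hF ⟨d', hd', hFd⟩ a ha
    rcases Finset.mem_insert.1 hd' with rfl | hd'
    · obtain ⟨t, ht, hat⟩ := hF.exists_mem hy ha
      obtain ⟨t', ht', htt⟩ := hF.exists_mem (hZ hz) ht
      exact ⟨t, hat, t', htt, hFd ht'⟩
    · exact ⟨0, hyF F hF ⟨d', hd', hFd⟩ ha, zero_mem _⟩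

/-- If `Γ` is essentially infinite, the finite `Γ`-stable subgroups of bounded size are contained
in a finite set. -/
theorem MinimalPair.finite_stable (h : MinimalPair L M Γ Δ)
    (hinf : (EndogRing.mk '' Γ.carrier).Infinite)
    (N : ℕ) : {a : A | ∃ F : AddSubgroup A, (F : Set A).Finite ∧ (F : Set A).ncard ≤ N ∧
      Stable Γ F ∧ a ∈ F}.Finite := by
  classical
  have h1 : EndogRing.mk (1 : Endogeny A) ≠ 0 := by
    intro h0
    refine hinf ((Set.finite_singleton 0).subset ?_)
    rintro _ ⟨γ, -, rfl⟩
    rw [Set.mem_singleton_iff, ← mul_one (EndogRing.mk γ), ← EndogRing.mk_one, h0, mul_zero]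
  have := hinf.to_subtype
  -- Of `N ^ N + 1` inequivalent elements, two induce the same function on a stable subgroup of
  -- size at most `N`; so one of their differences annihilates it.
  let e := (Fin.valEmbedding (n := N ^ N + 1)).trans (Infinite.natEmbedding
    (EndogRing.mk '' Γ.carrier))
  choose g hg hg' using fun i => (e i).2
  have hinj : ∀ i j, i ≠ j → EndogRing.mk (g i - g j) ≠ 0 := by
    intro i j hij h0
    rw [mk_sub, sub_eq_zero, hg', hg'] at h0
    exact hij (e.injective (Subtype.ext h0))
  obtain ⟨y, hy, hy₀, hyF⟩ := h.exists_ker_of_finset h1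
    (Finset.univ.offDiag.image fun p : Fin (N ^ N + 1) × Fin (N ^ N + 1) => g p.1 - g p.2) (by
      intro d hd
      obtain ⟨p, hp, rfl⟩ := Finset.mem_image.1 hd
      exact ⟨Γ.sub_mem (hg _) (hg _), hinj _ _ (Finset.mem_offDiag.1 hp).2.2⟩)
  have key := h.finite_ker (I := {γ | γ ∈ Γ.carrier ∧ ∀ F : AddSubgroup A,
    (F : Set A).Finite → (F : Set A).ncard ≤ N → Stable Γ F → F ≤ γ.ker}) (fun γ hγ => hγ.1)
    (fun γ hγ γ' hγ' => ⟨Γ.mul_mem hγ.1 hγ', fun F hF hN hs a ha => ?_⟩) (γ₀ := y) ⟨hy, ?_⟩ hy₀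
  · obtain ⟨J, hJ, hfin⟩ := key
    refine hfin.subset ?_
    rintro a ⟨F, hF, hN, hs, ha⟩ γ hγ
    exact (hJ hγ).2 F hF hN hs ha
  · obtain ⟨t, ht, hat⟩ := hs.exists_mem hγ' ha
    exact ⟨t, hat, hγ.2 F hF hN hs ht⟩
  · intro F hF hN hs
    refine hyF F hs ?_
    have := hF.to_subtype
    choose f hf hf' using fun i (a : F) => hs.exists_mem (hg i) a.2
    have hcard : Nat.card (F → F) < N ^ N + 1 := by
      have h₁ : Nat.card F ≤ N := hN
      have h₂ : 0 < Nat.card F := Nat.card_pos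
      rw [Nat.card_fun]
      refine Nat.lt_succ_of_le ((Nat.pow_le_pow_left h₁ _).trans (Nat.pow_le_pow_right ?_ h₁))
      omega
    obtain ⟨i, j, hij, hfij⟩ := exists_ne_forall_eq hcard (fun i a => (⟨f i a, hf i a⟩ : F))
    refine ⟨g i - g j, Finset.mem_image.2 ⟨(i, j), by simpa using hij, rfl⟩, fun a ha => ?_⟩
    have h₃ : f i ⟨a, ha⟩ = f j ⟨a, ha⟩ := Subtype.ext_iff.1 (congrFun hfij ⟨a, ha⟩)
    exact mem_sub.2 ⟨_, _, hf' i ⟨a, ha⟩, hf' j ⟨a, ha⟩, sub_eq_zero.2 h₃⟩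

/-- If `Γ` contains a large uniformly definable family and `Δ` is essentially infinite, the
katakernel of `Γ` is finite. -/
theorem MinimalPair.finite_Kat_left (h : MinimalPair L M Γ Δ)
    (hinf : (EndogRing.mk '' Δ.carrier).Infinite) (hY : TypeDef L M Y)
    (hΦ : DefSet L M Φ) (hc : ∀ y ∈ Y, c y ∈ Γ.carrier ∧ ∀ p, p ∈ (c y).graph ↔ (y, p) ∈ Φ)
    (hlarge : ∀ m, ∃ b : Fin m → β, (∀ i, b i ∈ Y) ∧
      ∀ i i', i ≠ i' → ¬ Equivalent (c (b i)) (c (b i'))) : (Kat Γ : Set A).Finite := by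
  let T : ℕ → Set A := fun N => {a : A | ∃ F : AddSubgroup A, (F : Set A).Finite ∧
    (F : Set A).ncard ≤ N ∧ Stable Δ F ∧ a ∈ F}
  have hT : ∀ N, (T N).Finite := h.symm.finite_stable hinf
  -- The katakernels of `Γ` are `Δ`-stable, so those of size at most `N` lie in the finite set
  -- `T N`, and `Kat Γ` is exhausted by countably many katakernels.
  have hcount : (Kat Γ : Set A).Countable := by
    refine Set.Countable.mono ?_ (Set.countable_iUnion fun N => (hT N).countable)
    intro a ha
    obtain ⟨γ, hγ, ha⟩ := mem_Kat_iff.1 ha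
    exact Set.mem_iUnion.2 ⟨_, γ.kat, finite_kat', le_rfl, h.stable_kat hγ, ha⟩
  obtain ⟨f, hf⟩ := hcount.exists_eq_range ⟨0, zero_mem _⟩
  have hfmem : ∀ i, f i ∈ Kat Γ := fun i => by
    have : f i ∈ (Kat Γ : Set A) := hf ▸ ⟨i, rfl⟩
    exact this
  choose g hg hg' using fun i => mem_Kat_iff.1 (hfmem i)
  obtain ⟨F, hF, hF', hFg⟩ := exists_monotone_kat g hg
  obtain ⟨y, hy, y', hy', hne, hker⟩ := exists_annihilator hY hΦ (fun y hy => (hc y hy).2) hlarge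
    (F := fun i => (F i).kat) hF' (fun i => finite_kat') fun i => by
      have hset : ∀ y ∈ Y, {b | (y, b) ∈ {p : β × A | ∃ a, a ∈ (F i).kat ∧ (p.1, (a, p.2)) ∈ Φ}} =
          (c y * F i).kat := by
        intro y hy
        ext b
        rw [kat_mul]
        exact exists_congr fun a => and_congr_right fun _ => ((hc y hy).2 (a, b)).symm
      -- The sets `c y [kat (F i)] = kat (c y * F i)` have bounded size, so all lie in one `T N`.
      obtain ⟨N, hN⟩ := hY.exists_ncard_le (R := {p : β × A | ∃ a, a ∈ (F i).kat ∧
        (p.1, (a, p.2)) ∈ Φ}) (DefSet.exists (p := fun (p : β × A) a => a ∈ (F i).kat ∧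
        (p.1, (a, p.2)) ∈ Φ) (((DefSet.of_finite (finite_kat' (φ := F i))).mem DefMap.id.snd).and
          (hΦ.mem (DefMap.id.fst.fst.prodMk (DefMap.id.snd.prodMk DefMap.id.fst.snd)))))
        fun y hy => by rw [hset y hy]; exact finite_kat'
      refine ⟨T N, hT N, fun y hy a ha => ?_⟩
      obtain ⟨t, ht⟩ := (c y).total a
      refine ⟨t, ⟨(c y * F i).kat, finite_kat', ?_, h.stable_kat (Γ.mul_mem (hc y hy).1 (hF i)),
        ⟨a, ha, ht⟩⟩, ht⟩
      rw [← hset y hy]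
      exact hN y hy
  have key := h.finite_ker (I := {γ | γ ∈ Γ.carrier ∧ Kat Γ ≤ γ.ker})
    (fun γ hγ => hγ.1) (fun γ hγ γ' hγ' => ⟨Γ.mul_mem hγ.1 hγ', fun a ha => ?_⟩)
    (γ₀ := c y - c y') ⟨Γ.sub_mem (hc y hy).1 (hc y' hy').1, fun a ha => ?_⟩ hne
  · obtain ⟨J, hJ, hfin⟩ := key
    exact hfin.subset fun a ha γ hγ => (hJ hγ).2 ha
  · obtain ⟨γ₁, hγ₁, ha⟩ := mem_Kat_iff.1 ha
    obtain ⟨t, ht⟩ := γ'.total a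
    exact ⟨t, ht, hγ.2 (mem_Kat_iff.2 ⟨γ' * γ₁, Γ.mul_mem hγ' hγ₁, ⟨a, ha, ht⟩⟩)⟩
  · have ha' : a ∈ (Kat Γ : Set A) := ha
    rw [hf] at ha'
    obtain ⟨i, rfl⟩ := ha'
    exact hker i _ (hFg i (hg' i))

end Tame

end Katakernels

/-! ### Families of endomorphisms indexed by type-definable sets -/

section Families

variable {L : FirstOrder.Language.{u, v}} {M : Type w} [L.Structure M] [Tame L M]
variable {U V : Type w} [Coded L M U] [Coded L M V] [AddCommGroup U] [AddCommGroup V]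

/-- The image of an endomorphism. -/
abbrev endRange {U : Type*} [AddCommGroup U] (f : AddMonoid.End U) : AddSubgroup U :=
  AddMonoidHom.range f

variable (L M) in
/-- A set of endomorphisms of `U` is a type-definable family if it consists of the members of a
uniformly definable family whose indices lie in a type-definable set. -/
def IsFamily (G : Set (AddMonoid.End U)) : Prop :=
  ∃ (β : Type w) (_ : Coded L M β) (Y : Set β) (Φ : Set (β × (U × U))), TypeDef L M Y ∧
    DefSet L M Φ ∧ (∀ y ∈ Y, ∃ g ∈ G, ∀ u v, (y, (u, v)) ∈ Φ ↔ g u = v) ∧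
    ∀ g ∈ G, ∃ y ∈ Y, ∀ u v, (y, (u, v)) ∈ Φ ↔ g u = v

/-- A binary operation applied to the members of two type-definable families yields a
type-definable family, if its graph is definable in terms of the graphs of its arguments. -/
theorem IsFamily.image2 {G G' : Set (AddMonoid.End U)} (hG : IsFamily L M G)
    (hG' : IsFamily L M G') (op : AddMonoid.End U → AddMonoid.End U → AddMonoid.End V)
    {θ : Set ((V × V) × (U × (U × U)))} (hθ : DefSet L M θ)
    (hop : ∀ g ∈ G, ∀ g' ∈ G', ∀ u v, op g g' u = v ↔ ∃ w, ((u, v), (w, (g w, g' w))) ∈ θ) :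
    IsFamily L M (Set.image2 op G G') := by
  obtain ⟨β, _, Y, Φ, hY, hΦ, hYG, hGY⟩ := hG
  obtain ⟨β', _, Y', Φ', hY', hΦ', hYG', hGY'⟩ := hG'
  have key : ∀ y y' g g', g ∈ G → g' ∈ G' → (∀ u v, (y, (u, v)) ∈ Φ ↔ g u = v) →
      (∀ u v, (y', (u, v)) ∈ Φ' ↔ g' u = v) → ∀ u v,
      ((y, y'), (u, v)) ∈ {x : (β × β') × (V × V) | ∃ p : U × (U × U),
        (x.1.1, (p.1, p.2.1)) ∈ Φ ∧ (x.1.2, (p.1, p.2.2)) ∈ Φ' ∧ (x.2, p) ∈ θ} ↔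
        op g g' u = v := by
    intro y y' g g' hg hg' h h' u v
    rw [hop g hg g' hg']
    constructor
    · rintro ⟨⟨w, z, z'⟩, h₁, h₂, h₃⟩
      obtain rfl : g w = z := (h _ _).1 h₁
      obtain rfl : g' w = z' := (h' _ _).1 h₂
      exact ⟨w, h₃⟩
    · rintro ⟨w, hw⟩
      exact ⟨_, (h _ _).2 rfl, (h' _ _).2 rfl, hw⟩
  refine ⟨β × β', inferInstance, Y ×ˢ Y', _, hY.prod hY', DefSet.exists
    (p := fun (x : (β × β') × (V × V)) (p : U × (U × U)) => (x.1.1, (p.1, p.2.1)) ∈ Φ ∧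
      (x.1.2, (p.1, p.2.2)) ∈ Φ' ∧ (x.2, p) ∈ θ) ?_, ?_, ?_⟩
  · exact (hΦ.mem (DefMap.id.fst.fst.fst.prodMk
      (DefMap.id.snd.fst.prodMk DefMap.id.snd.snd.fst))).and <|
      (hΦ'.mem (DefMap.id.fst.fst.snd.prodMk
      (DefMap.id.snd.fst.prodMk DefMap.id.snd.snd.snd))).and
      (hθ.mem (DefMap.id.fst.snd.prodMk DefMap.id.snd))
  · rintro ⟨y, y'⟩ ⟨hy, hy'⟩
    obtain ⟨g, hg, h⟩ := hYG y hy
    obtain ⟨g', hg', h'⟩ := hYG' y' hy'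
    exact ⟨op g g', ⟨g, hg, g', hg', rfl⟩, key y y' g g' hg hg' h h'⟩
  · rintro _ ⟨g, hg, g', hg', rfl⟩
    obtain ⟨y, hy, h⟩ := hGY g hg
    obtain ⟨y', hy', h'⟩ := hGY' g' hg'
    exact ⟨(y, y'), ⟨hy, hy'⟩, key y y' g g' hg hg' h h'⟩

/-- The members of a type-definable family satisfying a definable condition form a type-definable
family. -/
theorem IsFamily.sep {G : Set (AddMonoid.End U)} (hG : IsFamily L M G) {P : AddMonoid.End U → Prop}
    (hP : ∀ {β : Type w} [Coded L M β] {Φ : Set (β × (U × U))}, DefSet L M Φ → ∃ D : Set β,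
      DefSet L M D ∧ ∀ y g, (∀ u v, (y, (u, v)) ∈ Φ ↔ g u = v) → (y ∈ D ↔ P g)) :
    IsFamily L M {g | g ∈ G ∧ P g} := by
  obtain ⟨β, _, Y, Φ, hY, hΦ, hYG, hGY⟩ := hG
  obtain ⟨D, hD, hDP⟩ := hP hΦ
  refine ⟨β, _, Y ∩ D, Φ, hY.inter hD.typeDef, hΦ, ?_, ?_⟩
  · rintro y ⟨hy, hyD⟩
    obtain ⟨g, hg, h⟩ := hYG y hy
    exact ⟨g, ⟨hg, (hDP y g h).1 hyD⟩, h⟩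
  · rintro g ⟨hg, hPg⟩
    obtain ⟨y, hy, h⟩ := hGY g hg
    exact ⟨y, ⟨hy, (hDP y g h).2 hPg⟩, h⟩

theorem IsFamily.sep_apply_ne_zero {G : Set (AddMonoid.End U)} (hG : IsFamily L M G) (a : U) :
    IsFamily L M {g | g ∈ G ∧ g a ≠ 0} := by
  refine hG.sep fun {β} _ {Φ} hΦ => ⟨{y | (y, (a, 0)) ∉ Φ}, ?_, fun y g h => not_congr (h a 0)⟩
  exact (hΦ.mem (DefMap.id.prodMk ((DefMap.const a).prodMk (DefMap.const 0)))).not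

theorem IsFamily.sep_commute {G : Set (AddMonoid.End U)} (hG : IsFamily L M G)
    {f : AddMonoid.End U} (hf : DefMap L M f) : IsFamily L M {g | g ∈ G ∧ g * f = f * g} := by
  refine hG.sep fun {β} _ {Φ} hΦ => ⟨{y | ∀ p : U × U, (y, p) ∈ Φ → (y, (f p.1, f p.2)) ∈ Φ},
    DefSet.forall (p := fun y (p : U × U) => (y, p) ∈ Φ → (y, (f p.1, f p.2)) ∈ Φ) ?_, ?_⟩
  · exact (hΦ.mem (DefMap.id.fst.prodMk DefMap.id.snd)).imp
      (hΦ.mem (DefMap.id.fst.prodMk ((hf.comp DefMap.id.snd.fst).prodMk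
        (hf.comp DefMap.id.snd.snd))))
  · intro y g h
    constructor
    · intro hy
      ext u
      exact (h _ _).1 (hy (u, g u) ((h _ _).2 rfl))
    · rintro hy ⟨u, v⟩ hp
      obtain rfl := (h _ _).1 hp
      exact (h _ _).2 (DFunLike.congr_fun hy u)

theorem IsFamily.typeDef_eval {G : Set (AddMonoid.End U)} (hG : IsFamily L M G) (a : U) :
    TypeDef L M {x : U × (U × U) | ∃ g ∈ G, g a = x.1 ∧ g x.2.1 = x.2.2} := by
  obtain ⟨β, _, Y, Φ, hY, hΦ, hYG, hGY⟩ := hG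
  refine (TypeDef.exists (p := fun (x : U × (U × U)) y => y ∈ Y ∧ (y, (a, x.1)) ∈ Φ ∧ (y, x.2) ∈ Φ)
    ((hY.preimage DefMap.id.snd).inter (((hΦ.mem (DefMap.id.snd.prodMk
      ((DefMap.const a).prodMk DefMap.id.fst.fst))).and
        (hΦ.mem (DefMap.id.snd.prodMk DefMap.id.fst.snd))).typeDef))).of_eq ?_
  ext ⟨p, u, v⟩
  constructor
  · rintro ⟨y, hy, h₁, h₂⟩
    obtain ⟨g, hg, h⟩ := hYG y hy
    exact ⟨g, hg, (h _ _).1 h₁, (h _ _).1 h₂⟩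
  · rintro ⟨g, hg, h₁, h₂⟩
    obtain ⟨y, hy, h⟩ := hGY g hg
    exact ⟨y, hy, (h _ _).2 h₁, (h _ _).2 h₂⟩

theorem IsFamily.typeDef_apply {G : Set (AddMonoid.End U)} (hG : IsFamily L M G) (a : U) :
    TypeDef L M ((fun g => g a) '' G) := by
  have hf : DefMap L M fun v : U => (v, (a, v)) :=
    DefMap.id.prodMk ((DefMap.const a).prodMk DefMap.id)
  refine ((hG.typeDef_eval a).preimage hf).of_eq ?_
  ext v
  constructor
  · rintro ⟨g, hg, h, -⟩
    exact ⟨g, hg, h⟩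
  · rintro ⟨g, hg, h⟩
    exact ⟨g, hg, h, h⟩

/-! ### Domains of definable endomorphisms -/

section Domain

variable [DefAdd L M U]

/-- If the differences of the members of a type-definable family that disagree at `a` have images
of finite index, these indices are bounded. -/
theorem IsFamily.exists_index_le {G : Set (AddMonoid.End U)} (hG : IsFamily L M G) {a : U}
    (hidx : ∀ g ∈ G, ∀ g' ∈ G, g a ≠ g' a → (endRange (g - g')).index ≠ 0) :
    ∃ N, ∀ g ∈ G, ∀ g' ∈ G, g a ≠ g' a → (endRange (g - g')).index ≤ N := by
  obtain ⟨β, _, Y, Φ, hY, hΦ, hYG, hGY⟩ := hG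
  have hs : TypeDef L M ((Y ×ˢ Y) ∩ {x : β × β | ∃ v, (x.1, (a, v)) ∈ Φ ∧ (x.2, (a, v)) ∉ Φ}) := by
    refine (hY.prod hY).inter (DefSet.typeDef (DefSet.exists
      (p := fun (x : β × β) v => (x.1, (a, v)) ∈ Φ ∧ (x.2, (a, v)) ∉ Φ) ?_))
    exact (hΦ.mem (DefMap.id.fst.fst.prodMk ((DefMap.const a).prodMk DefMap.id.snd))).and
      (hΦ.mem (DefMap.id.fst.snd.prodMk ((DefMap.const a).prodMk DefMap.id.snd))).not
  -- It is a definable property of the indices of `g` and `g'` and of two points to be in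
  -- different cosets of the image of `g - g'`.
  have hQ : DefSet L M {p : (β × β) × (U × U) | ¬ ∃ z : U × (U × U), (p.1.1, (z.1, z.2.1)) ∈ Φ ∧
      (p.1.2, (z.1, z.2.2)) ∈ Φ ∧ z.2.1 - z.2.2 = -p.2.1 + p.2.2} := by
    refine DefSet.not (DefSet.exists (p := fun (p : (β × β) × (U × U)) (z : U × (U × U)) =>
      (p.1.1, (z.1, z.2.1)) ∈ Φ ∧ (p.1.2, (z.1, z.2.2)) ∈ Φ ∧ z.2.1 - z.2.2 = -p.2.1 + p.2.2) ?_)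
    exact (hΦ.mem (DefMap.id.fst.fst.fst.prodMk
      (DefMap.id.snd.fst.prodMk DefMap.id.snd.snd.fst))).and <|
      (hΦ.mem (DefMap.id.fst.fst.snd.prodMk
      (DefMap.id.snd.fst.prodMk DefMap.id.snd.snd.snd))).and <|
      DefSet.eq (DefMap.id.snd.snd.fst.sub DefMap.id.snd.snd.snd)
        (DefMap.id.fst.snd.fst.neg.add DefMap.id.fst.snd.snd)
  have hQmem : ∀ y y' (g g' : AddMonoid.End U), (∀ u v, (y, (u, v)) ∈ Φ ↔ g u = v) →
      (∀ u v, (y', (u, v)) ∈ Φ ↔ g' u = v) → ∀ u v : U, (¬ ∃ z : U × (U × U),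
      (y, (z.1, z.2.1)) ∈ Φ ∧ (y', (z.1, z.2.2)) ∈ Φ ∧ z.2.1 - z.2.2 = -u + v) ↔
      (u : U ⧸ endRange (g - g')) ≠ v := by
    intro y y' g g' h h' u v
    rw [Ne, QuotientAddGroup.eq]
    refine not_congr ⟨?_, ?_⟩
    · rintro ⟨⟨w, z, z'⟩, h₁, h₂, h₃⟩
      obtain rfl : g w = z := (h _ _).1 h₁
      obtain rfl : g' w = z' := (h' _ _).1 h₂
      exact ⟨w, h₃⟩
    · rintro ⟨w, hw⟩
      exact ⟨(w, g w, g' w), (h _ _).2 rfl, (h' _ _).2 rfl, hw⟩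
  by_contra! hc
  -- Were the indices unbounded, some image would have infinite index by compactness.
  obtain ⟨⟨y, y'⟩, ⟨⟨hy, hy'⟩, v, hv, hv'⟩, hcl⟩ := hs.exists_cliques
    (Q := fun x u v => ¬ ∃ z : U × (U × U), (x.1, (z.1, z.2.1)) ∈ Φ ∧
      (x.2, (z.1, z.2.2)) ∈ Φ ∧ z.2.1 - z.2.2 = -u + v) hQ (fun t => by
    obtain ⟨g, hg, g', hg', hne, ht⟩ := hc t
    obtain ⟨y, hy, h⟩ := hGY g hg
    obtain ⟨y', hy', h'⟩ := hGY g' hg'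
    have : (endRange (g - g')).FiniteIndex := ⟨hidx g hg g' hg' hne⟩
    have := Fintype.ofFinite (U ⧸ endRange (g - g'))
    obtain ⟨e⟩ : Nonempty (Fin t ↪ U ⧸ endRange (g - g')) := by
      refine Function.Embedding.nonempty_of_card_le ?_
      rw [Fintype.card_fin, Fintype.card_eq_nat_card]
      exact ht.le
    refine ⟨(y, y'), ⟨⟨hy, hy'⟩, g a, (h _ _).2 rfl, fun h₀ => hne ((h' _ _).1 h₀).symm⟩,
      fun i => (e i).out, fun i j hij => (hQmem y y' g g' h h' _ _).2 ?_⟩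
    dsimp only
    rw [QuotientAddGroup.out_eq', QuotientAddGroup.out_eq']
    exact fun h₀ => hij (e.injective h₀))
  obtain ⟨g, hg, h⟩ := hYG y hy
  obtain ⟨g', hg', h'⟩ := hYG y' hy'
  have hne : g a ≠ g' a := fun h₀ => hv' ((h' _ _).2 (h₀.symm.trans ((h _ _).1 hv)))
  have : (endRange (g - g')).FiniteIndex := ⟨hidx g hg g' hg' hne⟩
  obtain ⟨e, he⟩ := hcl ((endRange (g - g')).index + 1)
  have hinj : Function.Injective fun i => (e i : U ⧸ endRange (g - g')) := by
    intro i j hij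
    by_contra hne
    exact (hQmem y y' g g' h h' _ _).1 (he i j hne) hij
  have := Nat.card_le_card_of_injective _ hinj
  rw [Nat.card_fin] at this
  exact (Nat.lt_succ_self _).not_ge this

variable {P : Subring (AddMonoid.End U)}

/-- A ring of definable endomorphisms whose nonzero elements are injective, and which contains an
infinite type-definable family, is covered by the fractions of a type-definable family `G`: if
`(g, g') ↦ k * g - g'` were injective on a family of largest dimension, it would give a larger
one. -/
theorem exists_fraction_family (hdef : ∀ f ∈ P, DefMap L M f)
    (hinj : ∀ f ∈ P, ∀ a, f a = 0 → a ≠ 0 → f = 0)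
    {G₀ : Set (AddMonoid.End U)} (hG₀ : IsFamily L M G₀)
    (hG₀P : G₀ ⊆ P) (hG₀inf : G₀.Infinite) :
    ∃ G : Set (AddMonoid.End U), IsFamily L M G ∧ G ⊆ P ∧ ∀ k ∈ P, k ≠ 0 →
      ∃ g₁ ∈ G, ∃ g₂ ∈ G, ∃ g₃ ∈ G, ∃ g₄ ∈ G, g₁ ≠ g₂ ∧ k * (g₁ - g₂) = g₃ - g₄ := by
  have heq : ∀ f ∈ P, ∀ g ∈ P, ∀ a, a ≠ 0 → f a = g a → f = g := fun f hf g hg a ha h =>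
    sub_eq_zero.1 (hinj _ (P.sub_mem hf hg) a (sub_eq_zero.2 h) ha)
  obtain ⟨a, ha⟩ : ∃ a : U, a ≠ 0 := by
    by_contra! hc
    exact hG₀inf (Set.Subsingleton.finite fun f _ g _ => by ext u; rw [hc (f u), hc (g u)])
  -- An element of `P` is determined by its value at `a`, so the dimension of `G a` measures `G`.
  obtain ⟨G, ⟨hG, hGP, hGne⟩, hmax⟩ := exists_forall_le_nat
    (p := fun G => IsFamily L M G ∧ G ⊆ P ∧ G.Nonempty)
    (fun G : Set (AddMonoid.End U) => tdm L M ((fun g => g a) '' G))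
    ⟨G₀, hG₀, hG₀P, hG₀inf.nonempty⟩ (fun G _ => tdm_le_dm_univ _)
  have h1 : 1 ≤ tdm L M ((fun g => g a) '' G) := by
    refine le_trans (one_le_tdm (hG₀inf.image fun f hf g hg h => ?_))
      (hmax G₀ ⟨hG₀, hG₀P, hG₀inf.nonempty⟩)
    exact heq f (hG₀P hf) g (hG₀P hg) a ha h
  refine ⟨G, hG, hGP, fun k hk hk₀ => ?_⟩
  by_contra! hc
  -- Otherwise `k * g - g'` determines `(g, g')`, and the family of these elements has twice the
  -- dimension of `G`.
  have hfam : IsFamily L M (Set.image2 (fun g g' => k * g - g') G G) := by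
    refine hG.image2 hG (fun g g' => k * g - g')
      (θ := {x | x.1.1 = x.2.1 ∧ k x.2.2.1 - x.2.2.2 = x.1.2}) ?_ fun g _ g' _ u v => ?_
    · exact (DefSet.eq DefMap.id.fst.fst DefMap.id.snd.fst).and (DefSet.eq
        (((hdef k hk).comp DefMap.id.snd.snd.fst).sub DefMap.id.snd.snd.snd) DefMap.id.fst.snd)
    · constructor
      · intro h
        exact ⟨u, rfl, h⟩
      · rintro ⟨w, h, h'⟩
        obtain rfl : u = w := h
        exact h'
  have h2 := add_le_tdm_image (hG.typeDef_apply a) (hG.typeDef_apply a)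
    (hGne.image (fun g => g a)) (hGne.image (fun g => g a)) (f := fun p : U × U => k p.1 - p.2)
    (((hdef k hk).comp DefMap.id.fst).sub DefMap.id.snd) (by
      rintro ⟨_, _⟩ ⟨⟨g₁, hg₁, rfl⟩, g₃, hg₃, rfl⟩ ⟨_, _⟩ ⟨⟨g₂, hg₂, rfl⟩, g₄, hg₄, rfl⟩ h
      have h' : k (g₁ a) - g₃ a = k (g₂ a) - g₄ a := h
      have key : k * (g₁ - g₂) = g₃ - g₄ := by
        refine heq _ (P.mul_mem hk (P.sub_mem (hGP hg₁) (hGP hg₂))) _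
          (P.sub_mem (hGP hg₃) (hGP hg₄)) a ha ?_
        change k (g₁ a - g₂ a) = g₃ a - g₄ a
        rw [map_sub]
        exact sub_eq_sub_iff_sub_eq_sub.1 h'
      have h₁₂ : g₁ = g₂ := by
        by_contra hne
        exact hc g₁ hg₁ g₂ hg₂ g₃ hg₃ g₄ hg₄ hne key
      subst h₁₂
      rw [sub_self, mul_zero, eq_comm, sub_eq_zero] at key
      rw [key])
  have h3 : (fun p : U × U => k p.1 - p.2) '' (((fun g => g a) '' G) ×ˢ ((fun g => g a) '' G)) =
      (fun g => g a) '' Set.image2 (fun g g' => k * g - g') G G := by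
    ext v
    constructor
    · rintro ⟨⟨_, _⟩, ⟨⟨g, hg, rfl⟩, g', hg', rfl⟩, rfl⟩
      exact ⟨_, ⟨g, hg, g', hg', rfl⟩, rfl⟩
    · rintro ⟨_, ⟨g, hg, g', hg', rfl⟩, rfl⟩
      exact ⟨(g a, g' a), ⟨⟨g, hg, rfl⟩, g', hg', rfl⟩, rfl⟩
  rw [h3] at h2
  have := hmax _ ⟨hfam, by
    rintro _ ⟨g, hg, g', hg', rfl⟩
    exact P.sub_mem (P.mul_mem hk (hGP hg)) (hGP hg'), hGne.image2 hGne⟩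
  omega

/-- A ring of definable endomorphisms whose nonzero elements are injective, and which contains an
infinite type-definable family, consists of bijections and zero. -/
theorem surjective_of_domain (hdef : ∀ f ∈ P, DefMap L M f)
    (hinj : ∀ f ∈ P, ∀ a, f a = 0 → a ≠ 0 → f = 0)
    {G₀ : Set (AddMonoid.End U)} (hG₀ : IsFamily L M G₀)
    (hG₀P : G₀ ⊆ P) (hG₀inf : G₀.Infinite) :
    ∀ f ∈ P, f ≠ 0 → Function.Bijective f := by
  obtain ⟨G, hG, hGP, hfrac⟩ := exists_fraction_family hdef hinj hG₀ hG₀P hG₀inf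
  obtain ⟨a, ha⟩ : ∃ a : U, a ≠ 0 := by
    by_contra! hc
    exact hG₀inf (Set.Subsingleton.finite fun f _ g _ => by ext u; rw [hc (f u), hc (g u)])
  have hinj' : ∀ f ∈ P, f ≠ 0 → Function.Injective f := fun f hf hf₀ =>
    (injective_iff_map_eq_zero f).2 fun u hu => by
      by_contra hu'
      exact hf₀ (hinj f hf u hu hu')
  have hidx : ∀ f ∈ P, f ≠ 0 → (endRange f).index ≠ 0 := by
    intro f hf hf₀
    rw [← AddSubgroup.relIndex_top_right]
    have hrange : DefSet L M (endRange f : Set U) :=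
      ((DefSet.univ L M U).image (hdef f hf)).of_eq (by rw [Set.image_univ]; rfl)
    exact relIndex_ne_zero_of_dm_le hrange (DefSet.univ L M U) le_top
      (dm_le_of_injOn (DefSet.univ L M U) hrange (hdef f hf) (fun u _ => ⟨u, rfl⟩)
        (hinj' f hf hf₀).injOn)
  have hne : ∀ g ∈ G, ∀ g' ∈ G, g a ≠ g' a → g - g' ≠ 0 := fun g _ g' _ h h0 =>
    h (by rw [sub_eq_zero.1 h0])
  obtain ⟨N, hN⟩ := hG.exists_index_le (a := a) fun g hg g' hg' h =>
    hidx _ (P.sub_mem (hGP hg) (hGP hg')) (hne g hg g' hg' h)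
  -- As `k * (g₁ - g₂) = g₃ - g₄`, the image of `k` contains that of `g₃ - g₄`.
  have hbound : ∀ k, k ∈ P ∧ k ≠ 0 → (endRange k).index ≤ N := by
    rintro k ⟨hk, hk₀⟩
    obtain ⟨g₁, hg₁, g₂, hg₂, g₃, hg₃, g₄, hg₄, h₁₂, h⟩ := hfrac k hk hk₀
    have ha' : g₃ a ≠ g₄ a := by
      intro h0
      have h0' : k (g₁ a - g₂ a) = 0 := by
        have := DFunLike.congr_fun h a
        exact this.trans (sub_eq_zero.2 h0)
      have h1 := (injective_iff_map_eq_zero k).1 (hinj' k hk hk₀) _ h0'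
      exact h₁₂ (sub_eq_zero.1 (hinj _ (P.sub_mem (hGP hg₁) (hGP hg₂)) a h1 ha))
    refine le_trans (Nat.le_of_dvd (Nat.pos_of_ne_zero
      (hidx _ (P.sub_mem (hGP hg₃) (hGP hg₄)) (hne g₃ hg₃ g₄ hg₄ ha'))) ?_) (hN g₃ hg₃ g₄ hg₄ ha')
    refine AddSubgroup.index_dvd_of_le ?_
    rintro _ ⟨u, rfl⟩
    exact ⟨(g₁ - g₂) u, DFunLike.congr_fun h u⟩
  intro f hf hf₀
  -- the squares of the elements of largest index show that all indices are equal to one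
  obtain ⟨k, ⟨hk, hk₀⟩, hmax⟩ := exists_forall_le_nat (p := fun k => k ∈ P ∧ k ≠ 0)
    (fun k => (endRange k).index) ⟨f, hf, hf₀⟩ hbound
  have hkk : k * k ≠ 0 := by
    intro h0
    refine hk₀ (AddMonoidHom.ext fun u => ?_)
    exact hinj' k hk hk₀ (((DFunLike.congr_fun h0 u).trans rfl).trans (map_zero k).symm)
  have h1 : (endRange (k * k)).index =
      (endRange k).index * (endRange k).index := by
    rw [← AddSubgroup.index_map_of_injective _ (hinj' k hk hk₀)]
    congr 1
    ext v
    constructor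
    · rintro ⟨u, rfl⟩
      exact ⟨k u, ⟨u, rfl⟩, rfl⟩
    · rintro ⟨_, ⟨u, rfl⟩, rfl⟩
      exact ⟨u, rfl⟩
  have h2 := hmax (k * k) ⟨P.mul_mem hk hk, hkk⟩
  have h3 := hmax f ⟨hf, hf₀⟩
  have h4 := hidx k hk hk₀
  have h5 := hidx f hf hf₀
  have h6 : (endRange k).index = 1 := by
    rw [h1] at h2
    nlinarith [Nat.pos_of_ne_zero h4]
  have h7 : (endRange f).index = 1 := by omega
  refine ⟨hinj' f hf hf₀, AddMonoidHom.range_eq_top.1 (AddSubgroup.index_eq_one.1 h7)⟩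

/-- A ring of definable endomorphisms containing the inverses of its nonzero elements and an
infinite type-definable family is a type-definable family. -/
theorem isFamily_of_division (hdef : ∀ f ∈ P, DefMap L M f)
    (hdiv : ∀ f ∈ P, f ≠ 0 → ∃ g ∈ P, f * g = 1 ∧ g * f = 1) {G₀ : Set (AddMonoid.End U)}
    (hG₀ : IsFamily L M G₀) (hG₀P : G₀ ⊆ P) (hG₀inf : G₀.Infinite) :
    IsFamily L M (P : Set (AddMonoid.End U)) := by
  have hinj : ∀ f ∈ P, ∀ a, f a = 0 → a ≠ 0 → f = 0 := by
    intro f hf a hfa ha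
    by_contra hf₀
    obtain ⟨g, -, -, hg⟩ := hdiv f hf hf₀
    have h := DFunLike.congr_fun hg a
    have h' : g (f a) = a := h
    rw [hfa, map_zero] at h'
    exact ha h'.symm
  obtain ⟨a, ha⟩ : ∃ a : U, a ≠ 0 := by
    by_contra! hc
    exact hG₀inf (Set.Subsingleton.finite fun f _ g _ => by ext u; rw [hc (f u), hc (g u)])
  obtain ⟨G, hG, hGP, hfrac⟩ := exists_fraction_family hdef hinj hG₀ hG₀P hG₀inf
  have hD : IsFamily L M (Set.image2 (fun g g' => g - g') G G) := by
    refine hG.image2 hG (fun g g' => g - g')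
      (θ := {x | x.1.1 = x.2.1 ∧ x.2.2.1 - x.2.2.2 = x.1.2}) ?_ fun g _ g' _ u v => ?_
    · exact (DefSet.eq DefMap.id.fst.fst DefMap.id.snd.fst).and (DefSet.eq
        (DefMap.id.snd.snd.fst.sub DefMap.id.snd.snd.snd) DefMap.id.fst.snd)
    · constructor
      · intro h
        exact ⟨u, rfl, h⟩
      · rintro ⟨w, h, h'⟩
        obtain rfl : u = w := h
        exact h'
  have hDP : ∀ f ∈ Set.image2 (fun g g' => g - g') G G, f ∈ P := by
    rintro _ ⟨g, hg, g', hg', rfl⟩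
    exact P.sub_mem (hGP hg) (hGP hg')
  -- `P` consists of the `g * f⁻¹` for differences `f`, `g` of members of `G` with `f a ≠ 0`.
  choose! inv hinvP hinv hinv' using hdiv
  have hfam := (hD.sep_apply_ne_zero a).image2 hD (fun f g => g * inv f)
      (θ := {x | x.2.2.1 = x.1.1 ∧ x.2.2.2 = x.1.2}) ((DefSet.eq DefMap.id.snd.snd.fst
        DefMap.id.fst.fst).and (DefSet.eq DefMap.id.snd.snd.snd DefMap.id.fst.snd)) (by
      rintro f ⟨hf, hfa⟩ g hg u v
      have hf₀ : f ≠ 0 := fun h => hfa (by rw [h]; rfl)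
      constructor
      · intro h
        exact ⟨inv f u, DFunLike.congr_fun (hinv f (hDP f hf) hf₀) u, h⟩
      · rintro ⟨w, h, h'⟩
        obtain rfl : f w = u := h
        have := DFunLike.congr_fun (hinv' f (hDP f hf) hf₀) w
        have h'' : inv f (f w) = w := this
        change g (inv f (f w)) = v
        rw [h'']
        exact h')
  convert hfam using 1
  refine Set.Subset.antisymm (fun k hk => ?_) ?_
  · by_cases hk₀ : k = 0
    · obtain ⟨f, hf, hf₀⟩ : ∃ f ∈ G₀, f ≠ 0 := by
        by_contra! hc
        exact hG₀inf ((Set.finite_singleton 0).subset hc)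
      obtain ⟨g₁, hg₁, g₂, hg₂, -, -, -, -, h, -⟩ := hfrac f (hG₀P hf) hf₀
      refine ⟨g₁ - g₂, ⟨⟨g₁, hg₁, g₂, hg₂, rfl⟩, fun h0 => h ?_⟩, g₁ - g₁,
        ⟨g₁, hg₁, g₁, hg₁, rfl⟩, ?_⟩
      · exact sub_eq_zero.1 (hinj _ (P.sub_mem (hGP hg₁) (hGP hg₂)) a h0 ha)
      · simp [hk₀]
    · obtain ⟨g₁, hg₁, g₂, hg₂, g₃, hg₃, g₄, hg₄, h₁₂, h⟩ := hfrac k hk hk₀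
      have hP := P.sub_mem (hGP hg₁) (hGP hg₂)
      have hne : g₁ - g₂ ≠ 0 := sub_ne_zero.2 h₁₂
      refine ⟨g₁ - g₂, ⟨⟨g₁, hg₁, g₂, hg₂, rfl⟩, fun h0 => hne (hinj _ hP a h0 ha)⟩, g₃ - g₄,
        ⟨g₃, hg₃, g₄, hg₄, rfl⟩, ?_⟩
      dsimp only
      rw [← h, mul_assoc, hinv _ hP hne, mul_one]
  · rintro _ ⟨f, ⟨hf, hfa⟩, g, hg, rfl⟩
    have hf₀ : f ≠ 0 := fun h => hfa (by rw [h]; rfl)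
    exact P.mul_mem (hDP g hg) (hinvP f (hDP f hf) hf₀)

end Domain

end Families

/-! ### Commutativity and centres of division rings -/

section Algebra

/-- An endomorphism `T` of a vector space over a finite field with `q` elements such that
`T ^ q = T ≠ 0` has a nonzero eigenvalue. -/
theorem exists_eigenvalue_of_pow_card {k E : Type*} [Field k] [Fintype k] [AddCommGroup E]
    [Module k E] {T : Module.End k E} (hT : T ^ Fintype.card k = T) (hT₀ : T ≠ 0) :
    ∃ c : k, c ≠ 0 ∧ ∃ h : E, h ≠ 0 ∧ T h = c • h := by
  classical
  by_contra! hc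
  have hinj : ∀ s : Finset k, 0 ∉ s → Function.Injective
      (Polynomial.aeval T (∏ c ∈ s, (Polynomial.X - Polynomial.C c))) := by
    intro s
    induction s using Finset.induction_on with
    | empty =>
      intro _ a b hab
      simpa using hab
    | insert c s hcs ih =>
      intro h0
      rw [Finset.prod_insert hcs, map_mul]
      have h₁ : Function.Injective (Polynomial.aeval T (Polynomial.X - Polynomial.C c)) := by
        refine (injective_iff_map_eq_zero _).2 fun h hh => ?_
        by_contra hh₀
        refine hc c (fun h => h0 (h ▸ Finset.mem_insert_self c s)) h hh₀ ?_
        simpa [sub_eq_zero, Module.algebraMap_end_apply] using hh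
      exact h₁.comp (ih fun h => h0 (Finset.mem_insert_of_mem h))
  -- `X ^ q - X` is the product of the `X - c` over the elements `c` of `k`; without nonzero
  -- eigenvalues, all factors but `X` are injective at `T`.
  have hprod : (Polynomial.X ^ Fintype.card k - Polynomial.X : Polynomial k) =
      (∏ c ∈ Finset.univ.erase 0, (Polynomial.X - Polynomial.C c)) * Polynomial.X := by
    have hq := Fintype.one_lt_card (α := k)
    have hmonic : (Polynomial.X ^ Fintype.card k - Polynomial.X : Polynomial k).Monic :=
      (Polynomial.monic_X_pow _).sub_of_left (by
        rw [Polynomial.degree_X_pow, Polynomial.degree_X]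
        exact_mod_cast hq)
    rw [← Polynomial.prod_multiset_X_sub_C_of_monic_of_roots_card_eq hmonic,
      FiniteField.roots_X_pow_card_sub_X]
    · change ∏ c, (Polynomial.X - Polynomial.C c) = _
      rw [← Finset.prod_erase_mul _ _ (Finset.mem_univ (0 : k))]
      simp
    · rw [FiniteField.roots_X_pow_card_sub_X, FiniteField.X_pow_card_sub_X_natDegree_eq _ hq]
      rfl
  refine hT₀ (LinearMap.ext fun h => ?_)
  refine hinj (Finset.univ.erase 0) (Finset.notMem_erase _ _) ?_
  have := congrArg (Polynomial.aeval T) hprod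
  rw [map_mul, map_sub, map_pow, Polynomial.aeval_X, hT, sub_self] at this
  have h' := DFunLike.congr_fun this h
  simpa using h'.symm

theorem commute_of_finite {D : Type*} [DivisionRing D] (S : Subring D) (hS : (S : Set D).Finite)
    {x y : D} (hx : x ∈ S) (hy : y ∈ S) : x * y = y * x := by
  have : Finite S := hS.to_subtype
  have := (Finite.isDomain_to_isField S).mul_comm ⟨x, hx⟩ ⟨y, hy⟩
  exact Subtype.ext_iff.1 this

/-- An element `h` of finite order normalizing a finite subring generates with it a finite
subring. -/
theorem exists_finite_subring {D : Type*} [DivisionRing D] (C : Subring D)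
    (hC : (C : Set D).Finite) {h : D} {m : ℕ} (hm : m ≠ 0) (hhm : h ^ m = 1)
    (hconj : ∀ c ∈ C, ∃ c' ∈ C, h * c = c' * h) :
    ∃ S : Subring D, (S : Set D).Finite ∧ C ≤ S ∧ h ∈ S := by
  have : NeZero m := ⟨hm⟩
  have := hC.to_subtype
  -- The subring is the set of the sums `∑ i < m, c i * h ^ i` with `c i ∈ C`.
  let A : AddSubgroup D := AddMonoidHom.range
    (∑ i : Fin m, (AddMonoidHom.mulRight (h ^ (i : ℕ))).comp
      ((C.subtype : C →+* D).toAddMonoidHom.comp (Pi.evalAddMonoidHom (fun _ : Fin m => C) i)))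
  have hA : (A : Set D).Finite := Set.finite_range _
  have hmem : ∀ c ∈ C, ∀ i : ℕ, c * h ^ i ∈ A := by
    intro c hc i
    refine ⟨Pi.single (Fin.ofNat m i) ⟨c, hc⟩, ?_⟩
    rw [AddMonoidHom.finsetSum_apply, Finset.sum_eq_single (Fin.ofNat m i)]
    · simp only [AddMonoidHom.coe_comp, Function.comp_apply, Pi.evalAddMonoidHom_apply,
        Pi.single_eq_same, AddMonoidHom.mulRight_apply]
      change c * h ^ (i % m) = c * h ^ i
      conv_rhs => rw [← Nat.mod_add_div i m, pow_add, pow_mul, hhm, one_pow, mul_one]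
    · intro j _ hj
      change (((Pi.single (Fin.ofNat m i) ⟨c, hc⟩ : Fin m → C) j : C) : D) * h ^ (j : ℕ) = 0
      rw [Pi.single_eq_of_ne hj]
      simp
    · simp
  have hpow : ∀ i : ℕ, ∀ c ∈ C, ∃ c' ∈ C, h ^ i * c = c' * h ^ i := by
    intro i
    induction i with
    | zero => exact fun c hc => ⟨c, hc, by simp⟩
    | succ i ih =>
      intro c hc
      obtain ⟨c₁, hc₁, h₁⟩ := hconj c hc
      obtain ⟨c₂, hc₂, h₂⟩ := ih c₁ hc₁
      exact ⟨c₂, hc₂, by rw [pow_succ, mul_assoc, h₁, ← mul_assoc, h₂, mul_assoc]⟩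
  have hspan : ∀ a ∈ A, ∃ f : Fin m → C, a = ∑ i, (f i : D) * h ^ (i : ℕ) := by
    rintro _ ⟨f, rfl⟩
    exact ⟨f, by simp [AddMonoidHom.finsetSum_apply]⟩
  have h1 : ∀ c ∈ C, c ∈ A := fun c hc => by simpa using hmem c hc 0
  have h2 : h ∈ A := by simpa using hmem 1 C.one_mem 1
  have h3 : ∀ {a b}, a ∈ A → b ∈ A → a * b ∈ A := ?_
  · exact ⟨{ A with one_mem' := h1 1 C.one_mem, mul_mem' := h3 }, hA, h1, h2⟩
  intro a b ha hb
  obtain ⟨f, rfl⟩ := hspan a ha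
  obtain ⟨g, rfl⟩ := hspan b hb
  rw [Finset.sum_mul_sum]
  refine sum_mem fun i _ => sum_mem fun j _ => ?_
  obtain ⟨c', hc', h'⟩ := hpow i (g j) (g j).2
  have : (f i : D) * h ^ (i : ℕ) * (g j * h ^ (j : ℕ)) = (f i * c') * h ^ ((i : ℕ) + j) := by
    rw [mul_assoc, ← mul_assoc (h ^ (i : ℕ)), h', pow_add]
    simp only [mul_assoc]
  rw [this]
  exact hmem _ (C.mul_mem (f i).2 hc') _

/-- A division ring in which the centralizers of the noncentral elements are finite is
commutative: over the finite field `C` centralizing a noncentral `x`, the map `h ↦ x * h - h * x`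
has a nonzero eigenvector, which generates with `C` a finite, hence commutative, subring. -/
theorem commutative_of_finite_centralizer {D : Type*} [DivisionRing D]
    (hD : ∀ x : D, (∃ y, x * y ≠ y * x) → {y | x * y = y * x}.Finite) (x y : D) :
    x * y = y * x := by
  by_contra hxy
  let C : Subring D := Subring.centralizer {x}
  have hCmem : ∀ z, z ∈ C ↔ x * z = z * x := fun z => by
    simp [C, Subring.mem_centralizer_iff]
  have hCset : (C : Set D) = {y | x * y = y * x} := by
    ext z
    exact hCmem z
  have hC : (C : Set D).Finite := hCset ▸ hD x ⟨y, hxy⟩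
  have : Finite C := hC.to_subtype
  have := Fintype.ofFinite C
  let _ : Field C := (Finite.isDomain_to_isField C).toField
  let x' : C := ⟨x, (hCmem x).2 rfl⟩
  let T : Module.End C D := algebraMap C (Module.End C D) x' - LinearMap.mulRight C x
  have hT : ∀ h, T h = x * h - h * x := fun h => rfl
  -- `T` is the difference of two commuting operators, and Frobenius is additive.
  have hTpow : T ^ Fintype.card C = T := by
    obtain ⟨p, hp⟩ := CharP.exists C
    obtain ⟨n, hprime, hn⟩ := FiniteField.card C p
    have : Fact p.Prime := ⟨hprime⟩
    have : CharP (Module.End C D) p := charP_of_injective_algebraMap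
      (algebraMap C (Module.End C D)).injective p
    rw [hn, sub_pow_char_pow_of_commute _ _ (Algebra.commutes _ _), ← map_pow, ← hn,
      FiniteField.pow_card, LinearMap.pow_mulRight]
    congr 2
    have := congrArg Subtype.val (FiniteField.pow_card x')
    exact this
  have hT₀ : T ≠ 0 := by
    intro h0
    have := DFunLike.congr_fun h0 y
    exact hxy (sub_eq_zero.1 this)
  obtain ⟨c, hc, h, hh, hch⟩ := exists_eigenvalue_of_pow_card hTpow hT₀
  have hch' : x * h - h * x = c * h := hch
  have hne : h * x ≠ x * h := by
    intro h0
    rw [h0, sub_self] at hch'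
    rcases mul_eq_zero.1 hch'.symm with h1 | h1
    · exact hc (Subtype.ext h1)
    · exact hh h1
  -- As `h * x = (x - c) * h`, and `x` and `x - c` have the same centralizer, `h` normalizes `C`.
  have hconj' : ∀ w ∈ C, h⁻¹ * w * h ∈ C := by
    intro w hw
    have h1 : h * x = (x - c) * h := by rw [sub_mul, ← hch']; abel
    have h2 : x * h⁻¹ = h⁻¹ * (x - c) := by
      rw [eq_inv_mul_iff_mul_eq₀ hh, ← mul_assoc, h1, mul_assoc, mul_inv_cancel₀ hh, mul_one]
    have h3 : (x - c) * w = w * (x - c) :=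
      congrArg Subtype.val (mul_comm (x' - c) ⟨w, hw⟩)
    rw [hCmem]
    calc x * (h⁻¹ * w * h) = h⁻¹ * ((x - c) * w) * h := by
          rw [← mul_assoc, ← mul_assoc, h2, mul_assoc h⁻¹]
      _ = h⁻¹ * w * ((x - c) * h) := by rw [h3]; simp only [mul_assoc]
      _ = h⁻¹ * w * h * x := by rw [← h1]; simp only [mul_assoc]
  have hconj : ∀ z ∈ C, ∃ w ∈ C, h * z = w * h := by
    have hinj : Function.Injective fun w : C => (⟨h⁻¹ * w * h, hconj' w w.2⟩ : C) := by
      intro w w' hw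
      have hw' : h⁻¹ * (w : D) * h = h⁻¹ * w' * h := congrArg Subtype.val hw
      exact Subtype.ext (mul_left_cancel₀ (inv_ne_zero hh) (mul_right_cancel₀ hh hw'))
    intro z hz
    obtain ⟨w, hw⟩ := Finite.surjective_of_injective hinj ⟨z, hz⟩
    have hw' : h⁻¹ * (w : D) * h = z := congrArg Subtype.val hw
    refine ⟨w, w.2, ?_⟩
    rw [← hw', mul_assoc, mul_inv_cancel_left₀ hh]
  -- `h` is noncentral, so its centralizer, which contains its powers, is finite.
  obtain ⟨m, hm, hhm⟩ : ∃ m, m ≠ 0 ∧ h ^ m = 1 := by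
    have := (hD h ⟨x, hne⟩).to_subtype
    obtain ⟨i, j, hij, hpow⟩ := Finite.exists_ne_map_eq_of_infinite
      fun i : ℕ => (⟨h ^ i, (Commute.self_pow h i).eq⟩ : {y | h * y = y * h})
    have hpow' : h ^ i = h ^ j := congrArg Subtype.val hpow
    rcases lt_or_gt_of_ne hij with hlt | hlt
    · refine ⟨j - i, by omega, mul_left_cancel₀ (pow_ne_zero i hh) ?_⟩
      rw [← pow_add, Nat.add_sub_cancel' hlt.le, mul_one, hpow']
    · refine ⟨i - j, by omega, mul_left_cancel₀ (pow_ne_zero j hh) ?_⟩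
      rw [← pow_add, Nat.add_sub_cancel' hlt.le, mul_one, hpow']
  obtain ⟨S, hS, hCS, hhS⟩ := exists_finite_subring C hC hm hhm hconj
  exact hne (commute_of_finite S hS hhS (hCS x'.2))

/-- The Artin-Whaples independence: elements `g i` of a division ring that are linearly independent
over the centre satisfy no nontrivial identity `∑ i, a i * f * g i = 0`. -/
theorem eq_zero_of_forall_sum_mul {F ι : Type*} [DivisionRing F] {g : ι → F}
    (hg : LinearIndependent (Subring.center F) g) (s : Finset ι) :
    ∀ a : ι → F, (∀ f, ∑ i ∈ s, a i * f * g i = 0) → ∀ i ∈ s, a i = 0 := by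
  classical
  induction s using Finset.induction_on with
  | empty => simp
  | insert j s hjs ih =>
    intro a ha
    by_cases haj : a j = 0
    · refine Finset.forall_mem_insert _ _ _ |>.2 ⟨haj, ih a fun f => ?_⟩
      have := ha f
      rwa [Finset.sum_insert hjs, haj, zero_mul, zero_mul, zero_add] at this
    exfalso
    let b : ι → F := fun i => (a j)⁻¹ * a i
    have hbj : b j = 1 := inv_mul_cancel₀ haj
    have hb : ∀ f, ∑ i ∈ insert j s, b i * f * g i = 0 := by
      intro f
      have : ∑ i ∈ insert j s, b i * f * g i = (a j)⁻¹ * ∑ i ∈ insert j s, a i * f * g i := by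
        rw [Finset.mul_sum]
        exact Finset.sum_congr rfl fun i _ => by simp only [b, mul_assoc]
      rw [this, ha f, mul_zero]
    -- Comparing the identity at `c * f` with `c` times the identity at `f` removes the term of
    -- `j`, so by induction the coefficients `b i` are central.
    have hcomm : ∀ i ∈ s, b i ∈ Subring.center F := by
      intro i hi
      refine Subring.mem_center_iff.2 fun c => ?_
      have := ih (fun i => c * b i - b i * c) (fun f => ?_) i hi
      · exact sub_eq_zero.1 this
      · have h₁ := hb (c * f)
        have h₂ := congrArg (c * ·) (hb f)
        simp only [Finset.sum_insert hjs, hbj, mul_add, Finset.mul_sum, mul_zero] at h₁ h₂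
        have h₃ := sub_eq_zero.2 (h₂.trans h₁.symm)
        rw [one_mul, one_mul, ← mul_assoc, add_sub_add_left_eq_sub, ← Finset.sum_sub_distrib] at h₃
        rw [← h₃]
        exact Finset.sum_congr rfl fun i _ => by simp only [sub_mul, mul_assoc]
    have hmem : ∀ i ∈ insert j s, b i ∈ Subring.center F := by
      intro i hi
      rcases Finset.mem_insert.1 hi with rfl | hi
      · rw [hbj]
        exact Subring.one_mem _
      · exact hcomm i hi
    have hind := linearIndependent_iff'.1 hg (insert j s)
      (fun i => if h : b i ∈ Subring.center F then ⟨b i, h⟩ else 0) ?_ j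
      (Finset.mem_insert_self j s)
    · rw [dif_pos (hmem j (Finset.mem_insert_self j s))] at hind
      have h0 : b j = 0 := Subtype.ext_iff.1 hind
      exact one_ne_zero (hbj.symm.trans h0)
    · rw [← hb 1]
      refine Finset.sum_congr rfl fun i hi => ?_
      rw [dif_pos (hmem i hi), mul_one]
      rfl

/-- A division ring of finite dimension over a commutative subfield has finite dimension over its
centre. -/
theorem finite_center {k F : Type*} [Field k] [DivisionRing F] [Module k F] [IsScalarTower k F F]
    [Module.Finite k F] : Module.Finite (Subring.center F) F := by
  let b := Module.Basis.ofVectorSpace (Subring.center F) F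
  -- Elements independent over the centre give right multiplications independent over `k`.
  have hind : LinearIndependent k fun i => LinearMap.mulRight k (b i) := by
    refine linearIndependent_iff'.2 fun s c hc i hi => ?_
    have := eq_zero_of_forall_sum_mul b.linearIndependent s
      (fun i => c i • (1 : F)) (fun f => ?_) i hi
    · exact (smul_eq_zero.1 this).resolve_right one_ne_zero
    · have h := DFunLike.congr_fun hc f
      rw [LinearMap.zero_apply, LinearMap.sum_apply] at h
      rw [← h]
      refine Finset.sum_congr rfl fun i _ => ?_
      simp [smul_mul_assoc]
  have := hind.finite
  exact Module.Finite.of_basis b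

end Algebra

/-! ### Type-definable division rings of endomorphisms -/

section Division

variable {L : FirstOrder.Language.{u, v}} {M : Type w} [L.Structure M] [Tame L M]
variable {U : Type w} [Coded L M U] [AddCommGroup U] [DefAdd L M U]
variable {P : Subring (AddMonoid.End U)}

/-- The subring contains the inverses of its nonzero elements. -/
def IsDivision {R : Type*} [Ring R] (P : Subring R) : Prop :=
  ∀ f ∈ P, f ≠ 0 → ∃ g ∈ P, f * g = 1 ∧ g * f = 1

theorem IsDivision.eq_zero (hdiv : IsDivision P) {f : AddMonoid.End U} (hf : f ∈ P) {a : U}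
    (ha : a ≠ 0) (hfa : f a = 0) : f = 0 := by
  by_contra hf₀
  obtain ⟨g, -, -, hg⟩ := hdiv f hf hf₀
  have h : g (f a) = a := DFunLike.congr_fun hg a
  rw [hfa, map_zero] at h
  exact ha h.symm

theorem IsDivision.eq_of_apply_eq (hdiv : IsDivision P) {f g : AddMonoid.End U} (hf : f ∈ P)
    (hg : g ∈ P) {a : U} (ha : a ≠ 0) (h : f a = g a) : f = g :=
  sub_eq_zero.1 (hdiv.eq_zero (P.sub_mem hf hg) ha (sub_eq_zero.2 h))

theorem IsDivision.mem_of_smul_mem (hdiv : IsDivision P) {N : Submodule P U} {f : AddMonoid.End U}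
    (hf : f ∈ P) (hf₀ : f ≠ 0) {u : U} (h : f u ∈ N) : u ∈ N := by
  obtain ⟨g, hg, -, hgf⟩ := hdiv f hf hf₀
  have h' : g (f u) = u := DFunLike.congr_fun hgf u
  rw [← h']
  exact N.smul_mem (⟨g, hg⟩ : P) h

theorem exists_ne_zero_of_infinite (hinf : (P : Set (AddMonoid.End U)).Infinite) :
    ∃ a : U, a ≠ 0 := by
  by_contra! hc
  exact hinf (Set.Subsingleton.finite fun f _ g _ => by ext u; rw [hc (f u), hc (g u)])

theorem coe_span_insert [DecidableEq U] (s : Finset U) (u : U) :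
    ((Submodule.span P ((insert u s : Finset U) : Set U) : Submodule P U) : Set U) =
      (fun p : U × U => p.1 + p.2) '' (((fun f : AddMonoid.End U => f u) '' (P : Set _)) ×ˢ
        (Submodule.span P (s : Set U) : Set U)) := by
  ext v
  rw [Finset.coe_insert, SetLike.mem_coe, Submodule.mem_span_insert]
  constructor
  · rintro ⟨f, z, hz, rfl⟩
    exact ⟨(f • u, z), ⟨⟨f.1, f.2, rfl⟩, hz⟩, rfl⟩
  · rintro ⟨⟨_, z⟩, ⟨⟨f, hf, rfl⟩, hz⟩, rfl⟩
    exact ⟨⟨f, hf⟩, z, hz, rfl⟩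

theorem typeDef_span (hP : IsFamily L M (P : Set (AddMonoid.End U))) (s : Finset U) :
    TypeDef L M (Submodule.span P (s : Set U) : Set U) := by
  classical
  induction s using Finset.induction_on with
  | empty =>
    refine ((DefSet.singleton (L := L) (M := M) (0 : U)).typeDef).of_eq ?_
    simp
  | insert u s _ ih =>
    rw [coe_span_insert]
    exact ((hP.typeDef_apply u).prod ih).image (DefMap.id.fst.add DefMap.id.snd)

/-- Adding an independent vector to a finite set increases the dimension of its span, which is the
injective image of the product of a line and the span of the set. -/
theorem lt_tdm_span_insert [DecidableEq U] (hP : IsFamily L M (P : Set (AddMonoid.End U)))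
    (hdiv : IsDivision P) (hinf : (P : Set (AddMonoid.End U)).Infinite) {s : Finset U} {u : U}
    (hu : u ∉ Submodule.span P (s : Set U)) :
    tdm L M (Submodule.span P (s : Set U) : Set U) <
      tdm L M (Submodule.span P ((insert u s : Finset U) : Set U) : Set U) := by
  have hu₀ : u ≠ 0 := fun h => hu (h ▸ Submodule.zero_mem _)
  have h := add_le_tdm_image (hP.typeDef_apply u) (typeDef_span hP s) ⟨_, 0, P.zero_mem, rfl⟩
    ⟨0, Submodule.zero_mem _⟩ (f := fun p : U × U => p.1 + p.2)
    (DefMap.id.fst.add DefMap.id.snd) (by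
      rintro ⟨_, z⟩ ⟨⟨f, hf, rfl⟩, hz⟩ ⟨_, z'⟩ ⟨⟨g, hg, rfl⟩, hz'⟩ h
      have h' : f u + z = g u + z' := h
      have hfg : f = g := by
        by_contra hne
        refine hu (hdiv.mem_of_smul_mem (P.sub_mem hf hg) (sub_ne_zero.2 hne) ?_)
        have : (f - g) u = z' - z := by
          change f u - g u = z' - z
          rw [sub_eq_sub_iff_add_eq_add, h', add_comm]
        rw [this]
        exact Submodule.sub_mem _ hz' hz
      subst hfg
      rw [add_left_cancel h'])
  rw [← coe_span_insert] at h
  have h1 : 1 ≤ tdm L M ((fun f : AddMonoid.End U => f u) '' (P : Set _)) :=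
    one_le_tdm (hinf.image fun f hf g hg h => hdiv.eq_of_apply_eq hf hg hu₀ h)
  omega

/-- The group has finite dimension over an infinite type-definable division ring of
endomorphisms. -/
theorem IsDivision.finite (hP : IsFamily L M (P : Set (AddMonoid.End U)))
    (hdiv : IsDivision P) (hinf : (P : Set (AddMonoid.End U)).Infinite) : Module.Finite P U := by
  classical
  obtain ⟨s, -, hmax⟩ := exists_forall_le_nat (p := fun _ : Finset U => True)
    (fun s : Finset U => tdm L M (Submodule.span P (s : Set U) : Set U)) ⟨∅, trivial⟩
    (fun s _ => tdm_le_dm_univ _)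
  refine ⟨⟨s, eq_top_iff.2 fun u _ => ?_⟩⟩
  by_contra hu
  exact (lt_tdm_span_insert hP hdiv hinf hu).not_ge (hmax _ trivial)

/-- The line spanned by a nonzero vector over an infinite type-definable division ring of
endomorphisms is definable, because it has a type-definable complement. -/
theorem defSet_line (hP : IsFamily L M (P : Set (AddMonoid.End U)))
    (hdiv : IsDivision P) (hinf : (P : Set (AddMonoid.End U)).Infinite) {a : U} (ha : a ≠ 0) :
    DefSet L M ((fun f : AddMonoid.End U => f a) '' (P : Set (AddMonoid.End U))) := by
  classical
  obtain ⟨s, hs, hmax⟩ := exists_forall_le_nat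
    (p := fun s : Finset U => a ∉ Submodule.span P (s : Set U))
    (fun s : Finset U => tdm L M (Submodule.span P (s : Set U) : Set U))
    ⟨∅, by simpa using ha⟩ (fun s _ => tdm_le_dm_univ _)
  refine (hP.typeDef_apply a).defSet ?_
  -- For a span `N` maximal among those avoiding `a`, the complement of the line consists of the
  -- sums of a multiple of `a` and a nonzero element of `N`.
  have hc := ((hP.typeDef_apply a).prod ((typeDef_span hP s).inter
    (DefSet.singleton (L := L) (M := M) (0 : U)).compl.typeDef)).image
      (f := fun p : U × U => p.1 + p.2) (DefMap.id.fst.add DefMap.id.snd)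
  refine hc.of_eq (Set.Subset.antisymm ?_ ?_)
  · rintro _ ⟨⟨_, c⟩, ⟨⟨f, hf, rfl⟩, hc, hc₀⟩, rfl⟩ ⟨g, hg, h⟩
    have h' : g a = f a + c := h
    have hgf : g - f ≠ 0 := fun h0 => hc₀ (by
      rw [sub_eq_zero.1 h0] at h'
      simpa using h')
    refine hs (hdiv.mem_of_smul_mem (P.sub_mem hg hf) hgf ?_)
    have : (g - f) a = c := by
      change g a - f a = c
      rw [h', add_sub_cancel_left]
    rwa [this]
  · intro u hu
    by_cases hus : u ∈ Submodule.span P (s : Set U)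
    · refine ⟨(0, u), ⟨⟨0, P.zero_mem, rfl⟩, hus, fun h0 => hu ?_⟩, zero_add u⟩
      exact ⟨0, P.zero_mem, (Set.mem_singleton_iff.1 h0).symm⟩
    · have hmem : a ∈ Submodule.span P ((insert u s : Finset U) : Set U) := by
        by_contra hmem
        exact (lt_tdm_span_insert hP hdiv hinf hus).not_ge (hmax _ hmem)
      rw [Finset.coe_insert, Submodule.mem_span_insert] at hmem
      obtain ⟨f, z, hz, haz⟩ := hmem
      have hf₀ : f.1 ≠ 0 := by
        intro h0
        refine hs ?_
        rw [haz]
        refine Submodule.add_mem _ ?_ hz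
        have : f • u = 0 := by
          change f.1 u = 0
          rw [h0]; rfl
        rw [this]
        exact Submodule.zero_mem _
      obtain ⟨g, hg, -, hgf⟩ := hdiv f.1 f.2 hf₀
      have hgf' : g (f.1 u) = u := DFunLike.congr_fun hgf u
      have hfu : f.1 u = a - z := eq_sub_of_add_eq haz.symm
      refine ⟨(g a, -g z), ⟨⟨g, hg, rfl⟩, Submodule.neg_mem _
        (Submodule.smul_mem _ (⟨g, hg⟩ : P) hz), fun h0 => hu ⟨g, hg, ?_⟩⟩, ?_⟩
      · have h0' : g z = 0 := by simpa using h0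
        change g a = u
        rw [← hgf', hfu, map_sub, h0', sub_zero]
      · change g a + -g z = u
        rw [← sub_eq_add_neg, ← map_sub, ← hfu, hgf']

/-- The graph of the action of an infinite type-definable division ring of endomorphisms is
definable, an element `f` being given by its value at a nonzero vector `a`. -/
theorem defSet_action (hP : IsFamily L M (P : Set (AddMonoid.End U)))
    (hdiv : IsDivision P) (hinf : (P : Set (AddMonoid.End U)).Infinite) {a : U} (ha : a ≠ 0) :
    DefSet L M {x : U × (U × U) | ∃ f ∈ P, f a = x.1 ∧ f x.2.1 = x.2.2} := by
  have hE := hP.typeDef_eval a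
  refine hE.defSet ?_
  have h₁ : TypeDef L M {x : U × (U × U) | x.1 ∉
      (fun f : AddMonoid.End U => f a) '' (P : Set (AddMonoid.End U))} :=
    ((defSet_line hP hdiv hinf ha).mem DefMap.id.fst).not.typeDef
  have h₂ : TypeDef L M {x : U × (U × U) | ∃ v, (x.1, (x.2.1, v)) ∈
      {x : U × (U × U) | ∃ f ∈ (P : Set (AddMonoid.End U)), f a = x.1 ∧ f x.2.1 = x.2.2} ∧
      v ≠ x.2.2} := by
    refine TypeDef.exists (p := fun (x : U × (U × U)) v => (x.1, (x.2.1, v)) ∈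
      {x : U × (U × U) | ∃ f ∈ (P : Set (AddMonoid.End U)), f a = x.1 ∧ f x.2.1 = x.2.2} ∧
      v ≠ x.2.2) ?_
    exact (hE.preimage (DefMap.id.fst.fst.prodMk
      (DefMap.id.fst.snd.fst.prodMk DefMap.id.snd))).inter
      (DefSet.eq DefMap.id.snd DefMap.id.fst.snd.snd).not.typeDef
  -- The complement is type-definable too: the first entry is not on the line of `a`, or the
  -- action of the element it determines has another value.
  refine (h₁.union h₂).of_eq (Set.Subset.antisymm ?_ ?_)
  · rintro x (hx | ⟨v, ⟨f, hf, h, h'⟩, hv⟩) ⟨g, hg, hga, hgx⟩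
    · exact hx ⟨g, hg, hga⟩
    · have hfg : f = g := hdiv.eq_of_apply_eq hf hg ha (h.trans hga.symm)
      subst hfg
      exact hv (h'.symm.trans hgx)
  · intro x hx
    by_cases hxa : x.1 ∈ (fun f : AddMonoid.End U => f a) '' (P : Set (AddMonoid.End U))
    · obtain ⟨f, hf, h⟩ := hxa
      exact Or.inr ⟨f x.2.1, ⟨f, hf, h, rfl⟩, fun h' => hx ⟨f, hf, h, h'⟩⟩
    · exact Or.inl hxa

/-! ### The centre of a type-definable division ring -/

/-- The centralizer of a finite set in `P`. -/
def centralizerIn (P : Subring (AddMonoid.End U)) (E : Finset (AddMonoid.End U)) :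
    Subring (AddMonoid.End U) := P ⊓ Subring.centralizer (E : Set (AddMonoid.End U))

theorem mem_centralizerIn {E : Finset (AddMonoid.End U)} {f : AddMonoid.End U} :
    f ∈ centralizerIn P E ↔ f ∈ P ∧ ∀ g ∈ E, g * f = f * g := by
  simp [centralizerIn, Subring.mem_centralizer_iff]

theorem IsDivision.centralizerIn (hdiv : IsDivision P) (E : Finset (AddMonoid.End U)) :
    IsDivision (centralizerIn P E) := by
  intro f hf hf₀
  rw [mem_centralizerIn] at hf
  obtain ⟨g, hg, h, h'⟩ := hdiv f hf.1 hf₀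
  refine ⟨g, mem_centralizerIn.2 ⟨hg, fun e he => ?_⟩, h, h'⟩
  calc e * g = (g * f) * (e * g) := by rw [h', one_mul]
    _ = g * (e * f) * g := by rw [hf.2 e he]; simp only [mul_assoc]
    _ = g * e := by rw [mul_assoc, mul_assoc, h, mul_one]

omit [DefAdd L M U] in
theorem IsFamily.centralizerIn (hP : IsFamily L M (P : Set (AddMonoid.End U)))
    (hdef : ∀ f ∈ P, DefMap L M f) (E : Finset (AddMonoid.End U))
    (hE : (E : Set (AddMonoid.End U)) ⊆ P) :
    IsFamily L M (centralizerIn P E : Set (AddMonoid.End U)) := by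
  classical
  induction E using Finset.induction_on with
  | empty =>
    convert hP using 1
    ext f
    simp [mem_centralizerIn]
  | insert e E _ ih =>
    rw [Finset.coe_insert, Set.insert_subset_iff] at hE
    convert (ih hE.2).sep_commute (hdef e hE.1) using 1
    ext f
    simp only [SetLike.mem_coe, mem_centralizerIn, Finset.forall_mem_insert, Set.mem_ofPred_eq]
    rw [eq_comm (a := f * e)]
    tauto

variable (L M) in
/-- An infinite type-definable division ring of definable endomorphisms has an infinite commutative
type-definable division subring: an infinite centralizer of least dimension, in which the
centralizers of the noncentral elements are finite. -/
theorem exists_commutative (hP : IsFamily L M (P : Set (AddMonoid.End U)))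
    (hdef : ∀ f ∈ P, DefMap L M f) (hdiv : IsDivision P)
    (hinf : (P : Set (AddMonoid.End U)).Infinite) :
    ∃ H : Subring (AddMonoid.End U), H ≤ P ∧ IsFamily L M (H : Set (AddMonoid.End U)) ∧
      IsDivision H ∧ (H : Set (AddMonoid.End U)).Infinite ∧ ∀ f ∈ H, ∀ g ∈ H, f * g = g * f := by
  classical
  obtain ⟨a, ha⟩ := exists_ne_zero_of_infinite hinf
  -- Centralizers are measured by their lines through `a`.
  let B : Finset (AddMonoid.End U) → AddSubgroup U := fun E =>
    (centralizerIn P E).toAddSubgroup.map (AddMonoidHom.eval a)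
  have hB : ∀ E, (B E : Set U) = (fun f : AddMonoid.End U => f a) '' (centralizerIn P E : Set _) :=
    fun E => rfl
  have hBdef : ∀ E : Finset (AddMonoid.End U), ↑E ⊆ (P : Set (AddMonoid.End U)) →
      (centralizerIn P E : Set (AddMonoid.End U)).Infinite → DefSet L M (B E : Set U) :=
    fun E hE hEinf => defSet_line (hP.centralizerIn hdef E hE) (hdiv.centralizerIn E) hEinf ha
  obtain ⟨E, ⟨hE, hEinf⟩, hmin⟩ := exists_forall_nat_le (fun E => dm L M (B E : Set U))
    (p := fun E : Finset (AddMonoid.End U) => ↑E ⊆ (P : Set (AddMonoid.End U)) ∧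
      (centralizerIn P E : Set (AddMonoid.End U)).Infinite) ⟨∅, by simp, by
        convert hinf using 1
        ext f
        simp [mem_centralizerIn]⟩
  have hle : centralizerIn P E ≤ P := fun f hf => (mem_centralizerIn.1 hf).1
  refine ⟨centralizerIn P E, hle, hP.centralizerIn hdef E hE, hdiv.centralizerIn E, hEinf, ?_⟩
  have : Nontrivial (centralizerIn P E) := by
    have := hEinf.to_subtype
    exact Infinite.instNontrivial _
  let _ : DivisionRing (centralizerIn P E) := DivisionRing.ofIsUnitOrEqZero fun f => by
    by_cases hf : f = 0
    · exact Or.inr hf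
    · obtain ⟨g, hg, h, h'⟩ := hdiv.centralizerIn E f.1 f.2 fun h => hf (Subtype.ext h)
      exact Or.inl ⟨⟨f, ⟨g, hg⟩, Subtype.ext h, Subtype.ext h'⟩, rfl⟩
  have key := commutative_of_finite_centralizer (D := centralizerIn P E) ?_
  · exact fun f hf g hg => congrArg Subtype.val (key ⟨f, hf⟩ ⟨g, hg⟩)
  rintro x ⟨y, hxy⟩
  by_contra hx
  -- An infinite centralizer of the noncentral `x` would have a line of finite index in that of
  -- `centralizerIn P E`.
  have hE' : ((insert x.1 E : Finset (AddMonoid.End U)) : Set (AddMonoid.End U)) ⊆ P := by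
    rw [Finset.coe_insert]
    exact Set.insert_subset (hle x.2) hE
  have hmem : ∀ f : centralizerIn P E, x * f = f * x → f.1 ∈ centralizerIn P (insert x.1 E) := by
    intro f hf
    refine mem_centralizerIn.2 ⟨hle f.2, Finset.forall_mem_insert _ _ _ |>.2
      ⟨congrArg Subtype.val hf, (mem_centralizerIn.1 f.2).2⟩⟩
  have hinf' : (centralizerIn P (insert x.1 E) : Set (AddMonoid.End U)).Infinite := by
    have := Set.Infinite.image (f := Subtype.val) Subtype.val_injective.injOn hx
    refine this.mono ?_
    rintro _ ⟨f, hf, rfl⟩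
    exact hmem f hf
  have hBle : B (insert x.1 E) ≤ B E := by
    rintro _ ⟨f, hf, rfl⟩
    have hf' := mem_centralizerIn.1 hf
    exact ⟨f, mem_centralizerIn.2 ⟨hf'.1, fun g hg => hf'.2 g (Finset.mem_insert_of_mem hg)⟩, rfl⟩
  have hidx := relIndex_ne_zero_of_dm_le (hBdef _ hE' hinf') (hBdef _ hE hEinf) hBle
    (hmin _ ⟨hE', hinf'⟩)
  have hfi : ((B (insert x.1 E)).addSubgroupOf (B E)).FiniteIndex := ⟨hidx⟩
  have hfin : Finite (B E ⧸ (B (insert x.1 E)).addSubgroupOf (B E)) := inferInstance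
  have := hinf'.to_subtype
  have hcE : ∀ c ∈ centralizerIn P (insert x.1 E), c ∈ centralizerIn P E := by
    intro f hf
    have hf' := mem_centralizerIn.1 hf
    exact mem_centralizerIn.2 ⟨hf'.1, fun g hg => hf'.2 g (Finset.mem_insert_of_mem hg)⟩
  -- The cosets of the elements `c * y` are distinct when `c` commutes with `x` but `y`
  -- does not.
  obtain ⟨c, c', hne, hcc⟩ := Finite.exists_ne_map_eq_of_infinite
    fun c : (centralizerIn P (insert x.1 E) : Set (AddMonoid.End U)) =>
      ((⟨(c.1 * y.1) a, c.1 * y.1, (centralizerIn P E).mul_mem (hcE _ c.2) y.2, rfl⟩ : B E) :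
        B E ⧸ (B (insert x.1 E)).addSubgroupOf (B E))
  obtain ⟨(d : AddMonoid.End U), hd, hda⟩ := QuotientAddGroup.eq.1 hcc
  have hda' : d a = -((c.1 * y.1) a) + (c'.1 * y.1) a := hda
  have hd' : d = (c'.1 - c.1) * y.1 := by
    refine hdiv.eq_of_apply_eq (mem_centralizerIn.1 hd).1
      (P.mul_mem (P.sub_mem (hle (hcE _ c'.2)) (hle (hcE _ c.2))) (hle y.2)) ha ?_
    refine hda'.trans ?_
    rw [sub_mul, neg_add_eq_sub]
    rfl
  have hcx : (c'.1 - c.1) * x.1 = x.1 * (c'.1 - c.1) := by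
    have h1 := (mem_centralizerIn.1 c.2).2 x.1 (Finset.mem_insert_self _ _)
    have h2 := (mem_centralizerIn.1 c'.2).2 x.1 (Finset.mem_insert_self _ _)
    rw [sub_mul, mul_sub, h1, h2]
  have hdx := (mem_centralizerIn.1 hd).2 x.1 (Finset.mem_insert_self _ _)
  obtain ⟨g, -, -, hg⟩ := hdiv (c'.1 - c.1) (P.sub_mem (hle (hcE _ c'.2)) (hle (hcE _ c.2)))
    fun h0 => hne (Subtype.ext (sub_eq_zero.1 h0)).symm
  refine hxy (Subtype.ext ?_)
  change x.1 * y.1 = y.1 * x.1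
  rw [hd', ← mul_assoc, ← hcx, mul_assoc, mul_assoc] at hdx
  have := congrArg (g * ·) hdx
  simpa only [← mul_assoc, hg, one_mul] using this

/-- The centre of an infinite type-definable division ring of definable endomorphisms is an infinite
type-definable field: it is the centralizer of a finite set of generators over the centre. -/
theorem exists_central (hP : IsFamily L M (P : Set (AddMonoid.End U)))
    (hdef : ∀ f ∈ P, DefMap L M f) (hdiv : IsDivision P)
    (hinf : (P : Set (AddMonoid.End U)).Infinite) :
    ∃ C : Subring (AddMonoid.End U), (∀ f, f ∈ C ↔ f ∈ P ∧ ∀ g ∈ P, f * g = g * f) ∧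
      IsFamily L M (C : Set (AddMonoid.End U)) ∧ IsDivision C ∧
      (C : Set (AddMonoid.End U)).Infinite := by
  classical
  obtain ⟨a, ha⟩ := exists_ne_zero_of_infinite hinf
  obtain ⟨H, hHP, hHfam, hHdiv, hHinf, hcomm⟩ := exists_commutative L M hP hdef hdiv hinf
  have hInfH := hHinf.to_subtype
  have hInfP := hinf.to_subtype
  have : Nontrivial P := Infinite.instNontrivial (P : Set (AddMonoid.End U))
  have : Nontrivial H := Infinite.instNontrivial (H : Set (AddMonoid.End U))
  let _ : DivisionRing P := DivisionRing.ofIsUnitOrEqZero fun f => by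
    by_cases hf : f = 0
    · exact Or.inr hf
    · obtain ⟨g, hg, h, h'⟩ := hdiv f.1 f.2 fun h => hf (Subtype.ext h)
      exact Or.inl ⟨⟨f, ⟨g, hg⟩, Subtype.ext h, Subtype.ext h'⟩, rfl⟩
  have hfield : IsField H :=
    { exists_pair_ne := exists_pair_ne H
      mul_comm := fun f g => Subtype.ext (hcomm f.1 f.2 g.1 g.2)
      mul_inv_cancel := fun {f} hf => by
        obtain ⟨g, hg, h, -⟩ := hHdiv f.1 f.2 fun h => hf (Subtype.ext h)
        exact ⟨⟨g, hg⟩, Subtype.ext h⟩ }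
  let _ : Field H := hfield.toField
  have hfinU := hHdiv.finite hHfam hHinf
  -- `P` embeds into the finite-dimensional `H`-space `U` by evaluation at `a`, so it has finite
  -- dimension over `H`, and therefore over its centre.
  let _ : Module H P := Module.compHom P (Subring.inclusion hHP)
  have hsmul : ∀ (h : H) (f : P), h • f = Subring.inclusion hHP h * f := fun _ _ => rfl
  have : IsScalarTower H P P := ⟨fun h f g => by
    rw [hsmul, hsmul, smul_eq_mul, smul_eq_mul, mul_assoc]⟩
  let ev : P →ₗ[H] U :=
    { toFun := fun f => f.1 a
      map_add' := fun _ _ => rfl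
      map_smul' := fun _ _ => rfl }
  have hev : Function.Injective ev := fun f g h =>
    Subtype.ext (hdiv.eq_of_apply_eq f.2 g.2 ha h)
  have : Module.Finite H P := Module.Finite.of_injective ev hev
  have hfinC : Module.Finite (Subring.center P) P := finite_center (k := H)
  obtain ⟨t, ht⟩ := hfinC.fg_top
  -- The centre is the centralizer of a finite spanning set `t`.
  have hE : ((t.image Subtype.val : Finset (AddMonoid.End U)) : Set (AddMonoid.End U)) ⊆ P := by
    intro f hf
    obtain ⟨g, -, rfl⟩ := Finset.mem_image.1 (Finset.mem_coe.1 hf)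
    exact g.2
  have hmem : ∀ f, f ∈ centralizerIn P (t.image Subtype.val) ↔
      f ∈ P ∧ ∀ g ∈ P, f * g = g * f := by
    intro f
    rw [mem_centralizerIn]
    refine and_congr_right fun hf => ⟨fun h g hg => ?_, fun h g hg => (h g (hE hg)).symm⟩
    have hspan : (⟨g, hg⟩ : P) ∈ Submodule.span (Subring.center P) (t : Set P) := by
      rw [ht]; trivial
    have key : ∀ g ∈ Submodule.span (Subring.center P) (t : Set P),
        (⟨f, hf⟩ : P) * g = g * ⟨f, hf⟩ := by
      intro g hg
      induction hg using Submodule.span_induction with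
      | mem g hg => exact Subtype.ext (h g.1 (Finset.mem_image_of_mem _ hg)).symm
      | zero => rw [mul_zero, zero_mul]
      | add g g' _ _ h h' => rw [mul_add, add_mul, h, h']
      | smul c g _ h =>
        have hc : (⟨f, hf⟩ : P) * (c : P) = c * ⟨f, hf⟩ := Subring.mem_center_iff.1 c.2 _
        change (⟨f, hf⟩ : P) * ((c : P) * g) = (c : P) * g * ⟨f, hf⟩
        rw [← mul_assoc, hc, mul_assoc, h, mul_assoc]
    exact congrArg Subtype.val (key _ hspan)
  -- A finite centre would make `P` finite.
  refine ⟨_, hmem, hP.centralizerIn hdef _ hE, hdiv.centralizerIn _, fun hfin => ?_⟩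
  have := hfin.to_subtype
  have : Finite (Subring.center P) := by
    refine Finite.of_injective (β := (centralizerIn P (t.image Subtype.val) : Set _))
      (fun c => ⟨c.1.1, (hmem _).2 ⟨c.1.2, fun g hg => ?_⟩⟩) fun c c' h => ?_
    · exact congrArg Subtype.val (Subring.mem_center_iff.1 c.2 ⟨g, hg⟩).symm
    · exact Subtype.ext (Subtype.ext (by simpa using h))
  have : Finite P := Module.finite_of_finite (Subring.center P)
  exact not_finite (P : Set (AddMonoid.End U))

end Division

/-! ### Mutual commutants of definable endomorphisms -/

section Subgroup

variable {L : FirstOrder.Language.{u, v}} {M : Type w} [L.Structure M]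
variable {α V : Type w} [Coded L M α] [Coded L M V] [AddCommGroup V] {W : AddSubgroup V}

variable (L M) in
/-- A definable subgroup is a coded type. -/
@[reducible]
def Coded.addSubgroup (hW : DefSet L M (W : Set V)) : Coded L M W := Coded.subtype L M hW

theorem DefMap.addSubgroup_val (hW : DefSet L M (W : Set V)) :
    letI := Coded.addSubgroup L M hW
    DefMap L M (fun x : W => (x : V)) := by
  let _ := Coded.addSubgroup L M hW
  exact IsCoord.defMap ⟨fun i => i, fun c x h => h⟩

theorem DefMap.of_val (hW : DefSet L M (W : Set V)) {f : α → W}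
    (hf : DefMap L M fun x => (f x : V)) :
    letI := Coded.addSubgroup L M hW
    DefMap L M f := by
  let _ := Coded.addSubgroup L M hW
  refine DefMap.of_graph (s := {p : α × W | (f p.1 : V) = (p.2 : V)})
    (DefSet.eq (hf.comp DefMap.id.fst) ((DefMap.addSubgroup_val hW).comp DefMap.id.snd))
    fun x y => Subtype.ext_iff

theorem DefAdd.addSubgroup [DefAdd L M V] (hW : DefSet L M (W : Set V)) :
    letI := Coded.addSubgroup L M hW
    DefAdd L M W := by
  let _ := Coded.addSubgroup L M hW
  have hv := DefMap.addSubgroup_val hW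
  exact ⟨DefMap.of_val hW (f := fun p : W × W => p.1 + p.2)
    ((hv.comp DefMap.id.fst).add (hv.comp DefMap.id.snd))⟩

end Subgroup

section Commutant

variable {L : FirstOrder.Language.{u, v}} {M : Type w} [L.Structure M]
variable {V : Type w} [Coded L M V] [AddCommGroup V]

variable (L M) in
/-- `R` and `S` are the commutants of each other in the definable endomorphisms of `V`, no
nontrivial finite subgroup of `V` is invariant under `S`, and `R` is a strongly prime ring, on both
sides. -/
structure CommutantPair (R S : Subring (AddMonoid.End V)) : Prop where
  mem_left : ∀ f, f ∈ R ↔ DefMap L M f ∧ ∀ s ∈ S, f * s = s * f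
  mem_right : ∀ f, f ∈ S ↔ DefMap L M f ∧ ∀ r ∈ R, f * r = r * f
  eq_zero_of_finite : ∀ F : AddSubgroup V, (F : Set V).Finite → (∀ s ∈ S, ∀ x ∈ F, s x ∈ F) →
    ∀ x ∈ F, x = 0
  prime_right : ∀ y ∈ R, y ≠ 0 → ∃ Z : Finset (AddMonoid.End V), (∀ z ∈ Z, z ∈ R) ∧
    ∀ x ∈ R, (∀ z ∈ Z, x * z * y = 0) → x = 0
  prime_left : ∀ y ∈ R, y ≠ 0 → ∃ Z : Finset (AddMonoid.End V), (∀ z ∈ Z, z ∈ R) ∧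
    ∀ x ∈ R, (∀ z ∈ Z, y * z * x = 0) → x = 0

variable {R S : Subring (AddMonoid.End V)}

namespace CommutantPair

theorem defMap (h : CommutantPair L M R S) {r : AddMonoid.End V} (hr : r ∈ R) : DefMap L M r :=
  ((h.mem_left r).1 hr).1

theorem comm_apply (h : CommutantPair L M R S) {r s : AddMonoid.End V} (hr : r ∈ R) (hs : s ∈ S)
    (v : V) : r (s v) = s (r v) :=
  DFunLike.congr_fun (((h.mem_left r).1 hr).2 s hs) v

theorem exists_mul_ne_zero (h : CommutantPair L M R S) {x y : AddMonoid.End V} (hx : x ∈ R)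
    (hy : y ∈ R) (hx₀ : x ≠ 0) (hy₀ : y ≠ 0) : ∃ z ∈ R, x * z * y ≠ 0 := by
  obtain ⟨Z, hZ, h'⟩ := h.prime_right y hy hy₀
  by_contra! hc
  exact hx₀ (h' x hx fun z hz => hc z (hZ z hz))

end CommutantPair

/-- The endomorphisms of the subgroup `W` induced by the elements of `R`. -/
def restriction (R : Subring (AddMonoid.End V)) (W : AddSubgroup V) :
    Subring (AddMonoid.End W) where
  carrier := {f | ∃ r ∈ R, ∀ w : W, (f w : V) = r w}
  zero_mem' := ⟨0, R.zero_mem, fun _ => rfl⟩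
  one_mem' := ⟨1, R.one_mem, fun _ => rfl⟩
  add_mem' := by
    rintro f g ⟨r, hr, h⟩ ⟨t, ht, h'⟩
    exact ⟨r + t, R.add_mem hr ht, fun w => congrArg₂ (· + ·) (h w) (h' w)⟩
  neg_mem' := by
    rintro f ⟨r, hr, h⟩
    exact ⟨-r, R.neg_mem hr, fun w => congrArg (- ·) (h w)⟩
  mul_mem' := by
    rintro f g ⟨r, hr, h⟩ ⟨t, ht, h'⟩
    exact ⟨r * t, R.mul_mem hr ht, fun w => (h (g w)).trans (congrArg r (h' w))⟩

/-- The endomorphism of `W` induced by an endomorphism of `V`. -/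
def restrictEnd (W : AddSubgroup V) (r : AddMonoid.End V) (hr : ∀ w ∈ W, r w ∈ W) :
    AddMonoid.End W where
  toFun w := ⟨r w, hr w w.2⟩
  map_zero' := Subtype.ext (map_zero r)
  map_add' w w' := Subtype.ext (map_add r (w : V) (w' : V))

theorem restrictEnd_mem {W : AddSubgroup V} {r : AddMonoid.End V} (hr : ∀ w ∈ W, r w ∈ W)
    (hrR : r ∈ R) : restrictEnd W r hr ∈ restriction R W := ⟨r, hrR, fun _ => rfl⟩

variable (L M R S) in
/-- A definable subgroup `W`, invariant under `S`, on which every element of `R` is zero or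
injective. -/
structure IsCorner (W : AddSubgroup V) : Prop where
  defSet : DefSet L M (W : Set V)
  invariant : ∀ s ∈ S, ∀ w ∈ W, s w ∈ W
  eq_zero : ∀ r ∈ R, ∀ w ∈ W, w ≠ 0 → r w = 0 → ∀ w' ∈ W, r w' = 0

variable [Tame L M] [DefAdd L M V]

/-- The image of a nonzero element of `R` of least dimension is a corner. -/
theorem CommutantPair.exists_corner (h : CommutantPair L M R S) (hne : ∃ r ∈ R, r ≠ 0) :
    ∃ r₀ ∈ R, r₀ ≠ 0 ∧ IsCorner L M R S (endRange r₀) := by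
  have hdef : ∀ r ∈ R, DefSet L M (endRange r : Set V) := fun r hr =>
    ((DefSet.univ L M V).image (h.defMap hr)).of_eq (by rw [Set.image_univ]; rfl)
  obtain ⟨r₀, ⟨hr₀, hr₀'⟩, hmin⟩ := exists_forall_nat_le (p := fun r => r ∈ R ∧ r ≠ 0)
    (fun r : AddMonoid.End V => dm L M (endRange r : Set V)) hne
  have hinv : ∀ s ∈ S, ∀ w ∈ endRange r₀, s w ∈ endRange r₀ := by
    rintro s hs _ ⟨v, rfl⟩
    exact ⟨s v, h.comm_apply hr₀ hs v⟩
  refine ⟨r₀, hr₀, hr₀', hdef r₀ hr₀, hinv, ?_⟩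
  rintro r hr w hw hw₀ hrw
  by_contra! hc
  obtain ⟨w', ⟨v, rfl⟩, hv⟩ := hc
  have h1 : r * r₀ ≠ 0 := fun h0 => hv (DFunLike.congr_fun h0 v)
  have h2 := hmin _ ⟨R.mul_mem hr hr₀, h1⟩
  have h3 := dm_image_add_dm_ker_le (f := r) (h.defMap hr) (hdef r₀ hr₀)
  have h4 : r '' (endRange r₀ : Set V) = endRange (r * r₀) := by
    ext x
    constructor
    · rintro ⟨_, ⟨u, rfl⟩, rfl⟩
      exact ⟨u, rfl⟩
    · rintro ⟨u, rfl⟩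
      exact ⟨_, ⟨u, rfl⟩, rfl⟩
  have h4' : dm L M (r '' (endRange r₀ : Set V)) = dm L M (endRange (r * r₀) : Set V) := by
    rw [h4]
  -- By minimality of the image of `r₀`, the kernel of `r` on it has dimension zero. Being finite
  -- and invariant under `S`, it is trivial.
  let F : AddSubgroup V := endRange r₀ ⊓ AddMonoidHom.ker r
  have hF : DefSet L M (F : Set V) :=
    (hdef r₀ hr₀).inter (DefSet.eq (h.defMap hr) (DefMap.const 0))
  have h5 : dm L M (F : Set V) = 0 := by
    have h3' : dm L M (r '' (endRange r₀ : Set V)) + dm L M (F : Set V) ≤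
      dm L M (endRange r₀ : Set V) := h3
    omega
  refine hw₀ (h.eq_zero_of_finite F ((Tame.dm_eq_zero hF).1 h5) ?_ w ⟨hw, hrw⟩)
  rintro s hs x ⟨hx, hx'⟩
  refine ⟨hinv s hs x hx, ?_⟩
  have hx'' : r x = 0 := hx'
  change r (s x) = 0
  rw [h.comm_apply hr hs, hx'', map_zero]

/-- The ring induced on a corner contains an infinite type-definable family, and consists of
bijections and zero. -/
theorem CommutantPair.bijective_restriction (h : CommutantPair L M R S) {r₀ : AddMonoid.End V}
    (hr₀ : r₀ ∈ R) (hr₀' : r₀ ≠ 0) (hW : IsCorner L M R S (endRange r₀))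
    {G₀ : Set (AddMonoid.End V)} (hG₀ : IsFamily L M G₀) (hG₀R : G₀ ⊆ R) (hinf : G₀.Infinite) :
    letI := Coded.addSubgroup L M hW.defSet
    (∃ G ⊆ (restriction R (endRange r₀) : Set (AddMonoid.End (endRange r₀))),
        IsFamily L M G ∧ G.Infinite) ∧
      (∀ f ∈ restriction R (endRange r₀), DefMap L M f) ∧
      ∀ f ∈ restriction R (endRange r₀), f ≠ 0 → Function.Bijective f := by
  let _ := Coded.addSubgroup L M hW.defSet
  have := DefAdd.addSubgroup hW.defSet
  have hval := DefMap.addSubgroup_val hW.defSet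
  have hdef : ∀ f ∈ restriction R (endRange r₀), DefMap L M f := by
    rintro f ⟨r, hr, hf⟩
    refine DefMap.of_val hW.defSet ?_
    simp only [hf]
    exact (h.defMap hr).comp hval
  have hfam : ∃ G ⊆ (restriction R (endRange r₀) : Set (AddMonoid.End (endRange r₀))),
      IsFamily L M G ∧ G.Infinite := by
    obtain ⟨Z, hZ, hZ'⟩ := h.prime_right r₀ hr₀ hr₀'
    obtain ⟨Z', hZ'R, hZ''⟩ := h.prime_left r₀ hr₀ hr₀'
    -- By primeness the finitely many maps `g ↦ r₀ * z' * g * z * r₀` jointly separate the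
    -- elements of `R`, so one of them has an infinite image on `G₀`.
    obtain ⟨z, hz, z', hz', hzz⟩ : ∃ z ∈ Z, ∃ z' ∈ Z',
        ((fun g => r₀ * z' * g * z * r₀) '' G₀).Infinite := by
      by_contra! hc
      refine hinf ?_
      have hfin : {k : Z × Z' → AddMonoid.End V | ∀ p,
          k p ∈ (fun g => r₀ * p.2.1 * g * p.1.1 * r₀) '' G₀}.Finite :=
        Set.Finite.pi' fun p => hc p.1 p.1.2 p.2 p.2.2
      refine Set.Finite.of_finite_image (f := fun g (p : Z × Z') => r₀ * p.2.1 * g * p.1.1 * r₀)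
        (hfin.subset ?_) ?_
      · rintro _ ⟨g, hg, rfl⟩ p
        exact ⟨g, hg, rfl⟩
      · intro g hg g' hg' hgg
        refine sub_eq_zero.1 (hZ'' _ (R.sub_mem (hG₀R hg) (hG₀R hg')) fun z' hz' => ?_)
        refine hZ' _ (R.mul_mem (R.mul_mem hr₀ (hZ'R z' hz'))
          (R.sub_mem (hG₀R hg) (hG₀R hg'))) fun z hz => ?_
        have := congrFun hgg (⟨z, hz⟩, ⟨z', hz'⟩)
        simp only [mul_sub, sub_mul]
        exact sub_eq_zero.2 this
    let op : AddMonoid.End V → AddMonoid.End V → AddMonoid.End (endRange r₀) := fun g _ =>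
      restrictEnd (endRange r₀) (r₀ * z' * g * z) fun w _ => ⟨z' (g (z w)), rfl⟩
    refine ⟨Set.image2 op G₀ G₀, ?_, hG₀.image2 hG₀ op
      (θ := {x | x.2.1 = z x.1.1 ∧ r₀ (z' x.2.2.1) = x.1.2}) ?_ ?_, fun hfin => hzz ?_⟩
    · rintro _ ⟨g, hg, g', -, rfl⟩
      exact restrictEnd_mem _ (R.mul_mem (R.mul_mem (R.mul_mem hr₀ (hZ'R z' hz')) (hG₀R hg))
        (hZ z hz))
    · exact (DefSet.eq DefMap.id.snd.fst ((h.defMap (hZ z hz)).comp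
        (hval.comp DefMap.id.fst.fst))).and (DefSet.eq ((h.defMap hr₀).comp
          ((h.defMap (hZ'R z' hz')).comp DefMap.id.snd.snd.fst)) (hval.comp DefMap.id.fst.snd))
    · intro g _ g' _ u v
      constructor
      · intro huv
        exact ⟨z u, rfl, congrArg Subtype.val huv⟩
      · rintro ⟨w, hw, hwv⟩
        have hw' : w = z u := hw
        subst hw'
        exact Subtype.ext hwv
    · refine (hfin.image fun f : AddMonoid.End (endRange r₀) =>
        ((endRange r₀).subtype.comp (AddMonoidHom.comp f
          (AddMonoidHom.rangeRestrict r₀)) : AddMonoid.End V)).subset ?_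
      rintro _ ⟨g, hg, rfl⟩
      exact ⟨op g g, ⟨g, hg, g, hg, rfl⟩, rfl⟩
  refine ⟨hfam, hdef, ?_⟩
  obtain ⟨G, hGP, hG, hGinf⟩ := hfam
  refine surjective_of_domain hdef ?_ hG hGP hGinf
  rintro f ⟨r, hr, hf⟩ a hfa ha
  ext w
  have hra : r a = 0 := (hf a).symm.trans (congrArg Subtype.val hfa)
  rw [hf]
  exact hW.eq_zero r hr a a.2 (fun h0 => ha (Subtype.ext h0)) hra w w.2

end Commutant

/-! ### The field of scalars -/

section Scalars

variable {L : FirstOrder.Language.{u, v}} {M : Type w} [L.Structure M]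
variable {V : Type w} [Coded L M V] [AddCommGroup V]
variable {R S : Subring (AddMonoid.End V)} {W : AddSubgroup V} {e : AddMonoid.End V}

variable (L M R) in
/-- An idempotent `e` of `R` with definable image `W`, such that `e * R * e` is a division ring. -/
structure IsDivisionIdempotent (W : AddSubgroup V) (e : AddMonoid.End V) : Prop where
  defSet : DefSet L M (W : Set V)
  infinite : (W : Set V).Infinite
  mem : e ∈ R
  apply_mem : ∀ v, e v ∈ W
  apply_eq : ∀ w ∈ W, e w = w
  exists_inverse : ∀ r ∈ R, (∃ w ∈ W, e (r w) ≠ 0) → ∃ q ∈ R, (∀ v, q v ∈ W) ∧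
    (∀ w ∈ W, q (e (r w)) = w) ∧ ∀ w ∈ W, e (r (q w)) = w

/-- An element of `R` that is bijective on `W` can be inverted on `W` by an element of `R`. -/
theorem CommutantPair.exists_solution (h : CommutantPair L M R S)
    (hWdef : DefSet L M (W : Set V)) (hinv : ∀ s ∈ S, ∀ w ∈ W, s w ∈ W) {r t : AddMonoid.End V}
    (hr : r ∈ R) (ht : t ∈ R) (hinj : ∀ w ∈ W, r w = 0 → w = 0)
    (hsurj : ∀ w ∈ W, ∃ w' ∈ W, r w' = w) (htW : ∀ v, t v ∈ W) :
    ∃ q ∈ R, (∀ v, q v ∈ W) ∧ ∀ v, r (q v) = t v := by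
  have huniq : ∀ w ∈ W, ∀ w' ∈ W, r w = r w' → w = w' := fun w hw w' hw' hww =>
    sub_eq_zero.1 (hinj _ (W.sub_mem hw hw') (by rw [map_sub, hww, sub_self]))
  -- `q v` is the unique solution in `W` of `r w = t v`. By uniqueness `q` commutes with `S`, so
  -- it belongs to `R`.
  choose q hqW hq using fun v => hsurj (t v) (htW v)
  let q' : AddMonoid.End V := AddMonoidHom.mk' q fun v v' =>
    huniq _ (hqW _) _ (W.add_mem (hqW v) (hqW v')) (by rw [hq, map_add, map_add, hq, hq])
  refine ⟨q', (h.mem_left q').2 ⟨?_, fun s hs => ?_⟩, hqW, hq⟩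
  · refine DefMap.of_graph (s := {p : V × V | p.2 ∈ W ∧ r p.2 = t p.1})
      ((hWdef.mem DefMap.id.snd).and (DefSet.eq ((h.defMap hr).comp DefMap.id.snd)
        ((h.defMap ht).comp DefMap.id.fst))) fun v w => ?_
    constructor
    · rintro rfl
      exact ⟨hqW v, hq v⟩
    · rintro ⟨hw, hrw⟩
      exact huniq _ (hqW v) _ hw ((hq v).trans hrw.symm)
  · ext v
    refine huniq _ (hqW _) _ (hinv s hs _ (hqW v)) ?_
    change r (q (s v)) = r (s (q v))
    rw [hq, h.comm_apply hr hs, hq, h.comm_apply ht hs]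

theorem IsDivisionIdempotent.mul_self (he : IsDivisionIdempotent L M R W e) : e * e = e := by
  ext v
  exact he.apply_eq _ (he.apply_mem v)

theorem IsDivisionIdempotent.ne_zero (he : IsDivisionIdempotent L M R W e) : e ≠ 0 := by
  rintro rfl
  refine he.infinite ((Set.finite_singleton 0).subset fun w hw => ?_)
  exact (he.apply_eq w hw).symm

variable [Tame L M] [DefAdd L M V]

/-- `R` contains an idempotent `e` such that `e * R * e` is a division ring, and this division ring
is a type-definable family of endomorphisms of the image of `e`. -/
theorem CommutantPair.exists_idempotent (h : CommutantPair L M R S)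
    {G₀ : Set (AddMonoid.End V)} (hG₀ : IsFamily L M G₀) (hG₀R : G₀ ⊆ R) (hinf : G₀.Infinite) :
    ∃ W e, ∃ he : IsDivisionIdempotent L M R W e,
      letI := Coded.addSubgroup L M he.defSet
      (∀ f ∈ restriction R W, DefMap L M f) ∧ IsDivision (restriction R W) ∧
      (restriction R W : Set (AddMonoid.End W)).Infinite ∧
      IsFamily L M (restriction R W : Set (AddMonoid.End W)) := by
  have hne : ∃ r ∈ R, r ≠ 0 := by
    by_contra! hc
    exact hinf ((Set.finite_singleton 0).subset fun g hg => hc g (hG₀R hg))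
  obtain ⟨r₀, hr₀, hr₀', hW⟩ := h.exists_corner hne
  obtain ⟨⟨G, hGP, hG, hGinf⟩, hdef, hbij⟩ := h.bijective_restriction hr₀ hr₀' hW hG₀ hG₀R hinf
  set W := endRange r₀ with hWr
  let _ := Coded.addSubgroup L M hW.defSet
  have := DefAdd.addSubgroup hW.defSet
  have hbij' : ∀ r ∈ R, ∀ hrW : ∀ w ∈ W, r w ∈ W, (∃ w ∈ W, r w ≠ 0) →
      (∀ w ∈ W, r w = 0 → w = 0) ∧ ∀ w ∈ W, ∃ w' ∈ W, r w' = w := by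
    rintro r hr hrW ⟨w₀, hw₀, hrw₀⟩
    obtain ⟨hi, hs⟩ := hbij _ (restrictEnd_mem hrW hr) fun h0 =>
      hrw₀ (congrArg Subtype.val (DFunLike.congr_fun h0 (⟨w₀, hw₀⟩ : W)))
    refine ⟨fun w hw hrw => ?_, fun w hw => ?_⟩
    · have := (injective_iff_map_eq_zero _).1 hi ⟨w, hw⟩ (Subtype.ext hrw)
      exact congrArg Subtype.val this
    · obtain ⟨w', hw'⟩ := hs ⟨w, hw⟩
      exact ⟨w', w'.2, congrArg Subtype.val hw'⟩
  -- `r₀ * z` takes its values in `W` and is bijective on `W`; composed with the inverse of its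
  -- restriction to `W` it becomes the idempotent `e`.
  obtain ⟨z, hz, hz₀⟩ := h.exists_mul_ne_zero hr₀ hr₀ hr₀' hr₀'
  have hu : r₀ * z ∈ R := R.mul_mem hr₀ hz
  have huW : ∀ v, (r₀ * z) v ∈ W := fun v => ⟨z v, rfl⟩
  obtain ⟨huinj, husurj⟩ := hbij' (r₀ * z) hu (fun w _ => huW w) (by
    by_contra! hc
    exact hz₀ (AddMonoidHom.ext fun v => hc (r₀ v) ⟨v, rfl⟩))
  obtain ⟨e, heR, heW, he⟩ := h.exists_solution hW.defSet hW.invariant hu hu huinj husurj huW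
  have hee : ∀ w ∈ W, e w = w := fun w hw => sub_eq_zero.1
    (huinj _ (W.sub_mem (heW w) hw) (by rw [map_sub, he, sub_self]))
  have hinv : ∀ r ∈ R, (∃ w ∈ W, e (r w) ≠ 0) → ∃ q ∈ R, (∀ v, q v ∈ W) ∧
      (∀ w ∈ W, q (e (r w)) = w) ∧ ∀ w ∈ W, e (r (q w)) = w := by
    intro r hr hre
    obtain ⟨hi, hs⟩ := hbij' (e * r) (R.mul_mem heR hr) (fun w _ => heW _) hre
    obtain ⟨q, hq, hqW, hqe⟩ := h.exists_solution hW.defSet hW.invariant (R.mul_mem heR hr) heR hi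
      hs heW
    have hqe' : ∀ v, e (r (q v)) = e v := hqe
    refine ⟨q, hq, hqW, fun w hw => ?_, fun w hw => (hqe' w).trans (hee w hw)⟩
    refine sub_eq_zero.1 (hi _ (W.sub_mem (hqW _) hw) ?_)
    rw [map_sub, hqe, hee _ (heW _)]
    exact sub_self _
  have hWinf : (W : Set V).Infinite := by
    intro hfin
    have := hfin.to_subtype
    have : Finite W := this
    have : Finite (AddMonoid.End W) := Finite.of_injective (fun f => (f : W → W))
      DFunLike.coe_injective
    exact hGinf (Set.toFinite _)
  have hdiv : IsDivision (restriction R W) := by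
    rintro f ⟨r, hr, hf⟩ hf₀
    obtain ⟨w, hw⟩ : ∃ w, f w ≠ 0 := by
      by_contra! hc
      exact hf₀ (AddMonoidHom.ext hc)
    have her : ∀ w : W, e (r w) = f w := fun w => by rw [← hf, hee _ (f w).2]
    obtain ⟨q, hq, hqW, h₁, h₂⟩ := hinv r hr ⟨w, w.2, fun h0 => hw (by
      rw [her] at h0
      exact Subtype.ext h0)⟩
    refine ⟨restrictEnd W q fun w _ => hqW w, restrictEnd_mem _ hq, ?_, ?_⟩
    · ext w
      exact (her _).symm.trans (h₂ w w.2)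
    · ext w
      change q (f w) = w
      rw [← her]
      exact h₁ w w.2
  exact ⟨W, e, ⟨hW.defSet, hWinf, heR, heW, hee, hinv⟩, hdef, hdiv, hGinf.mono hGP,
    isFamily_of_division hdef hdiv hG hGP hGinf⟩

/-- The two-sided ideal of `R` generated by `e` contains the identity: otherwise an idempotent of
this ideal with image of largest dimension could be enlarged. -/
theorem CommutantPair.exists_units (h : CommutantPair L M R S)
    (he : IsDivisionIdempotent L M R W e) :
    ∃ (n : ℕ) (x y : Fin n → AddMonoid.End V), (∀ i, x i ∈ R) ∧ (∀ i, y i ∈ R) ∧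
      (∀ i v, y i v ∈ W) ∧ ∑ i, x i * y i = 1 := by
  obtain ⟨p, ⟨⟨n, x, y, hx, hy, hyW, hp⟩, hpp⟩, hmax⟩ := exists_forall_le_nat
    (p := fun p : AddMonoid.End V => (∃ (n : ℕ) (x y : Fin n → AddMonoid.End V),
      (∀ i, x i ∈ R) ∧ (∀ i, y i ∈ R) ∧ (∀ i v, y i v ∈ W) ∧ ∑ i, x i * y i = p) ∧ p * p = p)
    (fun p => dm L M (endRange p : Set V))
    ⟨0, ⟨0, Fin.elim0, Fin.elim0, fun i => i.elim0, fun i => i.elim0, fun i => i.elim0, by simp⟩,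
      by simp⟩ (N := dm L M (Set.univ : Set V)) (by
      rintro p ⟨⟨n, x, y, hx, hy, -, rfl⟩, -⟩
      have hp : ∑ i, x i * y i ∈ R := R.sum_mem fun i _ => R.mul_mem (hx i) (hy i)
      refine Tame.dm_mono (((DefSet.univ L M V).image (h.defMap hp)).of_eq ?_)
        (DefSet.univ L M V) (Set.subset_univ _)
      rw [Set.image_univ]; rfl)
  have hpR : p ∈ R := hp ▸ R.sum_mem fun i _ => R.mul_mem (hx i) (hy i)
  by_cases hp1 : p = 1
  · exact ⟨n, x, y, hx, hy, hyW, hp.trans hp1⟩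
  exfalso
  have hq : 1 - p ∈ R := R.sub_mem R.one_mem hpR
  obtain ⟨z, hz, hz₀⟩ := h.exists_mul_ne_zero hq he.mem (sub_ne_zero.2 (Ne.symm hp1)) he.ne_zero
  -- As `e * z' * (1 - p) * z * e` is nonzero, it is invertible in `e * R * e`. This gives `x'`
  -- and `y'` with `y' * x' = e`, `p * x' = 0` and `y' * p = 0`, so that `p + x' * y'` is an
  -- idempotent.
  obtain ⟨z', hz', hz₀'⟩ := h.exists_mul_ne_zero he.mem (R.mul_mem (R.mul_mem hq hz) he.mem)
    he.ne_zero hz₀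
  have hqq : (1 - p) * (1 - p) = 1 - p := by
    rw [sub_mul, mul_sub, mul_sub, hpp]; simp
  have hpq : p * (1 - p) = 0 := by rw [mul_sub, hpp, mul_one, sub_self]
  have hqp : (1 - p) * p = 0 := by rw [sub_mul, hpp, one_mul, sub_self]
  obtain ⟨t, ht, htW, htw, -⟩ := he.exists_inverse (z' * (1 - p) * z)
    (R.mul_mem (R.mul_mem hz' hq) hz) (by
      by_contra! hc
      exact hz₀' (AddMonoidHom.ext fun v => hc (e v) (he.apply_mem v)))
  set x' : AddMonoid.End V := (1 - p) * z * e with hx'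
  set y' : AddMonoid.End V := t * e * z' * (1 - p) with hy'
  have hyx : y' * x' = e := by
    have h1 : y' * x' = t * (e * (z' * (1 - p) * z)) * e := by
      calc y' * x' = t * e * z' * ((1 - p) * (1 - p)) * z * e := by
            simp only [hx', hy', mul_assoc]
        _ = _ := by rw [hqq]; simp only [mul_assoc]
    rw [h1]
    ext v
    exact htw (e v) (he.apply_mem v)
  have hx'e : x' * e = x' := by rw [hx', mul_assoc, he.mul_self]
  have hpx : p * x' = 0 := by rw [hx', ← mul_assoc, ← mul_assoc, hpq, zero_mul, zero_mul]
  have hyp : y' * p = 0 := by rw [hy', mul_assoc, hqp, mul_zero]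
  have hx'R : x' ∈ R := R.mul_mem (R.mul_mem hq hz) he.mem
  have hy'R : y' ∈ R := R.mul_mem (R.mul_mem (R.mul_mem ht he.mem) hz') hq
  have hpp' : (p + x' * y') * (p + x' * y') = p + x' * y' := by
    have h1 : p * (x' * y') = 0 := by rw [← mul_assoc, hpx, zero_mul]
    have h2 : x' * y' * p = 0 := by rw [mul_assoc, hyp, mul_zero]
    have h3 : x' * y' * (x' * y') = x' * y' := by
      rw [mul_assoc, ← mul_assoc y', hyx, ← mul_assoc, hx'e]
    rw [add_mul, mul_add, mul_add, hpp, h1, h2, h3, add_zero, zero_add]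
  have hp'R : p + x' * y' ∈ R := R.add_mem hpR (R.mul_mem hx'R hy'R)
  have hle := hmax (p + x' * y') ⟨⟨n + 1, Fin.cons x' x, Fin.cons y' y, ?_, ?_, ?_, ?_⟩, hpp'⟩
  · have hdef : DefSet L M (endRange (p + x' * y') : Set V) :=
      ((DefSet.univ L M V).image (h.defMap hp'R)).of_eq (by rw [Set.image_univ]; rfl)
    have h1 : dm L M (p '' (endRange (p + x' * y') : Set V)) +
        dm L M {v | v ∈ endRange (p + x' * y') ∧ p v = 0} ≤
        dm L M (endRange (p + x' * y') : Set V) := dm_image_add_dm_ker_le (h.defMap hpR) hdef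
    have h2 : p '' (endRange (p + x' * y') : Set V) = endRange p := by
      have h3 : p * (p + x' * y') = p := by rw [mul_add, hpp, ← mul_assoc, hpx, zero_mul, add_zero]
      ext v
      constructor
      · rintro ⟨u, -, rfl⟩
        exact ⟨u, rfl⟩
      · rintro ⟨u, rfl⟩
        exact ⟨_, ⟨u, rfl⟩, DFunLike.congr_fun h3 u⟩
    have h2' : dm L M (p '' (endRange (p + x' * y') : Set V)) = dm L M (endRange p : Set V) := by
      rw [h2]
    have h4 : DefSet L M {v | v ∈ endRange (p + x' * y') ∧ p v = 0} :=
      hdef.and (DefSet.eq (h.defMap hpR) (DefMap.const 0))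
    -- `p` maps the image of `p + x' * y'` onto that of `p`, with a kernel containing the infinite
    -- group `x' [W]`; so the dimension has increased.
    have h5 : dm L M {v | v ∈ endRange (p + x' * y') ∧ p v = 0} ≠ 0 := by
      rw [Ne, Tame.dm_eq_zero h4]
      intro hfin
      have hyx' : ∀ w ∈ W, y' (x' w) = w := fun w hw =>
        (DFunLike.congr_fun hyx w).trans (he.apply_eq w hw)
      have hpx' : ∀ w, p (x' w) = 0 := fun w => DFunLike.congr_fun hpx w
      refine he.infinite (Set.Finite.of_finite_image (f := x') (hfin.subset ?_) ?_)
      · rintro _ ⟨w, hw, rfl⟩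
        refine ⟨⟨x' w, ?_⟩, hpx' w⟩
        change p (x' w) + x' (y' (x' w)) = x' w
        rw [hpx', hyx' w hw, zero_add]
      · intro w hw w' hw' hww
        rw [← hyx' w hw, hww, hyx' w' hw']
    omega
  · exact Fin.cases hx'R hx
  · exact Fin.cases hy'R hy
  · exact Fin.cases (fun v => htW _) hyW
  · rw [Fin.sum_univ_succ]
    simp only [Fin.cons_zero, Fin.cons_succ]
    rw [hp, add_comm]

end Scalars

section Scalars

variable {L : FirstOrder.Language.{u, v}} {M : Type w} [L.Structure M] [Tame L M]
variable {V : Type w} [Coded L M V] [AddCommGroup V] [DefAdd L M V]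
variable {R S : Subring (AddMonoid.End V)}

/-- The intersection `K` of `R` and `S` is an infinite field over which `V` has finite dimension,
and which acts definably on `V`, its elements being given by their values at a vector `a`.

Restriction to the image `W` of a division idempotent `e` identifies `K` with the centre of the
division ring `e * R * e`: if `∑ i, x i * y i = 1`, where `y i` takes its values in `W`, the element
of `K` with restriction `c` is `∑ i, x i * c * y i`. -/
theorem CommutantPair.field (h : CommutantPair L M R S)
    {G₀ : Set (AddMonoid.End V)} (hG₀ : IsFamily L M G₀) (hG₀R : G₀ ⊆ R) (hinf : G₀.Infinite) :
    IsDivision (R ⊓ S) ∧ ((R ⊓ S : Subring (AddMonoid.End V)) : Set (AddMonoid.End V)).Infinite ∧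
      Module.Finite (R ⊓ S : Subring (AddMonoid.End V)) V ∧ ∃ a : V, a ≠ 0 ∧
        DefSet L M {x : V × (V × V) | ∃ f ∈ R ⊓ S, f a = x.1 ∧ f x.2.1 = x.2.2} := by
  obtain ⟨W, e, he, hdef, hdiv, hPinf, hfam⟩ := h.exists_idempotent hG₀ hG₀R hinf
  obtain ⟨n, x, y, hx, hy, hyW, hxy⟩ := h.exists_units he
  let _ := Coded.addSubgroup L M he.defSet
  have := DefAdd.addSubgroup he.defSet
  have hval := DefMap.addSubgroup_val he.defSet
  obtain ⟨C, hC, hCfam, hCdiv, hCinf⟩ := exists_central hfam hdef hdiv hPinf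
  have hsum_apply : ∀ (f : Fin n → AddMonoid.End V) (v : V), (∑ i, f i) v = ∑ i, f i v :=
    fun f v => AddMonoidHom.finsetSum_apply _ _ v
  have hxy' : ∀ v, ∑ i, x i (y i v) = v := fun v =>
    (hsum_apply (fun i => x i * y i) v).symm.trans (DFunLike.congr_fun hxy v)
  have happly : ∀ k ∈ R ⊓ S, ∀ r ∈ R, ∀ v, k (r v) = r (k v) := fun k hk r hr v =>
    (h.comm_apply hr hk.2 v).symm
  -- the elements of `C` extend to elements of `R ⊓ S`
  have hext : ∀ c ∈ C, ∃ k ∈ R ⊓ S, ∀ w : W, k w = c w := by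
    intro c hc
    obtain ⟨⟨r, hr, hcr⟩, hcP⟩ := (hC c).1 hc
    have hcomm : ∀ t ∈ R, (∀ w ∈ W, t w ∈ W) → ∀ w ∈ W, r (t w) = t (r w) := by
      intro t ht htW w hw
      have h1 := congrArg Subtype.val
        (DFunLike.congr_fun (hcP _ (restrictEnd_mem htW ht)) ⟨w, hw⟩)
      have h2 : (c ⟨t w, htW w hw⟩ : V) = t (c ⟨w, hw⟩ : V) := h1
      rwa [hcr, hcr] at h2
    have hkR : ∑ i, x i * r * y i ∈ R :=
      R.sum_mem fun i _ => R.mul_mem (R.mul_mem (hx i) hr) (hy i)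
    refine ⟨∑ i, x i * r * y i, ⟨hkR, (h.mem_right _).2 ⟨h.defMap hkR, fun t ht => ?_⟩⟩, ?_⟩
    · have hij : ∀ i j, r * (y i * t * x j) * y j = (y i * t * x j) * r * y j := fun i j => by
        ext v
        exact hcomm (y i * t * x j) (R.mul_mem (R.mul_mem (hy i) ht) (hx j))
          (fun w _ => hyW i _) _ (hyW j v)
      calc (∑ i, x i * r * y i) * t = (∑ i, x i * r * y i) * t * ∑ j, x j * y j := by
            rw [hxy, mul_one]
        _ = ∑ i, ∑ j, x i * (r * (y i * t * x j) * y j) := by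
            simp only [Finset.sum_mul, Finset.mul_sum, mul_assoc]
            exact Finset.sum_comm
        _ = ∑ i, ∑ j, x i * ((y i * t * x j) * r * y j) := by simp only [hij]
        _ = (∑ i, x i * y i) * t * ∑ j, x j * r * y j := by
            simp only [Finset.sum_mul, Finset.mul_sum, mul_assoc]
            exact Finset.sum_comm
        _ = t * ∑ i, x i * r * y i := by rw [hxy, one_mul]
    · intro w
      rw [hsum_apply]
      have hi : ∀ i, (x i * r * y i) (w : V) = x i (y i (c w)) := by
        intro i
        change x i (r (y i w)) = _
        rw [hcomm (y i) (hy i) (fun w _ => hyW i w) w w.2, hcr]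
      simp only [hi, hxy']
  -- the elements of `R ⊓ S` restrict to elements of `C`
  have hres : ∀ k ∈ R ⊓ S, ∃ c ∈ C, ∀ w : W, k w = c w := by
    intro k hk
    have hkW : ∀ w ∈ W, k w ∈ W := by
      intro w hw
      rw [← he.apply_eq w hw, happly k hk e he.mem]
      exact he.apply_mem _
    refine ⟨restrictEnd W k hkW, (hC _).2 ⟨restrictEnd_mem hkW hk.1, ?_⟩, fun w => rfl⟩
    rintro g ⟨r, hr, hg⟩
    ext w
    change k (g w) = g ⟨k w, _⟩
    rw [hg, hg, happly k hk r hr]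
  -- the elements of `R ⊓ S` are determined by their restrictions to `W`
  have hsum : ∀ k ∈ R ⊓ S, ∀ v, k v = ∑ i, x i (k (y i v)) := by
    intro k hk v
    conv_lhs => rw [← hxy' v, map_sum]
    exact Finset.sum_congr rfl fun i _ => happly k hk _ (hx i) _
  have heq : ∀ k ∈ R ⊓ S, ∀ k' ∈ R ⊓ S, (∀ w : W, k w = k' w) → k = k' := by
    intro k hk k' hk' hkk
    ext v
    rw [hsum k hk, hsum k' hk']
    exact Finset.sum_congr rfl fun i _ => congrArg (x i) (hkk ⟨y i v, hyW i v⟩)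
  obtain ⟨a, haW, ha⟩ : ∃ a ∈ W, a ≠ 0 := by
    by_contra! hc
    exact he.infinite ((Set.finite_singleton 0).subset hc)
  refine ⟨?_, ?_, ?_, a, ha, ?_⟩
  · intro k hk hk₀
    obtain ⟨c, hc, hkc⟩ := hres k hk
    obtain ⟨c', hc', h1, h2⟩ := hCdiv c hc fun h0 => hk₀ (heq k hk 0 (Subring.zero_mem _)
      fun w => by rw [hkc, h0]; rfl)
    obtain ⟨k', hk', hkc'⟩ := hext c' hc'
    refine ⟨k', hk', heq _ (Subring.mul_mem _ hk hk') _ (Subring.one_mem _) fun w => ?_,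
      heq _ (Subring.mul_mem _ hk' hk) _ (Subring.one_mem _) fun w => ?_⟩
    · change k (k' w) = w
      rw [hkc', hkc]
      exact congrArg Subtype.val (DFunLike.congr_fun h1 w)
    · change k' (k w) = w
      rw [hkc, hkc']
      exact congrArg Subtype.val (DFunLike.congr_fun h2 w)
  · choose! ζ hζ hζ' using hext
    refine Set.infinite_of_injOn_mapsTo (f := ζ) (fun c hc c' hc' hcc => ?_) hζ hCinf
    ext w
    rw [← hζ' c hc, ← hζ' c' hc', hcc]
  · have hfinW : Module.Finite C W := hCdiv.finite hCfam hCinf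
    obtain ⟨t, ht⟩ := hfinW.fg_top
    let X : Set V := (fun p : Fin n × W => x p.1 p.2) '' (Set.univ ×ˢ (t : Set W))
    refine Module.finite_def.2 (Submodule.fg_def.2
      ⟨X, (Set.finite_univ.prod t.finite_toSet).image _, eq_top_iff.2 fun v _ => ?_⟩)
    rw [← hxy' v]
    refine Submodule.sum_mem _ fun i _ => ?_
    have key : ∀ w ∈ Submodule.span C (t : Set W),
        x i w ∈ Submodule.span (R ⊓ S : Subring (AddMonoid.End V)) X := by
      intro w hw
      induction hw using Submodule.span_induction with
      | mem w hw => exact Submodule.subset_span ⟨(i, w), ⟨trivial, hw⟩, rfl⟩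
      | zero =>
        rw [show ((0 : W) : V) = 0 from rfl, map_zero]
        exact Submodule.zero_mem _
      | add w w' _ _ h1 h2 =>
        rw [show ((w + w' : W) : V) = w + w' from rfl, map_add]
        exact Submodule.add_mem _ h1 h2
      | smul c w _ h1 =>
        obtain ⟨k, hk, hkc⟩ := hext c.1 c.2
        have : x i ((c • w : W) : V) =
            (⟨k, hk⟩ : (R ⊓ S : Subring (AddMonoid.End V))) • x i (w : V) := by
          change x i (c.1 w : V) = k (x i w)
          rw [happly k hk _ (hx i), hkc]
        rw [this]
        exact Submodule.smul_mem _ _ h1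
    exact key ⟨y i v, hyW i v⟩ (by rw [ht]; trivial)
  -- `k u = v` holds if and only if `∑ i, x i (k (y i u)) = v`, where the vectors `k (y i u)` of
  -- `W` are determined, through the definable action of `C` on `W`, by the value of `k` at `a`.
  · have hact := defSet_action hCfam hCdiv hCinf (a := (⟨a, haW⟩ : W))
      fun h0 => ha (congrArg Subtype.val h0)
    set Θ : Set (W × (W × W)) := {x | ∃ f ∈ C, f ⟨a, haW⟩ = x.1 ∧ f x.2.1 = x.2.2} with hΘ
    refine (DefSet.exists (p := fun (z : V × (V × V)) (q : W × (Fin n → W)) =>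
      (q.1 : V) = z.1 ∧ (q.1, ((0 : W), (0 : W))) ∈ Θ ∧
        (∀ i, (q.1, ((⟨y i z.2.1, hyW i z.2.1⟩ : W), q.2 i)) ∈ Θ) ∧
        ∑ i, x i (q.2 i) = z.2.2) ?_).of_eq ?_
    · have h1 : DefMap L M fun p : (V × (V × V)) × (W × (Fin n → W)) => p.2.1 := DefMap.id.snd.fst
      have h2 : ∀ i, DefMap L M fun p : (V × (V × V)) × (W × (Fin n → W)) => p.2.2 i := fun i =>
        DefMap.id.snd.snd.apply i
      have h3 : ∀ i, DefMap L M fun p : (V × (V × V)) × (W × (Fin n → W)) =>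
          (⟨y i p.1.2.1, hyW i p.1.2.1⟩ : W) := fun i =>
        DefMap.of_val he.defSet ((h.defMap (hy i)).comp DefMap.id.fst.snd.fst)
      refine (DefSet.eq (hval.comp h1) DefMap.id.fst.fst).and ((hact.mem (h1.prodMk
        ((DefMap.const 0).prodMk (DefMap.const 0)))).and ((DefSet.finite_forall fun i =>
          hact.mem (h1.prodMk ((h3 i).prodMk (h2 i)))).and (DefSet.eq
            (DefMap.finset_sum Finset.univ fun i _ => (h.defMap (hx i)).comp (hval.comp (h2 i)))
            DefMap.id.fst.snd.snd)))
    · ext ⟨p, u, v⟩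
      constructor
      · rintro ⟨⟨p, ws⟩, rfl, ⟨f, hf, hfa, -⟩, hws, hv⟩
        obtain ⟨k, hk, hkf⟩ := hext f hf
        refine ⟨k, hk, ?_, ?_⟩
        · exact (hkf ⟨a, haW⟩).trans (congrArg Subtype.val hfa)
        · refine Eq.trans ?_ hv
          rw [hsum k hk]
          refine Finset.sum_congr rfl fun i _ => congrArg (x i) ?_
          obtain ⟨g, hg, hga, hgy⟩ := hws i
          have hfg : f = g := hCdiv.eq_of_apply_eq hf hg (a := ⟨a, haW⟩)
            (fun h0 => ha (congrArg Subtype.val h0)) (hfa.trans hga.symm)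
          subst hfg
          exact (hkf ⟨y i u, hyW i u⟩).trans (congrArg Subtype.val hgy)
      · rintro ⟨k, hk, hka, hku⟩
        obtain ⟨c, hc, hkc⟩ := hres k hk
        refine ⟨(c ⟨a, haW⟩, fun i => c ⟨y i u, hyW i u⟩), ?_, ⟨c, hc, rfl, map_zero c⟩,
          fun i => ⟨c, hc, rfl, rfl⟩, ?_⟩
        · exact (hkc ⟨a, haW⟩).symm.trans hka
        · refine Eq.trans ?_ hku
          rw [hsum k hk]
          exact Finset.sum_congr rfl fun i _ => congrArg (x i) (hkc ⟨y i u, hyW i u⟩).symm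

end Scalars

/-! ### Passage to the quotient by the bikatakernel -/

section Induced

open Endogeny

section Induces

variable {A : Type*} [AddCommGroup A] {B : AddSubgroup A} {φ ψ : Endogeny A}
variable {f g : AddMonoid.End (A ⧸ B)} {Γ Δ : PreSubring A}

/-- The endogeny `φ` of `A` induces the endomorphism `f` of `A ⧸ B`. -/
def Induces (φ : Endogeny A) (f : AddMonoid.End (A ⧸ B)) : Prop :=
  ∀ a b : A, (a, b) ∈ φ.graph → f (a : A ⧸ B) = (b : A ⧸ B)

theorem Induces.zero : Induces (B := B) 0 0 := by
  rintro a b hb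
  obtain rfl : b = 0 := hb
  rfl

theorem Induces.one : Induces (B := B) 1 1 := by
  rintro a b hb
  obtain rfl : b = a := hb
  rfl

theorem Induces.add (h : Induces φ f) (h' : Induces ψ g) : Induces (φ + ψ) (f + g) := by
  rintro a b ⟨x, y, hx, hy, hxy⟩
  obtain rfl : x + y = b := hxy
  exact congrArg₂ (· + ·) (h a x hx) (h' a y hy)

theorem Induces.neg (h : Induces φ f) : Induces (-φ) (-f) := by
  intro a b hb
  change -f (a : A ⧸ B) = b
  rw [h a (-b) hb]
  exact neg_neg (b : A ⧸ B)

theorem Induces.sub (h : Induces φ f) (h' : Induces ψ g) : Induces (φ - ψ) (f - g) := by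
  rw [sub_eq_add_neg]
  exact h.add h'.neg

theorem Induces.mul (h : Induces φ f) (h' : Induces ψ g) : Induces (φ * ψ) (f * g) := by
  rintro a b ⟨z, hz, hb⟩
  exact (congrArg f (h' a z hz)).trans (h z b hb)

/-- An endogeny leaving `B` invariant induces an endomorphism of `A ⧸ B`. -/
theorem exists_induces (h : φ.image B ≤ B) : ∃ f : AddMonoid.End (A ⧸ B), Induces φ f := by
  choose t ht using φ.total
  have hmk : ∀ a b c, (a, b) ∈ φ.graph → (a, c) ∈ φ.graph → (b : A ⧸ B) = c := by
    intro a b c hb hc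
    rw [QuotientAddGroup.eq, ← sub_eq_neg_add]
    exact h ⟨0, B.zero_mem, φ.sub_mem_kat hc hb⟩
  let f₀ : A →+ A ⧸ B := AddMonoidHom.mk' (fun a => (t a : A ⧸ B)) fun a a' =>
    hmk (a + a') _ (t a + t a') (ht _) (φ.graph.add_mem (ht a) (ht a'))
  refine ⟨QuotientAddGroup.lift B f₀ fun a ha => ?_, fun a b hb => hmk a _ b (ht a) hb⟩
  exact (QuotientAddGroup.eq_zero_iff _).2 (h ⟨a, ha, ht a⟩)

/-- The endomorphisms of `A ⧸ B` induced by the elements of `Γ`. -/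
def inducedRing (Γ : PreSubring A) (B : AddSubgroup A) : Subring (AddMonoid.End (A ⧸ B)) where
  carrier := {f | ∃ γ ∈ Γ.carrier, Induces γ f}
  zero_mem' := ⟨0, Γ.zero_mem, Induces.zero⟩
  one_mem' := ⟨1, Γ.one_mem, Induces.one⟩
  add_mem' := by
    rintro f g ⟨γ, hγ, h⟩ ⟨γ', hγ', h'⟩
    exact ⟨γ + γ', Γ.add_mem hγ hγ', h.add h'⟩
  neg_mem' := by
    rintro f ⟨γ, hγ, h⟩
    exact ⟨-γ, Γ.neg_mem hγ, h.neg⟩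
  mul_mem' := by
    rintro f g ⟨γ, hγ, h⟩ ⟨γ', hγ', h'⟩
    exact ⟨γ * γ', Γ.mul_mem hγ hγ', h.mul h'⟩

/-- The endogeny `{(a, b) | f (a + B) = b + B}` of `A` given by an endomorphism `f` of the quotient
by a finite subgroup. -/
def liftEnd (hB : (B : Set A).Finite) (f : AddMonoid.End (A ⧸ B)) : Endogeny A where
  graph :=
    { carrier := {p | f (p.1 : A ⧸ B) = (p.2 : A ⧸ B)}
      zero_mem' := map_zero f
      add_mem' := fun {p q} hp hq =>
        (map_add f (p.1 : A ⧸ B) (q.1 : A ⧸ B)).trans (congrArg₂ (· + ·) hp hq)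
      neg_mem' := fun {p} hp => (map_neg f (p.1 : A ⧸ B)).trans (congrArg (- ·) hp) }
  total a := by
    obtain ⟨b, hb⟩ := QuotientAddGroup.mk_surjective (f (a : A ⧸ B))
    exact ⟨b, hb.symm⟩
  finite_kat := by
    refine hB.subset fun b hb => ?_
    have hb' : f ((0 : A) : A ⧸ B) = (b : A ⧸ B) := hb
    have h0 : f ((0 : A) : A ⧸ B) = 0 := map_zero f
    exact (QuotientAddGroup.eq_zero_iff b).1 (hb'.symm.trans h0)

theorem mem_liftEnd {hB : (B : Set A).Finite} {a b : A} :
    (a, b) ∈ (liftEnd hB f).graph ↔ f (a : A ⧸ B) = (b : A ⧸ B) := Iff.rfl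

theorem induces_liftEnd (hB : (B : Set A).Finite) : Induces (liftEnd hB f) f := fun _ _ h => h

theorem kat_liftEnd {hB : (B : Set A).Finite} : (liftEnd hB f).kat = B := by
  ext b
  rw [mem_kat, mem_liftEnd, eq_comm, ← QuotientAddGroup.eq_zero_iff]
  have h0 : f ((0 : A) : A ⧸ B) = 0 := map_zero f
  rw [h0]

end Induces

variable {L : FirstOrder.Language.{u, v}} {M : Type w} [L.Structure M]
variable {A : Type w} [Coded L M A] [AddCommGroup A] {Γ Δ : PreSubring A}

/-- The bikatakernel is invariant under `Γ`: an element `γ` maps `kat γ'` into `kat (γ * γ')`, and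
it maps `kat δ` into `kat γ + kat δ` by sharp commutation. -/
theorem MinimalPair.image_BiKat_le (h : MinimalPair L M Γ Δ) {γ : Endogeny A}
    (hγ : γ ∈ Γ.carrier) : γ.image (BiKat Γ Δ) ≤ BiKat Γ Δ := by
  rintro b ⟨a, ha, hb⟩
  obtain ⟨x, hx, y, hy, rfl⟩ := AddSubgroup.mem_sup.1 ha
  obtain ⟨c, hc⟩ := γ.total x
  have hc' : c ∈ BiKat Γ Δ := by
    obtain ⟨γ', hγ', hx'⟩ := mem_Kat_iff.1 hx
    refine AddSubgroup.mem_sup_left (kat_le_Kat (Γ.mul_mem hγ hγ') ?_)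
    rw [kat_mul]
    exact ⟨x, hx', hc⟩
  have hd : (y, b - c) ∈ γ.graph := by simpa using γ.graph.sub_mem hb hc
  have hd' : b - c ∈ BiKat Γ Δ := by
    obtain ⟨δ, hδ, hy'⟩ := mem_Kat_iff.1 hy
    rw [BiKat, sup_comm]
    exact sup_le_sup (kat_le_Kat hδ) (kat_le_Kat hγ) (h.symm.stable_kat hδ γ hγ ⟨y, hy', hd⟩)
  simpa using add_mem hd' hc'

theorem DefAdd.quotient [DefAdd L M A] {B : AddSubgroup A} (hB : DefSet L M (B : Set A)) :
    letI := Coded.quotient L M hB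
    DefAdd L M (A ⧸ B) := by
  let _ := Coded.quotient L M hB
  have hmk := DefMap.quotient_mk hB
  refine ⟨DefMap.of_graph (s := {x : ((A ⧸ B) × (A ⧸ B)) × (A ⧸ B) | ∃ p : A × A,
    (p.1 : A ⧸ B) = x.1.1 ∧ (p.2 : A ⧸ B) = x.1.2 ∧ ((p.1 + p.2 : A) : A ⧸ B) = x.2})
    (DefSet.exists (p := fun (x : ((A ⧸ B) × (A ⧸ B)) × (A ⧸ B)) (p : A × A) =>
      (p.1 : A ⧸ B) = x.1.1 ∧ (p.2 : A ⧸ B) = x.1.2 ∧ ((p.1 + p.2 : A) : A ⧸ B) = x.2) ?_) ?_⟩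
  · exact (DefSet.eq (hmk.comp DefMap.id.snd.fst) DefMap.id.fst.fst.fst).and
      ((DefSet.eq (hmk.comp DefMap.id.snd.snd) DefMap.id.fst.fst.snd).and
        (DefSet.eq (hmk.comp (DefMap.id.snd.fst.add DefMap.id.snd.snd)) DefMap.id.fst.snd))
  · rintro ⟨x, y⟩ z
    constructor
    · rintro rfl
      obtain ⟨a, rfl⟩ := QuotientAddGroup.mk_surjective x
      obtain ⟨b, rfl⟩ := QuotientAddGroup.mk_surjective y
      exact ⟨(a, b), rfl, rfl, rfl⟩
    · rintro ⟨⟨a, b⟩, rfl, rfl, rfl⟩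
      rfl

section Quotient

variable {B : AddSubgroup A} (h : MinimalPair L M Γ Δ) (hB : B = BiKat Γ Δ)

include h hB

theorem MinimalPair.exists_induces_left {γ : Endogeny A} (hγ : γ ∈ Γ.carrier) :
    ∃ f : AddMonoid.End (A ⧸ B), Induces γ f :=
  exists_induces (hB ▸ h.image_BiKat_le hγ)

theorem MinimalPair.exists_induces_right {δ : Endogeny A} (hδ : δ ∈ Δ.carrier) :
    ∃ f : AddMonoid.End (A ⧸ B), Induces δ f :=
  h.symm.exists_induces_left (hB.trans (sup_comm _ _)) hδ

/-- The endomorphisms induced by sharply commuting endogenies commute. -/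
theorem MinimalPair.commute {f g : AddMonoid.End (A ⧸ B)} (hf : f ∈ inducedRing Γ B)
    (hg : g ∈ inducedRing Δ B) : f * g = g * f := by
  obtain ⟨γ, hγ, hf⟩ := hf
  obtain ⟨δ, hδ, hg⟩ := hg
  ext v
  obtain ⟨a, rfl⟩ := QuotientAddGroup.mk_surjective v
  obtain ⟨z, hz⟩ := δ.total a
  obtain ⟨b, hb⟩ := γ.total z
  obtain ⟨y, hy⟩ := γ.total a
  obtain ⟨c, hc⟩ := δ.total y
  change f (g (a : A ⧸ B)) = g (f (a : A ⧸ B))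
  rw [hg a z hz, hf z b hb, hf a y hy, hg y c hc, QuotientAddGroup.eq, ← sub_eq_neg_add, ← neg_sub]
  have := sup_le_sup (kat_le_Kat hγ) (kat_le_Kat hδ)
    (sharplyCommute_iff.1 (h.sharp hγ hδ) a b c ⟨z, hz, hb⟩ ⟨y, hy, hc⟩)
  exact neg_mem (hB ▸ this)

variable (hfin : (B : Set A).Finite)

include hfin

omit hB in
theorem MinimalPair.defMap_induced {f : AddMonoid.End (A ⧸ B)} [DefAdd L M A]
    (hf : f ∈ inducedRing Γ B) :
    letI := Coded.quotient L M (DefSet.of_finite hfin)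
    DefMap L M f := by
  let _ := Coded.quotient L M (DefSet.of_finite hfin)
  have hmk := DefMap.quotient_mk (DefSet.of_finite (L := L) (M := M) hfin)
  obtain ⟨γ, hγ, hf⟩ := hf
  refine DefMap.of_graph (s := {x | ∃ p : A × A, p ∈ γ.graph ∧ (p.1 : A ⧸ B) = x.1 ∧
    (p.2 : A ⧸ B) = x.2}) (DefSet.exists
      (p := fun (x : (A ⧸ B) × (A ⧸ B)) (p : A × A) => p ∈ γ.graph ∧
        (p.1 : A ⧸ B) = x.1 ∧ (p.2 : A ⧸ B) = x.2) ?_) fun x y => ?_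
  · exact ((h.defSet hγ).mem DefMap.id.snd).and ((DefSet.eq (hmk.comp DefMap.id.snd.fst)
      DefMap.id.fst.fst).and (DefSet.eq (hmk.comp DefMap.id.snd.snd) DefMap.id.fst.snd))
  · constructor
    · rintro rfl
      obtain ⟨a, rfl⟩ := QuotientAddGroup.mk_surjective x
      obtain ⟨b, hb⟩ := γ.total a
      exact ⟨(a, b), hb, rfl, (hf a b hb).symm⟩
    · rintro ⟨⟨a, b⟩, hp, rfl, rfl⟩
      exact hf a b hp

/-- A definable endomorphism of the quotient that commutes with the endomorphisms induced by `Δ`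
lifts to an element of `Γ`. -/
theorem MinimalPair.liftEnd_mem {f : AddMonoid.End (A ⧸ B)} [DefAdd L M A]
    (hfdef : letI := Coded.quotient L M (DefSet.of_finite hfin); DefMap L M f)
    (hf : ∀ g ∈ inducedRing Δ B, f * g = g * f) : liftEnd hfin f ∈ Γ.carrier := by
  let _ := Coded.quotient L M (DefSet.of_finite hfin)
  have hmk := DefMap.quotient_mk (DefSet.of_finite (L := L) (M := M) hfin)
  refine (h.mem_left _).2 ⟨?_, fun δ hδ => ?_⟩
  · exact DefSet.eq (hfdef.comp (hmk.comp DefMap.id.fst)) (hmk.comp DefMap.id.snd)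
  · rw [sharplyCommute_iff, kat_liftEnd]
    rintro a b c ⟨z, hz, hb⟩ ⟨y, hy, hc⟩
    obtain ⟨g, hg⟩ := h.exists_induces_right hB hδ
    have hfg : f (g (a : A ⧸ B)) = g (f (a : A ⧸ B)) :=
      DFunLike.congr_fun (hf g ⟨δ, hδ, hg⟩) _
    rw [hg a z hz, mem_liftEnd.1 hb, mem_liftEnd.1 hy, hg y c hc, QuotientAddGroup.eq,
      ← sub_eq_neg_add] at hfg
    rw [← neg_sub]
    exact neg_mem (AddSubgroup.mem_sup_left hfg)

/-- A finite subgroup of the quotient that is invariant under `Δ` is trivial, because it is the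
image of a katakernel of `Γ`. -/
theorem MinimalPair.eq_zero_of_finite {F : AddSubgroup (A ⧸ B)}
    (hF : (F : Set (A ⧸ B)).Finite)
    (hinv : ∀ g ∈ inducedRing Δ B, ∀ x ∈ F, g x ∈ F) : ∀ x ∈ F, x = 0 := by
  let F' : AddSubgroup A := F.comap (QuotientAddGroup.mk' B)
  have hF' : (F' : Set A).Finite := by
    refine Set.Finite.preimage' (f := fun a : A => (a : A ⧸ B)) hF fun x _ => ?_
    obtain ⟨a, rfl⟩ := QuotientAddGroup.mk_surjective x
    refine (hfin.image fun b => a + b).subset fun c hc => ?_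
    have hc' : (c : A ⧸ B) = (a : A ⧸ B) := hc
    exact ⟨-a + c, QuotientAddGroup.eq.1 hc'.symm, add_neg_cancel_left a c⟩
  have hmem := h.const_mem hF' fun δ hδ => by
    rintro b ⟨a, ha, hb⟩
    obtain ⟨g, hg⟩ := h.exists_induces_right hB hδ
    refine AddSubgroup.mem_sup_left ?_
    change (b : A ⧸ B) ∈ F
    rw [← hg a b hb]
    exact hinv g ⟨δ, hδ, hg⟩ _ ha
  intro x hx
  obtain ⟨a, rfl⟩ := QuotientAddGroup.mk_surjective x
  refine (QuotientAddGroup.eq_zero_iff a).2 (hB ▸ AddSubgroup.mem_sup_left (kat_le_Kat hmem ?_))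
  rw [kat_const]
  exact hx

/-- On elements of `Γ`, equivalence to zero means inducing zero on the quotient: a finite image is
invariant under `Δ`, hence trivial. -/
theorem MinimalPair.class_eq_zero_iff {γ : Endogeny A} (hγ : γ ∈ Γ.carrier)
    {f : AddMonoid.End (A ⧸ B)} (hf : Induces γ f) : EndogRing.mk γ = 0 ↔ f = 0 := by
  rw [Endogeny.class_eq_zero_iff]
  constructor
  · intro hγfin
    have hrange : (endRange f : Set (A ⧸ B)).Finite := by
      refine (hγfin.image fun a : A => (a : A ⧸ B)).subset ?_
      rintro _ ⟨v, rfl⟩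
      obtain ⟨a, rfl⟩ := QuotientAddGroup.mk_surjective v
      obtain ⟨b, hb⟩ := γ.total a
      exact ⟨b, ⟨a, trivial, hb⟩, (hf a b hb).symm⟩
    ext v
    refine h.eq_zero_of_finite hB hfin hrange ?_ _ ⟨v, rfl⟩
    rintro g hg _ ⟨v, rfl⟩
    exact ⟨g v, DFunLike.congr_fun (h.commute hB ⟨γ, hγ, hf⟩ hg) v⟩
  · rintro rfl
    refine hfin.subset ?_
    rintro b ⟨a, -, hb⟩
    exact (QuotientAddGroup.eq_zero_iff b).1 (hf a b hb).symm

theorem MinimalPair.class_eq_iff {γ γ' : Endogeny A} (hγ : γ ∈ Γ.carrier) (hγ' : γ' ∈ Γ.carrier)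
    {f f' : AddMonoid.End (A ⧸ B)} (hf : Induces γ f) (hf' : Induces γ' f') :
    EndogRing.mk γ = EndogRing.mk γ' ↔ f = f' := by
  rw [← sub_eq_zero, ← mk_sub, h.class_eq_zero_iff hB hfin (Γ.sub_mem hγ hγ') (hf.sub hf'),
    sub_eq_zero]

/-- The finite form of primeness passes from `Γ` to the ring that it induces on the quotient. -/
theorem MinimalPair.prime_induced [DefAdd L M A] [Tame L M] {f : AddMonoid.End (A ⧸ B)}
    (hf : f ∈ inducedRing Γ B) (hf₀ : f ≠ 0) :
    (∃ Z : Finset (AddMonoid.End (A ⧸ B)), (∀ z ∈ Z, z ∈ inducedRing Γ B) ∧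
      ∀ x ∈ inducedRing Γ B, (∀ z ∈ Z, x * z * f = 0) → x = 0) ∧
    ∃ Z : Finset (AddMonoid.End (A ⧸ B)), (∀ z ∈ Z, z ∈ inducedRing Γ B) ∧
      ∀ x ∈ inducedRing Γ B, (∀ z ∈ Z, f * z * x = 0) → x = 0 := by
  classical
  obtain ⟨γ, hγ, hγf⟩ := hf
  choose! ι hι using fun (γ : Endogeny A) (hγ : γ ∈ Γ.carrier) => h.exists_induces_left hB hγ
  have hγ₀ := mt (h.class_eq_zero_iff hB hfin hγ hγf).1 hf₀
  constructor
  · obtain ⟨Z, hZ, hZ'⟩ := h.prime_right hγ hγ₀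
    refine ⟨Z.image ι, fun z hz => ?_, ?_⟩
    · obtain ⟨ζ, hζ, rfl⟩ := Finset.mem_image.1 hz
      exact ⟨ζ, hZ hζ, hι ζ (hZ hζ)⟩
    · rintro x ⟨ξ, hξ, hξx⟩ hx
      refine (h.class_eq_zero_iff hB hfin hξ hξx).1 (hZ' ξ fun ζ hζ => ?_)
      exact (h.class_eq_zero_iff hB hfin (Γ.mul_mem (Γ.mul_mem hξ (hZ hζ)) hγ)
        ((hξx.mul (hι ζ (hZ hζ))).mul hγf)).2 (hx _ (Finset.mem_image_of_mem ι hζ))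
  · obtain ⟨Z, hZ, hZ'⟩ := h.prime_left hγ hγ₀
    refine ⟨Z.image ι, fun z hz => ?_, ?_⟩
    · obtain ⟨ζ, hζ, rfl⟩ := Finset.mem_image.1 hz
      exact ⟨ζ, hZ hζ, hι ζ (hZ hζ)⟩
    · rintro x ⟨ξ, hξ, hξx⟩ hx
      refine (h.class_eq_zero_iff hB hfin hξ hξx).1 (hZ' ξ fun ζ hζ => ?_)
      exact (h.class_eq_zero_iff hB hfin (Γ.mul_mem (Γ.mul_mem hγ (hZ hζ)) hξ)
        ((hγf.mul (hι ζ (hZ hζ))).mul hξx)).2 (hx _ (Finset.mem_image_of_mem ι hζ))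

/-- The rings induced by `Γ` and `Δ` on the quotient are exact commutants of each other. -/
theorem MinimalPair.commutantPair [DefAdd L M A] [Tame L M] :
    letI := Coded.quotient L M (DefSet.of_finite hfin)
    CommutantPair L M (inducedRing Γ B) (inducedRing Δ B) := by
  let _ := Coded.quotient L M (DefSet.of_finite hfin)
  have hB' : B = BiKat Δ Γ := hB.trans (sup_comm _ _)
  refine ⟨fun f => ⟨fun hf => ⟨h.defMap_induced hfin hf, fun g hg => h.commute hB hf hg⟩,
    fun hf => ⟨_, h.liftEnd_mem hB hfin hf.1 hf.2, induces_liftEnd hfin⟩⟩,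
    fun g => ⟨fun hg => ⟨h.symm.defMap_induced hfin hg,
      fun f hf => h.symm.commute hB' hg hf⟩,
    fun hg => ⟨_, h.symm.liftEnd_mem hB' hfin hg.1 hg.2, induces_liftEnd hfin⟩⟩,
    fun F hF hinv => h.eq_zero_of_finite hB hfin hF hinv,
    fun f hf hf₀ => (h.prime_induced hB hfin hf hf₀).1,
    fun f hf hf₀ => (h.prime_induced hB hfin hf hf₀).2⟩

end Quotient

end Induced

/-! ### The ring of classes and its action -/

section FieldOfClasses

open Endogeny

/-- Rings isomorphic to rings of endomorphisms act by the corresponding endomorphisms. -/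
theorem exists_modules {V E : Type*} [AddCommGroup V] [Ring E] {R S T : Subring (AddMonoid.End V)}
    {Q N K : Subring E} (e : R ≃+* Q) (e' : S ≃+* N) (ε : T ≃+* K) (hTR : T ≤ R) (hTS : T ≤ S)
    (hcomm : ∀ f ∈ R, ∀ g ∈ S, f * g = g * f) (hfin : Module.Finite T V) :
    ∃ (_ : Module K V) (_ : Module Q V) (_ : Module N V), Module.Finite K V ∧
      SMulCommClass Q K V ∧ SMulCommClass N K V ∧ (∀ (k : K) v, k • v = (ε.symm k).1 v) ∧
      (∀ (s : Q) v, s • v = (e.symm s).1 v) ∧ ∀ (s : N) v, s • v = (e'.symm s).1 v := by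
  let mK : Module K V := Module.compHom V ε.symm.toRingHom
  let mQ : Module Q V := Module.compHom V e.symm.toRingHom
  let mN : Module N V := Module.compHom V e'.symm.toRingHom
  refine ⟨mK, mQ, mN, ?_, ⟨fun s k v => ?_⟩, ⟨fun s k v => ?_⟩,
    fun _ _ => rfl, fun _ _ => rfl, fun _ _ => rfl⟩
  · obtain ⟨t, ht⟩ := hfin.fg_top
    refine ⟨⟨t, eq_top_iff.2 fun v _ => ?_⟩⟩
    have hv : v ∈ Submodule.span T (t : Set V) := by
      rw [ht]; trivial
    induction hv using Submodule.span_induction with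
    | mem v hv => exact Submodule.subset_span hv
    | zero => exact Submodule.zero_mem _
    | add v v' _ _ h1 h2 => exact Submodule.add_mem _ (h1 trivial) (h2 trivial)
    | smul f v _ h1 =>
      have : f • v = ε f • v := by
        change f.1 v = (ε.symm (ε f)).1 v
        rw [ε.symm_apply_apply]
      rw [this]
      exact Submodule.smul_mem _ _ (h1 trivial)
  · exact DFunLike.congr_fun (hcomm _ (e.symm s).2 _ (hTS (ε.symm k).2)) v
  · exact (DFunLike.congr_fun (hcomm _ (hTR (ε.symm k).2) _ (e'.symm s).2) v).symm

section Classes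

variable {L : FirstOrder.Language.{u, v}} {M : Type w} [L.Structure M]
variable {A : Type w} [Coded L M A] [AddCommGroup A] [DefAdd L M A] {Γ Δ : PreSubring A}
variable {B : AddSubgroup A} (h : MinimalPair L M Γ Δ) (hB : B = BiKat Γ Δ)
  (hfin : (B : Set A).Finite)

include h hB

theorem MinimalPair.liftEnd_mem_of_mem {f : AddMonoid.End (A ⧸ B)} (hf : f ∈ inducedRing Γ B) :
    liftEnd hfin f ∈ Γ.carrier :=
  h.liftEnd_mem hB hfin (h.defMap_induced hfin hf) fun _ hg => h.commute hB hf hg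

/-- The ring induced by `Γ` on the quotient is the ring of the classes of the elements of `Γ`. -/
theorem MinimalPair.exists_ringEquiv : ∃ e : inducedRing Γ B ≃+* Γ.quot,
    ∀ f, (e f : EndogRing A) = EndogRing.mk (liftEnd hfin f.1) := by
  have hmem := fun f : inducedRing Γ B => h.liftEnd_mem_of_mem hB hfin f.2
  have hind := fun f : inducedRing Γ B => induces_liftEnd (f := f.1) hfin
  let e₀ : inducedRing Γ B →+* Γ.quot :=
    { toFun := fun f => ⟨EndogRing.mk (liftEnd hfin f.1), _, hmem f, rfl⟩
      map_zero' := Subtype.ext <| (h.class_eq_iff hB hfin (hmem 0) Γ.zero_mem (hind 0)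
        Induces.zero).2 rfl
      map_one' := Subtype.ext <| (h.class_eq_iff hB hfin (hmem 1) Γ.one_mem (hind 1)
        Induces.one).2 rfl
      map_add' := fun f g => Subtype.ext <| (h.class_eq_iff hB hfin (hmem (f + g))
        (Γ.add_mem (hmem f) (hmem g)) (hind (f + g)) ((hind f).add (hind g))).2 rfl
      map_mul' := fun f g => Subtype.ext <| (h.class_eq_iff hB hfin (hmem (f * g))
        (Γ.mul_mem (hmem f) (hmem g)) (hind (f * g)) ((hind f).mul (hind g))).2 rfl }
  refine ⟨RingEquiv.ofBijective e₀ ⟨fun f g hfg => Subtype.ext ?_, ?_⟩, fun f => rfl⟩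
  · exact (h.class_eq_iff hB hfin (hmem f) (hmem g) (hind f) (hind g)).1
      (Subtype.ext_iff.1 hfg)
  · rintro ⟨_, γ, hγ, rfl⟩
    obtain ⟨f, hf⟩ := h.exists_induces_left hB hγ
    exact ⟨⟨f, γ, hγ, hf⟩, Subtype.ext <| (h.class_eq_iff hB hfin (hmem ⟨f, γ, hγ, hf⟩) hγ
      (hind ⟨f, γ, hγ, hf⟩) hf).2 rfl⟩

/-- The classes of the endogenies inducing the endomorphisms that are induced both by `Γ` and by
`Δ` form a ring. -/
theorem MinimalPair.exists_ringEquiv_inf : ∃ (K : Subring (EndogRing A))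
    (e : (inducedRing Γ B ⊓ inducedRing Δ B : Subring _) ≃+* K),
    ∀ f, (e f : EndogRing A) = EndogRing.mk (liftEnd hfin f.1) := by
  obtain ⟨e, he⟩ := h.exists_ringEquiv hB hfin
  let κ : (inducedRing Γ B ⊓ inducedRing Δ B : Subring _) →+* EndogRing A :=
    (Γ.quot.subtype.comp e.toRingHom).comp (Subring.inclusion inf_le_left)
  have hκ : Function.Injective κ :=
    (Subtype.val_injective.comp e.injective).comp (Subring.inclusion_injective inf_le_left)
  exact ⟨κ.range, RingEquiv.ofBijective κ.rangeRestrict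
    ⟨fun f g hfg => hκ (by simpa using congrArg Subtype.val hfg),
      κ.rangeRestrict_surjective⟩, fun f => he _⟩

/-- A uniformly definable family of elements of `Γ` with arbitrarily many inequivalent members
induces an infinite type-definable family on the quotient. -/
theorem MinimalPair.exists_isFamily [Tame L M] {β : Type w} [Coded L M β] {Y : Set β}
    {c : β → Endogeny A} {Φ : Set (β × (A × A))} (hY : TypeDef L M Y) (hΦ : DefSet L M Φ)
    (hc : ∀ y ∈ Y, c y ∈ Γ.carrier ∧ ∀ p, p ∈ (c y).graph ↔ (y, p) ∈ Φ)
    (hlarge : ∀ m, ∃ b : Fin m → β, (∀ i, b i ∈ Y) ∧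
      ∀ i i', i ≠ i' → ¬ Equivalent (c (b i)) (c (b i'))) :
    letI := Coded.quotient L M (DefSet.of_finite hfin)
    ∃ G : Set (AddMonoid.End (A ⧸ B)), IsFamily L M G ∧ G ⊆ inducedRing Γ B ∧ G.Infinite := by
  let _ := Coded.quotient L M (DefSet.of_finite hfin)
  have hmk := DefMap.quotient_mk (DefSet.of_finite (L := L) (M := M) hfin)
  have hgraph : ∀ y ∈ Y, ∀ g : AddMonoid.End (A ⧸ B), Induces (c y) g → ∀ u v,
      (y, (u, v)) ∈ {x : β × ((A ⧸ B) × (A ⧸ B)) | ∃ p : A × A, (x.1, p) ∈ Φ ∧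
        (p.1 : A ⧸ B) = x.2.1 ∧ (p.2 : A ⧸ B) = x.2.2} ↔ g u = v := by
    intro y hy g hg u v
    constructor
    · rintro ⟨⟨a, b⟩, hp, rfl, rfl⟩
      exact hg a b (((hc y hy).2 _).2 hp)
    · rintro rfl
      obtain ⟨a, rfl⟩ := QuotientAddGroup.mk_surjective u
      obtain ⟨b, hb⟩ := (c y).total a
      exact ⟨(a, b), ((hc y hy).2 _).1 hb, rfl, (hg a b hb).symm⟩
  refine ⟨{g | ∃ y ∈ Y, Induces (c y) g}, ⟨β, _, Y, _, hY, DefSet.exists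
    (p := fun (x : β × ((A ⧸ B) × (A ⧸ B))) (p : A × A) => (x.1, p) ∈ Φ ∧
      (p.1 : A ⧸ B) = x.2.1 ∧ (p.2 : A ⧸ B) = x.2.2) ?_, fun y hy => ?_, ?_⟩, ?_, fun hGfin => ?_⟩
  · exact (hΦ.mem (DefMap.id.fst.fst.prodMk DefMap.id.snd)).and
      ((DefSet.eq (hmk.comp DefMap.id.snd.fst) DefMap.id.fst.snd.fst).and
        (DefSet.eq (hmk.comp DefMap.id.snd.snd) DefMap.id.fst.snd.snd))
  · obtain ⟨g, hg⟩ := h.exists_induces_left hB (hc y hy).1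
    exact ⟨g, ⟨y, hy, hg⟩, hgraph y hy g hg⟩
  · rintro g ⟨y, hy, hg⟩
    exact ⟨y, hy, hgraph y hy g hg⟩
  · rintro g ⟨y, hy, hg⟩
    exact ⟨c y, (hc y hy).1, hg⟩
  -- inequivalent members induce different endomorphisms
  · obtain ⟨b, hb, hne⟩ := hlarge ({g : AddMonoid.End (A ⧸ B) | ∃ y ∈ Y, Induces (c y) g}.ncard + 1)
    choose g hg using fun i => h.exists_induces_left hB (hc (b i) (hb i)).1
    have hinj : Function.Injective g := by
      intro i i' hii
      by_contra hne'
      refine hne i i' hne' (EndogRing.mk_eq_mk.1 ?_)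
      exact (h.class_eq_iff hB hfin (hc _ (hb i)).1 (hc _ (hb i')).1 (hg i) (hg i')).2 hii
    have h1 := Set.ncard_le_ncard (s := Set.range g)
      (t := {g : AddMonoid.End (A ⧸ B) | ∃ y ∈ Y, Induces (c y) g})
      (by
        rintro _ ⟨i, rfl⟩
        exact ⟨b i, hb i, hg i⟩) hGfin
    rw [← Set.image_univ, Set.ncard_image_of_injective _ hinj, Set.ncard_univ, Nat.card_fin] at h1
    omega

/-- The field of scalars, as a ring of classes of endogenies. -/
theorem MinimalPair.exists_field [Tame L M] {β : Type w} [Coded L M β] {Y : Set β}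
    {c : β → Endogeny A} {Φ : Set (β × (A × A))} (hY : TypeDef L M Y) (hΦ : DefSet L M Φ)
    (hc : ∀ y ∈ Y, c y ∈ Γ.carrier ∧ ∀ p, p ∈ (c y).graph ↔ (y, p) ∈ Φ)
    (hlarge : ∀ m, ∃ b : Fin m → β, (∀ i, b i ∈ Y) ∧
      ∀ i i', i ≠ i' → ¬ Equivalent (c (b i)) (c (b i'))) :
    ∃ (K : Subring (EndogRing A)) (_ : Module K (A ⧸ B)) (_ : Module Γ.quot (A ⧸ B))
      (_ : Module Δ.quot (A ⧸ B)), IsField K ∧ Infinite K ∧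
      (∃ ε : (inducedRing Γ B ⊓ inducedRing Δ B : Subring _) ≃+* K,
        ∀ f, (ε f : EndogRing A) = EndogRing.mk (liftEnd hfin f.1)) ∧
      K ≤ Γ.quot ⊓ Δ.quot ∧
      IsInducedAction Γ.carrier B Γ.quot ∧ IsInducedAction Δ.carrier B Δ.quot ∧
      IsInducedAction (Γ.carrier ∪ Δ.carrier) B K ∧ Module.Finite K (A ⧸ B) ∧
      SMulCommClass Γ.quot K (A ⧸ B) ∧ SMulCommClass Δ.quot K (A ⧸ B) ∧
      letI := Coded.quotient L M (DefSet.of_finite hfin)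
      ∃ a : A ⧸ B, (∀ f ∈ inducedRing Γ B ⊓ inducedRing Δ B, f a = 0 → f = 0) ∧
        DefSet L M {x : (A ⧸ B) × ((A ⧸ B) × (A ⧸ B)) |
          ∃ f ∈ inducedRing Γ B ⊓ inducedRing Δ B, f a = x.1 ∧ f x.2.1 = x.2.2} := by
  let _ := Coded.quotient L M (DefSet.of_finite hfin)
  have := DefAdd.quotient (L := L) (M := M) (DefSet.of_finite hfin)
  have hB' : B = BiKat Δ Γ := hB.trans (sup_comm _ _)
  obtain ⟨G, hG, hGR, hGinf⟩ := h.exists_isFamily hB hfin hY hΦ hc hlarge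
  obtain ⟨hdiv, hinf, hfg, a₀, ha₀, hact⟩ := (h.commutantPair hB hfin).field hG hGR hGinf
  obtain ⟨e, he⟩ := h.exists_ringEquiv hB hfin
  obtain ⟨e', he'⟩ := h.symm.exists_ringEquiv hB' hfin
  obtain ⟨K, ε, hκ⟩ := h.exists_ringEquiv_inf hB hfin
  have hmemΓ : ∀ f ∈ inducedRing Γ B, liftEnd hfin f ∈ Γ.carrier := fun f hf =>
    h.liftEnd_mem_of_mem hB hfin hf
  have hmemΔ : ∀ f ∈ inducedRing Δ B, liftEnd hfin f ∈ Δ.carrier := fun f hf =>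
    h.symm.liftEnd_mem_of_mem hB' hfin hf
  have hε : ∀ s : K, (s : EndogRing A) = EndogRing.mk (liftEnd hfin (ε.symm s).1) := by
    intro s
    obtain ⟨f, rfl⟩ := ε.surjective s
    rw [ε.symm_apply_apply]
    exact hκ f
  obtain ⟨mK, mΓ, mΔ, hfinK, hsΓ, hsΔ, hK, hΓ, hΔ⟩ := exists_modules e e' ε inf_le_left
    inf_le_right (fun f hf g hg => h.commute hB hf hg) hfg
  refine ⟨K, mK, mΓ, mΔ, ?_, ?_, ⟨ε, hκ⟩, ?_, ?_, ?_, ?_, hfinK, hsΓ, hsΔ, a₀,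
    fun f hf => hdiv.eq_zero hf ha₀, hact⟩
  · refine MulEquiv.isField (B := (inducedRing Γ B ⊓ inducedRing Δ B : Subring _)) ?_
      ε.symm.toMulEquiv
    refine ⟨?_, fun f g => Subtype.ext (h.commute hB f.2.1 g.2.2), fun {f} hf => ?_⟩
    · have := hinf.to_subtype
      exact (Infinite.instNontrivial ((inducedRing Γ B ⊓ inducedRing Δ B : Subring
        (AddMonoid.End (A ⧸ B))) : Set (AddMonoid.End (A ⧸ B)))).exists_pair_ne
    · obtain ⟨g, hg, hfg, -⟩ := hdiv f.1 f.2 fun h0 => hf (Subtype.ext h0)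
      exact ⟨⟨g, hg⟩, Subtype.ext hfg⟩
  · have : Infinite (inducedRing Γ B ⊓ inducedRing Δ B : Subring _) := hinf.to_subtype
    exact Infinite.of_injective ε ε.injective
  · intro s hs
    have h1 : s = EndogRing.mk (liftEnd hfin (ε.symm ⟨s, hs⟩).1) := hε ⟨s, hs⟩
    rw [h1]
    exact ⟨⟨_, hmemΓ _ (ε.symm ⟨s, hs⟩).2.1, rfl⟩, ⟨_, hmemΔ _ (ε.symm ⟨s, hs⟩).2.2, rfl⟩⟩
  · intro γ hγ s hs a b hab
    obtain ⟨f, hf⟩ := h.exists_induces_left hB hγ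
    have hsf : s = e ⟨f, γ, hγ, hf⟩ := Subtype.ext <| hs.trans <| by
      rw [he]
      exact ((h.class_eq_iff hB hfin hγ (hmemΓ f ⟨γ, hγ, hf⟩) hf (induces_liftEnd hfin)).2 rfl)
    rw [hΓ, hsf, e.symm_apply_apply]
    exact hf a b hab
  · intro δ hδ s hs a b hab
    obtain ⟨f, hf⟩ := h.exists_induces_right hB hδ
    have hsf : s = e' ⟨f, δ, hδ, hf⟩ := Subtype.ext <| hs.trans <| by
      rw [he']
      exact ((h.symm.class_eq_iff hB' hfin hδ (hmemΔ f ⟨δ, hδ, hf⟩) hf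
        (induces_liftEnd hfin)).2 rfl)
    rw [hΔ, hsf, e'.symm_apply_apply]
    exact hf a b hab
  · rintro γ hγ s hs a b hab
    rw [hε] at hs
    rw [hK]
    rcases hγ with hγ | hγ
    · obtain ⟨f, hf⟩ := h.exists_induces_left hB hγ
      have := (h.class_eq_iff hB hfin (hmemΓ _ (ε.symm s).2.1) hγ (induces_liftEnd hfin) hf).1 hs
      rw [this]
      exact hf a b hab
    · obtain ⟨f, hf⟩ := h.exists_induces_right hB hγ
      have := (h.symm.class_eq_iff hB' hfin (hmemΔ _ (ε.symm s).2.2) hγ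
        (induces_liftEnd hfin) hf).1 hs
      rw [this]
      exact hf a b hab

end Classes

end FieldOfClasses

/-! ### Groups of tuples -/

section TupleGroups

open Endogeny

section Tuples

variable {L : FirstOrder.Language.{u, v}} {M : Type w} [L.Structure M]
variable {α β γ : Type w} [Coded L M α] [Coded L M β] [Coded L M γ]

theorem DefSet.image_iff {e : α → β} (he : DefMap L M e) (hinj : Function.Injective e) {s : Set α} :
    DefSet L M (e '' s) ↔ DefSet L M s :=
  ⟨fun h => (he.preimage h).of_eq (hinj.preimage_image s), fun h => h.image he⟩

theorem DefMap.sumElim {ι ι' : Type} [Finite ι] [Finite ι'] {f : α → ι → M} {g : α → ι' → M}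
    (hf : DefMap L M f) (hg : DefMap L M g) : DefMap L M fun x => Sum.elim (f x) (g x) := by
  refine DefMap.pi ?_
  rintro (i | i)
  · exact hf.apply i
  · exact hg.apply i

theorem sumElim_injective {ι ι' X : Type*} {f f' : ι → X} {g g' : ι' → X}
    (h : Sum.elim f g = Sum.elim f' g') : f = f' ∧ g = g' :=
  ⟨funext fun i => congrFun h (Sum.inl i), funext fun i => congrFun h (Sum.inr i)⟩

variable {n : ℕ} {A : Set (Fin n → M)} [AddCommGroup A] [Coded L M A]
  (hval : DefMap L M (Subtype.val : A → Fin n → M))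

include hval

theorem isDefinableSubgroup_iff {B : AddSubgroup A} :
    IsDefinableSubgroup L B ↔ DefSet L M (B : Set A) := by
  rw [← DefSet.image_iff hval Subtype.val_injective, defSet_tuple_iff, IsDefinableSubgroup]
  refine iff_of_eq (congrArg (Set.univ.Definable L) ?_)
  ext x
  exact ⟨fun ⟨a, ha, h⟩ => ⟨a, ha, h.symm⟩, fun ⟨a, ha, h⟩ => ⟨a, ha, h.symm⟩⟩

theorem isDefinableEndogeny_iff {φ : Endogeny A} :
    IsDefinableEndogeny L φ ↔ DefSet L M (φ.graph : Set (A × A)) := by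
  rw [← DefSet.image_iff (e := fun p : A × A => (Sum.elim p.1.1 p.2.1 : Fin n ⊕ Fin n → M))
    ((hval.comp DefMap.id.fst).sumElim (hval.comp DefMap.id.snd)) fun p q h =>
      Prod.ext (Subtype.ext (sumElim_injective h).1) (Subtype.ext (sumElim_injective h).2),
    defSet_tuple_iff, IsDefinableEndogeny]
  refine iff_of_eq (congrArg (Set.univ.Definable L) ?_)
  ext x
  exact ⟨fun ⟨a, b, hab, h⟩ => ⟨(a, b), hab, h.symm⟩, fun ⟨p, hp, h⟩ => ⟨p.1, p.2, hp, h.symm⟩⟩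

theorem IsDefinableGroup.defAdd (hA : IsDefinableGroup L A) : DefAdd L M A := by
  constructor
  change DefSet L M {p : (A × A) × A | p.1.1 + p.1.2 = p.2}
  rw [← DefSet.image_iff (e := fun p : (A × A) × A =>
      (Sum.elim (Sum.elim p.1.1.1 p.1.2.1) p.2.1 : (Fin n ⊕ Fin n) ⊕ Fin n → M))
    (((hval.comp DefMap.id.fst.fst).sumElim (hval.comp DefMap.id.fst.snd)).sumElim
      (hval.comp DefMap.id.snd)) fun p q h => ?_, defSet_tuple_iff]
  · refine hA.2.of_eq ?_
    ext x
    constructor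
    · rintro ⟨a, b, rfl⟩
      exact ⟨((a, b), a + b), rfl, rfl⟩
    · rintro ⟨⟨⟨a, b⟩, c⟩, h, rfl⟩
      obtain rfl : a + b = c := h
      exact ⟨a, b, rfl⟩
  · have h1 := sumElim_injective h
    have h2 := sumElim_injective h1.1
    exact Prod.ext (Prod.ext (Subtype.ext h2.1) (Subtype.ext h2.2)) (Subtype.ext h1.2)

/-- The hypotheses on `Γ` and `Δ`, in terms of tuples, say that they form a minimal pair in terms
of the coded type `A`. -/
theorem minimalPair_of_tuples {Γ Δ : PreSubring A}
    (hΓΔ : sharpCommutant L Γ.carrier = Δ.carrier) (hΔΓ : sharpCommutant L Δ.carrier = Γ.carrier)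
    (hmin : AbsolutelyMinimal L (Γ.carrier ∪ Δ.carrier)) : MinimalPair L M Γ Δ where
  mem_left φ := by
    rw [← hΔΓ, ← isDefinableEndogeny_iff hval]
    rfl
  mem_right φ := by
    rw [← hΓΔ, ← isDefinableEndogeny_iff hval]
    rfl
  minimal B hB hΓ hΔ := by
    refine (hmin B ((isDefinableSubgroup_iff hval).2 hB) ?_).imp_right fun h => h.index_ne_zero
    rintro γ (hγ | hγ)
    · exact ⟨hΓ γ hγ⟩
    · exact ⟨hΔ γ hγ⟩

/-- A ring of endomorphisms of the quotient, whose action is definable when its elements are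
given by their values at a vector `a₀`, gives a definable ring of classes of endogenies: the
endomorphism `f` is indexed by the points of the coset `f a₀`. -/
theorem isDefinableSubring_of_action [DefAdd L M A] {B : AddSubgroup A} (hfin : (B : Set A).Finite)
    {Q : Subring (AddMonoid.End (A ⧸ B))} {K : Subring (EndogRing A)} (e : Q ≃+* K)
    (he : ∀ f, (e f : EndogRing A) = EndogRing.mk (liftEnd hfin f.1)) {a₀ : A ⧸ B}
    (ha₀ : ∀ f ∈ Q, f a₀ = 0 → f = 0)
    (hact : letI := Coded.quotient L M (DefSet.of_finite hfin)
      DefSet L M {x : (A ⧸ B) × ((A ⧸ B) × (A ⧸ B)) | ∃ f ∈ Q, f a₀ = x.1 ∧ f x.2.1 = x.2.2}) :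
    IsDefinableSubring L K := by
  let _ := Coded.quotient L M (DefSet.of_finite hfin)
  have hmk := DefMap.quotient_mk (DefSet.of_finite (L := L) (M := M) hfin)
  have hadd := DefAdd.quotient (L := L) (M := M) (DefSet.of_finite hfin)
  let D : Set A := {a | ∃ f ∈ Q, f a₀ = (a : A ⧸ B)}
  let Θ : Set (A × (A × A)) :=
    {x | ∃ f ∈ Q, f a₀ = (x.1 : A ⧸ B) ∧ f (x.2.1 : A ⧸ B) = (x.2.2 : A ⧸ B)}
  have hΘ : DefSet L M Θ := hact.mem (f := fun x : A × (A × A) =>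
    ((x.1 : A ⧸ B), ((x.2.1 : A ⧸ B), (x.2.2 : A ⧸ B)))) ((hmk.comp DefMap.id.fst).prodMk
      ((hmk.comp DefMap.id.snd.fst).prodMk (hmk.comp DefMap.id.snd.snd)))
  have hD : DefSet L M D := by
    refine (hΘ.mem (f := fun a : A => (a, ((0 : A), (0 : A)))) (DefMap.id.prodMk
      ((DefMap.const 0).prodMk (DefMap.const 0)))).of_eq ?_
    ext a
    exact ⟨fun ⟨f, hf, h, _⟩ => ⟨f, hf, h⟩, fun ⟨f, hf, h⟩ => ⟨f, hf, h, map_zero f⟩⟩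
  -- `F a` is the unique element of `Q` with value the coset of `a` at `a₀`, for `a` in the
  -- definable set `D` of indices.
  choose! F hFQ hF using fun (a : A) (ha : a ∈ D) => ha
  have hFeq : ∀ a ∈ D, ∀ f ∈ Q, f a₀ = (a : A ⧸ B) → f = F a := fun a ha f hf hfa =>
    sub_eq_zero.1 (ha₀ _ (Q.sub_mem hf (hFQ a ha)) (sub_eq_zero.2 (hfa.trans (hF a ha).symm)))
  have hPA : ∀ p ∈ Subtype.val '' D, p ∈ A := by
    rintro _ ⟨a, -, rfl⟩
    exact a.2
  have hPD : ∀ p (hp : p ∈ Subtype.val '' D), (⟨p, hPA p hp⟩ : A) ∈ D := by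
    rintro _ ⟨a, ha, rfl⟩
    exact ha
  let c : (Subtype.val '' D : Set (Fin n → M)) → Endogeny A := fun p =>
    liftEnd hfin (F ⟨p.1, hPA p.1 p.2⟩)
  let toP : ∀ a ∈ D, (Subtype.val '' D : Set (Fin n → M)) := fun a ha => ⟨a.1, a, ha, rfl⟩
  have hce : ∀ p, ∃ a, ∃ ha : a ∈ D, p = toP a ha ∧
      EndogRing.mk (c p) = e ⟨F a, hFQ a ha⟩ := by
    intro p
    exact ⟨⟨p.1, hPA p.1 p.2⟩, hPD p.1 p.2, rfl,
      (he ⟨F ⟨p.1, hPA p.1 p.2⟩, hFQ _ (hPD p.1 p.2)⟩).symm⟩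
  have hce' : ∀ a (ha : a ∈ D), EndogRing.mk (c (toP a ha)) = e ⟨F a, hFQ a ha⟩ := fun a ha =>
    (he ⟨F a, hFQ a ha⟩).symm
  refine ⟨n, Subtype.val '' D, c, defSet_tuple_iff.1 (hD.image hval), ?_, ?_, ?_, ?_, ?_⟩
  · refine Set.Definable.of_eq (defSet_tuple_iff.1 (hΘ.image (f := fun x : A × (A × A) =>
      (Sum.elim x.1.1 (Sum.elim x.2.1.1 x.2.2.1) : Fin n ⊕ (Fin n ⊕ Fin n) → M))
        ((hval.comp DefMap.id.fst).sumElim ((hval.comp DefMap.id.snd.fst).sumElim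
          (hval.comp DefMap.id.snd.snd))))) ?_
    ext q
    constructor
    · rintro ⟨⟨a, x, y⟩, ⟨f, hf, hfa, hfx⟩, rfl⟩
      have ha : a ∈ D := ⟨f, hf, hfa⟩
      obtain rfl := hFeq a ha f hf hfa
      exact ⟨toP a ha, _, ⟨x, y, hfx, rfl⟩, rfl⟩
    · rintro ⟨p, _, ⟨x, y, hxy, rfl⟩, rfl⟩
      exact ⟨(⟨p.1, hPA p.1 p.2⟩, (x, y)), ⟨_, hFQ _ (hPD p.1 p.2), hF _ (hPD p.1 p.2), hxy⟩, rfl⟩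
  · ext s
    constructor
    · rintro ⟨p, rfl⟩
      obtain ⟨a, ha, -, h⟩ := hce p
      have h1 := (e ⟨F a, hFQ a ha⟩).2
      rwa [← h] at h1
    · intro hs
      obtain ⟨a, ha⟩ := QuotientAddGroup.mk_surjective ((e.symm ⟨s, hs⟩).1 a₀)
      have haD : a ∈ D := ⟨_, (e.symm ⟨s, hs⟩).2, ha.symm⟩
      refine ⟨toP a haD, (hce' a haD).trans ?_⟩
      have h1 : (⟨F a, hFQ a haD⟩ : Q) = e.symm ⟨s, hs⟩ :=
        Subtype.ext (hFeq a haD _ (e.symm ⟨s, hs⟩).2 ha.symm).symm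
      rw [h1, e.apply_symm_apply]
  · have h1 : DefSet L M {x : A × A | x.1 ∈ D ∧ (x.1 : A ⧸ B) = (x.2 : A ⧸ B)} :=
      (hD.mem DefMap.id.fst).and (DefSet.eq (hmk.comp DefMap.id.fst) (hmk.comp DefMap.id.snd))
    refine Set.Definable.of_eq (defSet_tuple_iff.1 (h1.image (f := fun x : A × A =>
      (Sum.elim x.1.1 x.2.1 : Fin n ⊕ Fin n → M))
        ((hval.comp DefMap.id.fst).sumElim (hval.comp DefMap.id.snd)))) ?_
    ext q
    constructor
    · rintro ⟨⟨a, b⟩, ⟨ha, hab⟩, rfl⟩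
      have hb : b ∈ D := ⟨F a, hFQ a ha, (hF a ha).trans hab⟩
      refine ⟨toP a ha, toP b hb, rfl, ?_⟩
      have h2 := hFeq b hb (F a) (hFQ a ha) ((hF a ha).trans hab)
      rw [hce' a ha, hce' b hb, Subtype.ext (a1 := ⟨F a, hFQ a ha⟩) (a2 := ⟨F b, hFQ b hb⟩) h2]
    · rintro ⟨p₁, p₂, rfl, h2⟩
      obtain ⟨a, ha, rfl, h3⟩ := hce p₁
      obtain ⟨b, hb, rfl, h4⟩ := hce p₂
      refine ⟨(a, b), ⟨ha, ?_⟩, rfl⟩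
      have h5 : F a = F b := congrArg Subtype.val
        (e.injective (Subtype.ext (h3.symm.trans (h2.trans h4))))
      exact (hF a ha).symm.trans ((DFunLike.congr_fun h5 a₀).trans (hF b hb))
  · have h1 : DefSet L M {x : (A × A) × A | (x.1.1 ∈ D ∧ x.1.2 ∈ D) ∧
        ((x.1.1 : A ⧸ B) + (x.1.2 : A ⧸ B) : A ⧸ B) = (x.2 : A ⧸ B)} :=
      ((hD.mem DefMap.id.fst.fst).and (hD.mem DefMap.id.fst.snd)).and
        (DefSet.eq ((hmk.comp DefMap.id.fst.fst).add (hmk.comp DefMap.id.fst.snd))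
          (hmk.comp DefMap.id.snd))
    refine Set.Definable.of_eq (defSet_tuple_iff.1 (h1.image (f := fun x : (A × A) × A =>
      (Sum.elim (Sum.elim x.1.1.1 x.1.2.1) x.2.1 : (Fin n ⊕ Fin n) ⊕ Fin n → M))
        (((hval.comp DefMap.id.fst.fst).sumElim (hval.comp DefMap.id.fst.snd)).sumElim
          (hval.comp DefMap.id.snd)))) ?_
    ext q
    constructor
    · rintro ⟨⟨⟨a, b⟩, d⟩, ⟨⟨ha, hb⟩, habd⟩, rfl⟩
      have hQ := Q.add_mem (hFQ a ha) (hFQ b hb)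
      have hFd : (F a + F b) a₀ = (d : A ⧸ B) :=
        (congrArg₂ (· + ·) (hF a ha) (hF b hb)).trans habd
      have hd : d ∈ D := ⟨_, hQ, hFd⟩
      refine ⟨toP a ha, toP b hb, toP d hd, rfl, ?_⟩
      have h2 : (⟨F a, hFQ a ha⟩ + ⟨F b, hFQ b hb⟩ : Q) = ⟨F d, hFQ d hd⟩ :=
        Subtype.ext (hFeq d hd _ hQ hFd)
      rw [hce' a ha, hce' b hb, hce' d hd, ← h2, map_add]
      rfl
    · rintro ⟨p₁, p₂, p₃, rfl, h2⟩
      obtain ⟨a, ha, rfl, h3⟩ := hce p₁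
      obtain ⟨b, hb, rfl, h4⟩ := hce p₂
      obtain ⟨d, hd, rfl, h5⟩ := hce p₃
      refine ⟨((a, b), d), ⟨⟨ha, hb⟩, ?_⟩, rfl⟩
      rw [h3, h4, h5] at h2
      have h6 : (⟨F a, hFQ a ha⟩ + ⟨F b, hFQ b hb⟩ : Q) = ⟨F d, hFQ d hd⟩ :=
        e.injective (Subtype.ext (by rw [map_add]; exact h2))
      have h7 : F a a₀ + F b a₀ = F d a₀ := DFunLike.congr_fun (congrArg Subtype.val h6) a₀
      rwa [hF a ha, hF b hb, hF d hd] at h7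
  · have h1 : DefSet L M {x : (A × A) × A | x.1.2 ∈ D ∧ (x.1.1, (x.1.2, x.2)) ∈ Θ} :=
      (hD.mem DefMap.id.fst.snd).and (hΘ.mem (DefMap.id.fst.fst.prodMk
        (DefMap.id.fst.snd.prodMk DefMap.id.snd)))
    refine Set.Definable.of_eq (defSet_tuple_iff.1 (h1.image (f := fun x : (A × A) × A =>
      (Sum.elim (Sum.elim x.1.1.1 x.1.2.1) x.2.1 : (Fin n ⊕ Fin n) ⊕ Fin n → M))
        (((hval.comp DefMap.id.fst.fst).sumElim (hval.comp DefMap.id.fst.snd)).sumElim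
          (hval.comp DefMap.id.snd)))) ?_
    ext q
    constructor
    · rintro ⟨⟨⟨a, b⟩, d⟩, ⟨hb, f, hf, hfa, hfb⟩, rfl⟩
      have ha : a ∈ D := ⟨f, hf, hfa⟩
      obtain rfl := hFeq a ha f hf hfa
      have hQ := Q.mul_mem (hFQ a ha) (hFQ b hb)
      have hFd : (F a * F b) a₀ = (d : A ⧸ B) := (congrArg (F a) (hF b hb)).trans hfb
      have hd : d ∈ D := ⟨_, hQ, hFd⟩
      refine ⟨toP a ha, toP b hb, toP d hd, rfl, ?_⟩
      have h2 : (⟨F a, hFQ a ha⟩ * ⟨F b, hFQ b hb⟩ : Q) = ⟨F d, hFQ d hd⟩ :=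
        Subtype.ext (hFeq d hd _ hQ hFd)
      rw [hce' a ha, hce' b hb, hce' d hd, ← h2, map_mul]
      rfl
    · rintro ⟨p₁, p₂, p₃, rfl, h2⟩
      obtain ⟨a, ha, rfl, h3⟩ := hce p₁
      obtain ⟨b, hb, rfl, h4⟩ := hce p₂
      obtain ⟨d, hd, rfl, h5⟩ := hce p₃
      refine ⟨((a, b), d), ⟨hb, F a, hFQ a ha, hF a ha, ?_⟩, rfl⟩
      rw [h3, h4, h5] at h2
      have h6 : (⟨F a, hFQ a ha⟩ * ⟨F b, hFQ b hb⟩ : Q) = ⟨F d, hFQ d hd⟩ :=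
        e.injective (Subtype.ext (by rw [map_mul]; exact h2))
      have h7 : F a (F b a₀) = F d a₀ := DFunLike.congr_fun (congrArg Subtype.val h6) a₀
      rwa [hF b hb, hF d hd] at h7

end Tuples

end TupleGroups

/-! ### The field of classes of endogenies -/

section Conclusion

open Endogeny

section

variable {L : FirstOrder.Language.{u, v}} {M : Type w} [L.Structure M] [Tame L M]

/-- In a tame structure, if `Γ` is the essentially unbounded one of the two pre-rings, the common
part of the rings of classes is a definable field as required. -/
theorem exists_isDefinableSubring
    (hL : Cardinal.lift.{w} L.card < Cardinal.lift.{max u v} (Tame.κ L M))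
    {n : ℕ} {A : Set (Fin n → M)} [AddCommGroup A] (hA : IsDefinableGroup L A)
    {X : Set M} (hX : #X < Tame.κ L M) {Γ Δ : PreSubring A}
    (hΓ : IsInvariantOver L X Γ.carrier)
    (hΓΔ : sharpCommutant L Γ.carrier = Δ.carrier)
    (hΔΓ : sharpCommutant L Δ.carrier = Γ.carrier)
    (hmin : AbsolutelyMinimal L (Γ.carrier ∪ Δ.carrier))
    (hunb : EssentiallyUnbounded L X Γ.carrier) (hinf : EssentiallyInfinite Δ.carrier)
    {B : AddSubgroup A} (hB : B = BiKat Γ Δ) :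
    ∃ (K : Subring (EndogRing A)) (_ : Module K (A ⧸ B)) (_ : Module Γ.quot (A ⧸ B))
      (_ : Module Δ.quot (A ⧸ B)),
      IsField K ∧ Infinite K ∧ IsDefinableSubring L K ∧ K ≤ Γ.quot ⊓ Δ.quot ∧
      IsInducedAction Γ.carrier B Γ.quot ∧ IsInducedAction Δ.carrier B Δ.quot ∧
      IsInducedAction (Γ.carrier ∪ Δ.carrier) B K ∧ Module.Finite K (A ⧸ B) ∧
      SMulCommClass Γ.quot K (A ⧸ B) ∧ SMulCommClass Δ.quot K (A ⧸ B) := by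
  let _ : Coded L M A := Coded.subtype L M (defSet_tuple_iff.2 hA.1)
  have hval : DefMap L M (Subtype.val : A → Fin n → M) :=
    IsCoord.defMap ⟨fun i => i, fun c x h => h⟩
  have := IsDefinableGroup.defAdd hval hA
  have h := minimalPair_of_tuples hval hΓΔ hΔΓ hmin
  obtain ⟨k, Y, c, Φ, hY, hΦ, hc, hlarge⟩ := hunb.exists_family hL hA hval hX hΓ
  have hfin : (B : Set A).Finite := by
    rw [hB]
    exact finite_sup (h.finite_Kat_left hinf hY hΦ hc hlarge) (h.finite_Kat_right hY hΦ hc hlarge)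
  obtain ⟨K, mK, mΓ, mΔ, hfield, hK, ⟨ε, hε⟩, hle, h1, h2, h3, h4, h5, h6, a₀, ha₀, hact⟩ :=
    h.exists_field hB hfin hY hΦ hc hlarge
  exact ⟨K, mK, mΓ, mΔ, hfield, hK, isDefinableSubring_of_action hval hfin ε hε ha₀ hact, hle,
    h1, h2, h3, h4, h5, h6⟩

end

/-- An essentially infinite set of endogenies lives on a group of tuples of a non-empty set. -/
theorem EssentiallyInfinite.nonempty {M : Type w} {n : ℕ} {A : Set (Fin n → M)} [AddCommGroup A]
    {Γ : Set (Endogeny A)} (h : EssentiallyInfinite Γ) : Nonempty M := by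
  by_contra hM
  have := not_nonempty_iff.1 hM
  have : Finite (Endogeny A) :=
    Finite.of_injective (fun φ => (φ.graph : Set (A × A))) fun φ ψ hφ =>
      Endogeny.ext (SetLike.coe_injective hφ)
  exact h ((Set.toFinite Γ).image _)

end Conclusion

end Endogenies

theorem theoremB {L : FirstOrder.Language.{u, v}} (T : L.Theory)
    (hT : Endogenies.FiniteDimensionalTheory.{u, v, w} T)
    (M : Type w) [L.Structure M] [M ⊨ T]
    (κ : Cardinal.{w}) (hκ : ℵ₀ < κ)
    (hL : Cardinal.lift.{w} L.card < Cardinal.lift.{max u v} κ)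
    (hM : Endogenies.IsSaturated L M κ)
    (n : ℕ) (A : Set (Fin n → M)) [AddCommGroup A] (hA : Endogenies.IsDefinableGroup L A)
    (X : Set M) (hX : #X < κ)
    (Γ Δ : Endogenies.PreSubring A)
    (hΓ : Endogenies.IsInvariantOver L X Γ.carrier)
    (hΔ : Endogenies.IsInvariantOver L X Δ.carrier)
    (hΓΔ : Endogenies.sharpCommutant L Γ.carrier = Δ.carrier)
    (hΔΓ : Endogenies.sharpCommutant L Δ.carrier = Γ.carrier)
    (hmin : Endogenies.AbsolutelyMinimal L (Γ.carrier ∪ Δ.carrier))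
    (hlarge :
      (Endogenies.EssentiallyUnbounded L X Γ.carrier ∧
        Endogenies.EssentiallyInfinite Δ.carrier) ∨
      (Endogenies.EssentiallyUnbounded L X Δ.carrier ∧
        Endogenies.EssentiallyInfinite Γ.carrier))
    (A₀ : AddSubgroup A) (hA₀ : A₀ = Endogenies.BiKat Γ Δ) :
    ∃ (K : Subring (Endogenies.EndogRing A)) (_ : Module K (A ⧸ A₀))
      (_ : Module Γ.quot (A ⧸ A₀)) (_ : Module Δ.quot (A ⧸ A₀)),
      IsField K ∧ Infinite K ∧ Endogenies.IsDefinableSubring L K ∧ K ≤ Γ.quot ⊓ Δ.quot ∧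
      Endogenies.IsInducedAction Γ.carrier A₀ Γ.quot ∧
      Endogenies.IsInducedAction Δ.carrier A₀ Δ.quot ∧
      Endogenies.IsInducedAction (Γ.carrier ∪ Δ.carrier) A₀ K ∧
      Module.Finite K (A ⧸ A₀) ∧
      SMulCommClass Γ.quot K (A ⧸ A₀) ∧ SMulCommClass Δ.quot K (A ⧸ A₀) := by
  -- A dimension on the models of `T` and saturation make `M` tame; if `Δ` is the essentially
  -- unbounded pre-ring, exchange the roles of `Γ` and `Δ`.
  obtain ⟨D⟩ := hT
  have hne : Nonempty M := hlarge.elim (fun h => h.2.nonempty) (fun h => h.2.nonempty)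
  let _ : Endogenies.Tame L M := D.tame hκ hM
  rcases hlarge with ⟨hunb, hinf⟩ | ⟨hunb, hinf⟩
  · exact Endogenies.exists_isDefinableSubring hL hA hX hΓ hΓΔ hΔΓ hmin hunb hinf hA₀
  · obtain ⟨K, mK, mΔ, mΓ, hfield, hK, hdef, hle, h1, h2, h3, h4, h5, h6⟩ :=
      Endogenies.exists_isDefinableSubring hL hA hX hΔ hΔΓ hΓΔ
        (by rwa [Set.union_comm]) hunb hinf (hA₀.trans (sup_comm _ _))
    refine ⟨K, mK, mΓ, mΔ, hfield, hK, hdef, ?_, h2, h1, ?_, h4, h6, h5⟩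
    · rwa [inf_comm]
    · rwa [Set.union_comm]
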